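/- Let $d$ be a dimension, $t_*>0$, $\nu\ge 0$ and $K\in L^\infty(\mathbb{R}^d,\mathbb{R}^d)$. **Extended graphons.** Let $w\in L^\infty_\xi\mathcal{M}_\zeta\cap L^\infty_\zeta\mathcal{M}_\xi$, that is, $\xi\mapsto w(\xi,d\zeta)$ and $\zeta\mapsto w(d\xi,\zeta)$ are weak-star measurable families, essentially bounded in total variation, of finite signed Borel measures on $[0,1]$, which induce the same measure $w(\xi,d\zeta)\,d\xi=w(d\xi,\zeta)\,d\zeta$ on $[0,1]^2$. **Weak solutions.** Let $f=f(t,x,\xi)\in L^\infty([0,t_*],L^\infty_\xi L^1_x)$ be real valued (that is, $f$ is measurable on $(0,t_*)\times\mathbb{R}^d\times[0,1]$ and $\operatorname{ess\,sup}_{t,\xi}\int_{\mathbb{R}^d}|f(t,x,\xi)|\,dx<\infty$), and put $$\mathcal V_f(t,x,\xi)=\int_0^1 w(\xi,d\zeta)\int_{\mathbb{R}^d}K(x-y)\,f(t,y,\zeta)\,dy .$$ Assume that $(w,f)$ is a weak solution of $\partial_t f+\operatorname{div}_x(f\,\mathcal V_f)=\nu\Delta_x f$, i.e. for every $\varphi\in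 C^2_c((0,t_*)\times[0,1]\times\mathbb{R}^d)$ $$\int_0^{t_*}\!\!\int_0^1\!\!\int_{\mathbb{R}^d}\big(\partial_t\varphi+\nabla_x\varphi\cdot\mathcal V_f+\nu\,\Delta_x\varphi\big)\,f\,dx\,d\xi\,dt=0 .$$ **Observables.** Labeled trees are defined recursively: $T_1$ is the tree with the single vertex $1$ (the root); if $T$ is a labeled tree with vertices $1,\dots,n$ and $1\le i\le n$, then $T+i$ is the labeled tree with vertices $1,\dots,n+1$ obtained by attaching the new vertex $n+1$ to $i$ as a leaf. Write $|T|$ for the number of vertices and $(k,l)\in T$ for an edge oriented away from the root. Put $$\tau(T,w,f)(t,x_1,\dots,x_{|T|})=\int_{[0,1]^{|T|}}\ \prod_{(k,l)\in T}w(\xi_k,d\xi_l)\ \prod_{m=1}^{|T|}f(t,x_m,\xi_m)\ d\xi_1 ,$$ an iterated integral in which $\xi_1$ is integrated against Lebesgue measure and, for every edge $(k,l)\in T$, the variable $\xi_l$ is integrated against $w(\xi_k,\cdot)$. **Conclusion.** For every labeled tree $T$, $\tau(T,w,f)\in L^\infty([0,t_*],L^1(\mathbb{R}^{d|T|}))$,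 and $$\partial_t\tau(T,w,f)+\sum_{i=1}^{|T|}\operatorname{div}_{x_i}\Big(\int_{\mathbb{R}^d}K(x_i-z)\,\tau(T+i,w,f)(t,x_1,\dots,x_{|T|},z)\,dz\Big)=\nu\sum_{i=1}^{|T|}\Delta_{x_i}\tau(T,w,f)$$ in the sense of distributions on $(0,t_*)\times\mathbb{R}^{d|T|}$. -/

import Mathlib

open MeasureTheory Set Filter Topology
open scoped unitInterval NNReal ENNReal ContDiff Laplacian

noncomputable section

/-- Euclidean space `ℝ^d`. -/
abbrev Space (d : ℕ) : Type := EuclideanSpace ℝ (Fin d)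

/-- Labeled trees of order `n`, with vertices `0, …, n - 1` and root `0`: the tree with a single
vertex, and, for a tree `T` of order `n` and a vertex `i` of `T`, the tree `T + i` of order `n + 1`
obtained by attaching the new vertex `n` to `i` as a leaf. -/
inductive LabeledTree : ℕ → Type
  | single : LabeledTree 1
  | addLeaf {n : ℕ} (T : LabeledTree n) (i : Fin n) : LabeledTree (n + 1)

/-- The weak-star Bochner space `L^∞_ξ M_ζ`: families `ξ ↦ w ξ` of finite signed Borel measures on
`[0,1]` that are weak-star measurable and essentially bounded in total variation. -/
def MemLinftyM (w : I → SignedMeasure I) : Prop :=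
  (∀ φ : C(I, ℝ), AEMeasurable (fun ξ => ∫ᵛ ζ, φ ζ ∂<•(w ξ)) volume) ∧
    ∃ C : ℝ≥0, ∀ᵐ ξ : I, (w ξ).variation univ ≤ C

/-- Extended graphons, i.e. elements of `L^∞_ξ M_ζ ∩ L^∞_ζ M_ξ`. Here `w ξ` is `w(ξ, dζ)`, and
`w' ζ` is `w(dξ, ζ)`; the two families define the same measure
`w(ξ, dζ) dξ = w(dξ, ζ) dζ` on `[0,1]²`. -/
def IsExtendedGraphon (w : I → SignedMeasure I) : Prop :=
  MemLinftyM w ∧ ∃ w' : I → SignedMeasure I, MemLinftyM w' ∧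
    ∀ Φ : C(I × I, ℝ),
      ∫ ξ : I, ∫ᵛ ζ, Φ (ξ, ζ) ∂<•(w ξ) = ∫ ζ : I, ∫ᵛ ξ, Φ (ξ, ζ) ∂<•(w' ζ)

/-- `f ∈ L^∞([0,t_*], L^∞_ξ L^1_x)`, for `f = f(t, x, ξ)`. -/
def MemLinftyLinftyL1 {d : ℕ} (tstar : ℝ) (f : ℝ → Space d → I → ℝ) : Prop :=
  AEStronglyMeasurable (fun p : ℝ × Space d × I => f p.1 p.2.1 p.2.2)
      ((volume.restrict (Ioo 0 tstar)).prod (volume.prod volume)) ∧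
    ∃ C : ℝ≥0, ∀ᵐ p : ℝ × I ∂((volume.restrict (Ioo 0 tstar)).prod volume),
      ∫⁻ x, ‖f p.1 x p.2‖ₑ ≤ C

/-- `h ∈ L^∞([0,t_*], L^1(ℝ^{dn}))`, for `h = h(t, x₁, …, x_n)`. -/
def MemLinftyL1 {d n : ℕ} (tstar : ℝ) (h : ℝ → (Fin n → Space d) → ℝ) : Prop :=
  AEStronglyMeasurable (fun p : ℝ × (Fin n → Space d) => h p.1 p.2)
      ((volume.restrict (Ioo 0 tstar)).prod volume) ∧
    ∃ C : ℝ≥0, ∀ᵐ t ∂(volume.restrict (Ioo 0 tstar)), ∫⁻ x, ‖h t x‖ₑ ≤ C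

/-- The velocity field
`V_f(t, x, ξ) = ∫_0^1 w(ξ, dζ) ∫_{ℝ^d} K(x - y) f(t, y, ζ) dy`. -/
def velocity {d : ℕ} (K : Space d → Space d) (w : I → SignedMeasure I)
    (f : ℝ → Space d → I → ℝ) (t : ℝ) (x : Space d) (ξ : I) : Space d :=
  ∫ᵛ ζ, (∫ y, f t y ζ • K (x - y)) ∂<•(w ξ)

/-- Weak formulation of
`∂_t f + div_x (f V_f) = ν Δ_x f` on `(0,t_*) × [0,1] × ℝ^d`. The test functions are the `C²`
functions with compact support in `(0,t_*) × ℝ^d × [0,1]`, given as restrictions to `ξ ∈ [0,1]`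
of `C²` functions with compact support in `(0,t_*) × ℝ^d × ℝ`. -/
def IsWeakSolution {d : ℕ} (K : Space d → Space d) (ν tstar : ℝ) (w : I → SignedMeasure I)
    (f : ℝ → Space d → I → ℝ) : Prop :=
  ∀ φ : ℝ × Space d × ℝ → ℝ, ContDiff ℝ 2 φ → HasCompactSupport φ →
    tsupport φ ⊆ Ioo 0 tstar ×ˢ univ →
    (∫ t in Ioo 0 tstar, ∫ ξ : I, ∫ x, deriv (fun s => φ (s, x, ξ)) t * f t x ξ)
      + (∫ t in Ioo 0 tstar, ∫ ξ : I, ∫ x,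
          fderiv ℝ (fun y => φ (t, y, ξ)) x (velocity K w f t x ξ) * f t x ξ)
      + ν * (∫ t in Ioo 0 tstar, ∫ ξ : I, ∫ x, Δ (fun y => φ (t, y, ξ)) x * f t x ξ) = 0

/-- The integral of `g(ξ₁, …, ξ_n)` against `∏_{(k,l) ∈ T} w(ξ_k, dξ_l) dξ₁`, where the product
is over the edges of `T` oriented away from the root `1`, as an iterated integral. -/
def treeIntegral (w : I → SignedMeasure I) : {n : ℕ} → LabeledTree n → ((Fin n → I) → ℝ) → ℝ
  | _, .single, g => ∫ ξ : I, g (fun _ => ξ)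
  | _, .addLeaf T i, g =>
      treeIntegral w T fun ξ => ∫ᵛ ζ, g (Fin.snoc (α := fun _ => I) ξ ζ) ∂<•(w (ξ i))

/-- The observable
`τ(T,w,f)(x₁, …, x_n) = ∫_{[0,1]^n} ∏_{(k,l) ∈ T} w(ξ_k, ξ_l) ∏_m f(x_m, ξ_m) dξ₁ ⋯ dξ_n`. -/
def tau {d n : ℕ} (T : LabeledTree n) (w : I → SignedMeasure I) (f : Space d → I → ℝ)
    (x : Fin n → Space d) : ℝ :=
  treeIntegral w T fun ξ => ∏ m, f (x m) (ξ m)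

/-- `h = h(t, x₁, …, x_n)` and `J_i = J_i(t, x₁, …, x_n)` satisfy
`∂_t h + ∑_i div_{x_i} J_i = ν ∑_i Δ_{x_i} h` in the sense of distributions on
`(0,t_*) × ℝ^{dn}`. -/
def SolvesInDistributions {d n : ℕ} (ν tstar : ℝ) (h : ℝ → (Fin n → Space d) → ℝ)
    (J : Fin n → ℝ → (Fin n → Space d) → Space d) : Prop :=
  ∀ φ : ℝ × (Fin n → Space d) → ℝ, ContDiff ℝ ∞ φ → HasCompactSupport φ →
    tsupport φ ⊆ Ioo 0 tstar ×ˢ univ →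
    (∫ t in Ioo 0 tstar, ∫ x, deriv (fun s => φ (s, x)) t * h t x)
      + (∑ i, ∫ t in Ioo 0 tstar, ∫ x,
          fderiv ℝ (fun y => φ (t, Function.update x i y)) (x i) (J i t x))
      + ν * (∑ i, ∫ t in Ioo 0 tstar, ∫ x,
          Δ (fun y => φ (t, Function.update x i y)) (x i) * h t x) = 0

end

/-! For fixed labels, the Leibniz rule shows formally that the tensor product `∏ f(t, x_m, ξ_m)`
solves a transport-diffusion equation whose velocity in the variable `x_i` is `V_f(t, x_i, ξ_i)`.
Integrate it against `∏ w(ξ_k, dξ_l) dξ₁`. The integral over `ζ` and `z` hidden in `V_f(t, x_i,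
ξ_i)` amounts to one more leaf attached at `i`, so the `i`-th flux is `∫ K(x_i - z) τ(T + i) dz`.
Two points need care.

The first is null sets of labels: `f` is known only for almost every label, while `w(ξ, ·)` may be
singular. `IsExtendedGraphon.exists_kernel` writes `w(ξ, dζ) = s(ξ, ζ) κ(ξ, dζ)` with `s` bounded
and `κ` a Markov kernel that sends Lebesgue measure to an absolutely continuous measure; the latter
comes from the second family `w(dξ, ζ)`. The tree then carries a probability measure on the labels
with absolutely continuous one-dimensional marginals (`quasiMeasurePreserving_eval_treeMeasure`),
and the signed iterated integral becomes an ordinary integral with a bounded weight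
(`treeIntegral_eq_integral`). Hence `f`, `K` and `V_f` can be replaced by bounded measurable
representatives.

The second is that a product of weak solutions must be differentiated. Paired with a fixed `b(x)`,
the solution is for almost every label an absolutely continuous function of time, up to a null set
of times (`ae_exists_ae_eq_const_add_integral`). The product rule for such functions gives the
hierarchy for test functions `θ(t) ∏ b_m(x_m)` (`IsWeakSolution.integral_weight_mul_testFactor`). A
general test function `φ` is reached by mollification: use a tensor mollifier centred at `x`
together with `θ = φ(·, x)`, integrate over `x`, move the derivatives onto `φ` by parts, and let the
mollifier concentrate (`integral_mul_testOperator_eq_zero`). The velocity stays a frozen vector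
throughout, so only its measurability and boundedness matter. -/

noncomputable section

open ProbabilityTheory

/-! ### Variation of signed measures and integration against a bounded signed density -/

section SignedMeasure

variable {X : Type*} [MeasurableSpace X]

instance SignedMeasure.isFiniteMeasure_variation (μ : SignedMeasure X) :
    IsFiniteMeasure μ.variation := by
  rw [← SignedMeasure.totalVariation_eq_variation, SignedMeasure.totalVariation]
  infer_instance

lemma SignedMeasure.integral_indicator_one (μ : SignedMeasure X) {A : Set X}
    (hA : MeasurableSet A) :
    ∫ᵛ x, A.indicator (fun _ => (1 : ℝ)) x ∂<•μ = μ A := by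
  rw [VectorMeasure.integral_indicator hA, VectorMeasure.setIntegral_const]
  simp

/-- On a Hahn decomposition, the masses that the two Jordan parts give to `A` are, up to sign,
values of `μ` on two pieces of `A`. This turns a bound on set values into a bound on the variation,
at the cost of a factor `2`. -/
lemma SignedMeasure.variation_le_two_mul {m : ℝ≥0∞} (μ : SignedMeasure X) {A : Set X}
    (hA : MeasurableSet A) (h : ∀ E, MeasurableSet E → E ⊆ A → ‖μ E‖ₑ ≤ m) :
    μ.variation A ≤ 2 * m := by
  obtain ⟨s, hs, hpos, hneg⟩ := μ.toJordanDecomposition.mutuallySingular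
  have e1 : μ.toJordanDecomposition.posPart A = ‖μ (A ∩ sᶜ)‖ₑ := by
    have h1 : μ.toJordanDecomposition.posPart (A ∩ sᶜ) = μ.toJordanDecomposition.posPart A :=
      measure_inter_conull (by simpa using hpos)
    have h2 : μ.toJordanDecomposition.negPart (A ∩ sᶜ) = 0 :=
      measure_mono_null inter_subset_right hneg
    rw [μ.apply_eq_posPart_real_sub_negPart_real (hA.inter hs.compl), measureReal_def,
      measureReal_def, h1, h2]
    simp [Real.enorm_of_nonneg]
  have e2 : μ.toJordanDecomposition.negPart A = ‖μ (A ∩ s)‖ₑ := by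
    have h1 : μ.toJordanDecomposition.negPart (A ∩ s) = μ.toJordanDecomposition.negPart A :=
      measure_inter_conull hneg
    have h2 : μ.toJordanDecomposition.posPart (A ∩ s) = 0 :=
      measure_mono_null inter_subset_right hpos
    rw [μ.apply_eq_posPart_real_sub_negPart_real (hA.inter hs), measureReal_def,
      measureReal_def, h1, h2]
    simp [enorm_neg, Real.enorm_of_nonneg]
  rw [← SignedMeasure.totalVariation_eq_variation, SignedMeasure.totalVariation,
    Measure.add_apply, e1, e2, two_mul]
  exact add_le_add (h _ (hA.inter hs.compl) inter_subset_left)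
    (h _ (hA.inter hs) inter_subset_left)

/-- Split `s` into positive and negative parts. Since `s` is bounded, `g` is integrable against both
resulting positive measures, and the two integrals may be subtracted. -/
lemma SignedMeasure.integral_withDensityᵥ {E : Type*} [NormedAddCommGroup E] [NormedSpace ℝ E]
    [CompleteSpace E]
    (μ : Measure X) [IsFiniteMeasure μ] {s : X → ℝ} (hs : Measurable s) {C : ℝ}
    (hsC : ∀ x, |s x| ≤ C) {g : X → E} (hg : Integrable g μ) :
    ∫ᵛ x, g x ∂<•(μ.withDensityᵥ s) = ∫ x, s x • g x ∂μ := by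
  have hsi : Integrable s μ := Integrable.of_bound hs.aestronglyMeasurable C
    (Eventually.of_forall hsC)
  have hfin (r : X → ℝ) (hr : Measurable r) (hrC : ∀ x, |r x| ≤ C) :
      Integrable (fun x => (ENNReal.ofReal (r x)).toReal • g x) μ :=
    hg.bdd_smul C (φ := fun x => (ENNReal.ofReal (r x)).toReal)
      hr.ennreal_ofReal.ennreal_toReal.aestronglyMeasurable
      (Eventually.of_forall fun x => by
        rw [ENNReal.toReal_ofReal', Real.norm_eq_abs, abs_of_nonneg (le_max_right _ _)]
        exact max_le ((le_abs_self _).trans (hrC x)) ((abs_nonneg _).trans (hrC x)))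
  have hint (r : X → ℝ) (hr : Measurable r) (hrC : ∀ x, |r x| ≤ C) :
      Integrable g (μ.withDensity fun x => ENNReal.ofReal (r x)) := by
    rw [integrable_withDensity_iff_integrable_smul' (by fun_prop) (by simp)]
    exact hfin r hr hrC
  have h1 := isFiniteMeasure_withDensity_ofReal hsi.2
  have h2 := isFiniteMeasure_withDensity_ofReal hsi.neg.2
  have hs' : ∀ x, |(-s) x| ≤ C := by simpa using hsC
  rw [withDensityᵥ_eq_withDensity_pos_part_sub_withDensity_neg_part hsi,
    VectorMeasure.integral_sub_vectorMeasure, VectorMeasure.integral_toSignedMeasure,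
    VectorMeasure.integral_toSignedMeasure, integral_withDensity_eq_integral_toReal_smul,
    integral_withDensity_eq_integral_toReal_smul, ← integral_sub]
  · refine integral_congr_ae (Eventually.of_forall fun x => ?_)
    simp only [← sub_smul, ENNReal.toReal_ofReal']
    congr 1
    rcases le_total 0 (s x) with h | h <;> simp [h]
  · exact hfin s hs hsC
  · exact hfin (-s) hs.neg hs'
  · fun_prop
  · simp
  · fun_prop
  · simp
  · simpa [VectorMeasure.Integrable] using hint s hs hsC
  · simpa [VectorMeasure.Integrable] using hint (-s) hs.neg hs'

end SignedMeasure

/-! ### The signed measure on the square defined by a graphon -/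

section Graphon

/-- Graphons are only tested against continuous functions; this gives access to closed sets, which
form a π-system generating the Borel sets. -/
lemma exists_continuousMap_tendsto_indicator {F : Set I} (hF : IsClosed F) :
    ∃ φ : ℕ → C(I, ℝ), (∀ k x, |φ k x| ≤ 1) ∧
      ∀ x, Tendsto (fun k => φ k x) atTop (𝓝 (F.indicator (fun _ => (1 : ℝ)) x)) := by
  refine ⟨fun k => ⟨fun x => (hF.apprSeq k x : ℝ), by fun_prop⟩, fun k x => ?_, fun x => ?_⟩
  · simpa using HasOuterApproxClosed.apprSeq_apply_le_one hF k x
  · have h := tendsto_pi_nhds.1 (HasOuterApproxClosed.tendsto_apprSeq hF) x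
    have := (NNReal.continuous_coe.tendsto _).comp h
    have e : F.indicator (fun _ => (1 : ℝ)) x = 
        ((F.indicator (fun _ => (1 : ℝ≥0)) x : ℝ≥0) : ℝ) := by
      by_cases hx : x ∈ F <;> simp [hx]
    rw [e]
    exact this

lemma SignedMeasure.tendsto_integral_of_tendsto_indicator (μ : SignedMeasure I) {F : Set I}
    (hF : MeasurableSet F) {φ : ℕ → C(I, ℝ)} (h1 : ∀ k x, |φ k x| ≤ 1)
    (h2 : ∀ x, Tendsto (fun k => φ k x) atTop (𝓝 (F.indicator (fun _ => (1 : ℝ)) x))) :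
    Tendsto (fun k => ∫ᵛ ζ, φ k ζ ∂<•μ) atTop (𝓝 (μ F)) := by
  rw [← SignedMeasure.integral_indicator_one μ hF]
  refine VectorMeasure.tendsto_integral_of_dominated_convergence (fun _ => 1)
    (fun n => (φ n).continuous.aestronglyMeasurable) (integrable_const _)
    (fun n => Eventually.of_forall (h1 n)) (Eventually.of_forall h2)

lemma SignedMeasure.abs_integral_le (μ : SignedMeasure I) {φ : I → ℝ} {c : ℝ} {C : ℝ≥0}
    (hφ : ∀ x, |φ x| ≤ c) (hC : μ.variation univ ≤ C) :
    |∫ᵛ ζ, φ ζ ∂<•μ| ≤ c * C := by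
  have h := VectorMeasure.norm_integral_le_of_norm_le_const (μ := μ) (f := φ)
    (B := (ContinuousLinearMap.lsmul ℝ ℝ).flip) (C := c) (Eventually.of_forall hφ)
  have hc : 0 ≤ c := (abs_nonneg _).trans (hφ 0)
  have hB : ‖(ContinuousLinearMap.lsmul ℝ ℝ : ℝ →L[ℝ] ℝ →L[ℝ] ℝ).flip‖ ≤ 1 := by
    rw [ContinuousLinearMap.opNorm_flip]
    exact ContinuousLinearMap.opNorm_lsmul_le
  have hV : μ.variation.real univ ≤ C := ENNReal.toReal_le_coe_of_le_coe hC
  refine h.trans ?_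
  calc c * _ * μ.variation.real univ ≤ c * 1 * C := by gcongr
    _ = c * C := by ring

lemma SignedMeasure.abs_apply_le {X : Type*} [MeasurableSpace X] (μ : SignedMeasure X) {C : ℝ≥0}
    (hC : μ.variation univ ≤ C) (A : Set X) : |μ A| ≤ C :=
  (VectorMeasure.norm_measure_le_variation (μ := μ) (E := A)).trans
    ((measureReal_mono (subset_univ A)).trans (ENNReal.toReal_le_coe_of_le_coe hC))

/-- Bounded pointwise limits carry weak-star measurability from continuous functions to closed sets,
and a π-λ argument carries it to all Borel sets. -/
lemma MemLinftyM.aemeasurable_apply {w : I → SignedMeasure I} (hw : MemLinftyM w) {A : Set I}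
    (hA : MeasurableSet A) : AEMeasurable (fun ξ => w ξ A) volume := by
  induction A, hA using MeasurableSpace.induction_on_inter
    (show Subtype.instMeasurableSpace = MeasurableSpace.generateFrom {s : Set I | IsClosed s} by
      rw [← borel_eq_generateFrom_isClosed]; exact BorelSpace.measurable_eq)
    isPiSystem_isClosed with
  | empty => simp
  | basic F hF =>
    obtain ⟨φ, h1, h2⟩ := exists_continuousMap_tendsto_indicator hF
    exact aemeasurable_of_tendsto_metrizable_ae atTop (fun k => hw.1 (φ k))
      (Eventually.of_forall fun ξ =>
        SignedMeasure.tendsto_integral_of_tendsto_indicator (w ξ) hF.measurableSet h1 h2)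
  | compl A hA ih =>
    have huniv : AEMeasurable (fun ξ => w ξ univ) volume := by
      obtain ⟨φ, h1, h2⟩ := exists_continuousMap_tendsto_indicator (F := univ) isClosed_univ
      exact aemeasurable_of_tendsto_metrizable_ae atTop (fun k => hw.1 (φ k))
        (Eventually.of_forall fun ξ =>
          SignedMeasure.tendsto_integral_of_tendsto_indicator (w ξ) MeasurableSet.univ h1 h2)
    simp_rw [compl_eq_univ_sdiff]
    simp_rw [VectorMeasure.of_sdiff hA .univ (subset_univ _)]
    exact huniv.sub ih
  | iUnion A hd hA ih =>
    refine aemeasurable_of_tendsto_metrizable_ae atTop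
      (f := fun (k : ℕ) ξ => ∑ i ∈ Finset.range k, w ξ (A i))
      (fun k => Finset.aemeasurable_fun_sum _ fun i _ => ih i)
      (Eventually.of_forall fun ξ => ((w ξ).m_iUnion hA hd).tendsto_sum_nat)

lemma MemLinftyM.aemeasurable_section {w : I → SignedMeasure I} (hw : MemLinftyM w)
    {B : Set (I × I)} (hB : MeasurableSet B) :
    AEMeasurable (fun ξ => w ξ (Prod.mk ξ ⁻¹' B)) volume := by
  induction B, hB using MeasurableSpace.induction_on_inter generateFrom_prod.symm
    isPiSystem_prod with
  | empty => simp
  | basic R hR =>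
    obtain ⟨A, hA, B, hB, rfl⟩ := hR
    have : (fun ξ => w ξ (Prod.mk ξ ⁻¹' A ×ˢ B)) = A.indicator fun ξ => w ξ B := by
      classical
      funext ξ
      by_cases h : ξ ∈ A <;> simp [h]
    rw [this]
    exact (hw.aemeasurable_apply hB).indicator hA
  | compl B hB ih =>
    have : (fun ξ => w ξ (Prod.mk ξ ⁻¹' Bᶜ)) =
        fun ξ => w ξ univ - w ξ (Prod.mk ξ ⁻¹' B) := by
      funext ξ
      rw [preimage_compl, compl_eq_univ_sdiff,
        VectorMeasure.of_sdiff (measurable_prodMk_left hB) .univ (subset_univ _)]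
    rw [this]
    exact (hw.aemeasurable_apply .univ).sub ih
  | iUnion A hd hA ih =>
    refine aemeasurable_of_tendsto_metrizable_ae atTop
      (f := fun (k : ℕ) ξ => ∑ i ∈ Finset.range k, w ξ (Prod.mk ξ ⁻¹' A i))
      (fun k => Finset.aemeasurable_fun_sum _ fun i _ => ih i)
      (Eventually.of_forall fun ξ => ?_)
    simp_rw [preimage_iUnion]
    exact ((w ξ).m_iUnion (fun i => measurable_prodMk_left (hA i))
      (fun i j hij => (hd hij).preimage _)).tendsto_sum_nat

/-- The signed measure `w(ξ, dζ) dξ` on `[0,1]²`. -/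
lemma MemLinftyM.exists_signedMeasure {w : I → SignedMeasure I} (hw : MemLinftyM w) :
    ∃ W : SignedMeasure (I × I), ∀ B, MeasurableSet B →
      W B = ∫ ξ, w ξ (Prod.mk ξ ⁻¹' B) := by
  classical
  obtain ⟨C, hC⟩ := hw.2
  refine ⟨⟨fun B => if MeasurableSet B then ∫ ξ, w ξ (Prod.mk ξ ⁻¹' B) else 0, by simp,
    fun B hB => by simp [hB], fun A hA hd => ?_⟩, fun B hB => by simp [hB]⟩
  simp only [hA, if_true, MeasurableSet.iUnion hA]
  have hsum (ξ : I) : HasSum (fun i => w ξ (Prod.mk ξ ⁻¹' A i)) (w ξ (Prod.mk ξ ⁻¹' ⋃ i, A i)) := by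
    rw [preimage_iUnion]
    exact (w ξ).m_iUnion (fun i => measurable_prodMk_left (hA i))
      (fun i j hij => (hd hij).preimage _)
  have hvar (ξ : I) : HasSum (fun i => (w ξ).variation.real (Prod.mk ξ ⁻¹' A i))
      ((w ξ).variation.real (⋃ i, Prod.mk ξ ⁻¹' A i)) := by
    have hm (i : ℕ) : MeasurableSet (Prod.mk ξ ⁻¹' A i) := measurable_prodMk_left (hA i)
    have := (w ξ).variation.toSignedMeasure.m_iUnion hm (fun i j hij => (hd hij).preimage _)
    simpa [Measure.toSignedMeasure_apply, hm, MeasurableSet.iUnion hm] using this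
  have hle (ξ : I) (i : ℕ) : |w ξ (Prod.mk ξ ⁻¹' A i)| ≤
      (w ξ).variation.real (Prod.mk ξ ⁻¹' A i) :=
    VectorMeasure.norm_measure_le_variation (μ := w ξ) (measure_ne_top _ _)
  have habs (ξ : I) : Summable fun i => |w ξ (Prod.mk ξ ⁻¹' A i)| :=
    Summable.of_nonneg_of_le (fun _ => abs_nonneg _) (hle ξ) (hvar ξ).summable
  -- Countable additivity follows by dominated convergence: the absolute values of the terms sum to
  -- at most the variation of `w ξ`, which is essentially bounded by `C`.
  refine hasSum_integral_of_dominated_convergence (fun i ξ => |w ξ (Prod.mk ξ ⁻¹' A i)|)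
    (fun i => (hw.aemeasurable_section (hA i)).aestronglyMeasurable)
    (fun i => Eventually.of_forall fun ξ => le_rfl) (Eventually.of_forall habs) ?_
    (Eventually.of_forall hsum)
  refine Integrable.of_bound (C := C) ?_ ?_
  · refine (aemeasurable_of_tendsto_metrizable_ae atTop
      (f := fun (k : ℕ) ξ => ∑ i ∈ Finset.range k, |w ξ (Prod.mk ξ ⁻¹' A i)|)
      (fun k => Finset.aemeasurable_fun_sum _ fun i _ => ?_)
      (Eventually.of_forall fun ξ => (habs ξ).hasSum.tendsto_sum_nat)).aestronglyMeasurable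
    exact continuous_abs.measurable.comp_aemeasurable (hw.aemeasurable_section (hA i))
  · filter_upwards [hC] with ξ hξ
    rw [Real.norm_of_nonneg (tsum_nonneg fun _ => abs_nonneg _)]
    refine ((habs ξ).tsum_le_tsum (hle ξ) (hvar ξ).summable).trans ?_
    rw [(hvar ξ).tsum_eq]
    exact (measureReal_mono (subset_univ _)).trans (ENNReal.toReal_le_coe_of_le_coe hξ)

/-- The family `w(dξ, ζ)` enters here only. It exhibits `W` as the transpose of a measure built by
integrating over `ζ` with respect to Lebesgue measure, and such a measure ignores null sets of `ζ`.
-/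
lemma IsExtendedGraphon.exists_signedMeasure {w : I → SignedMeasure I} (hw : IsExtendedGraphon w) :
    ∃ W : SignedMeasure (I × I),
      (∀ B, MeasurableSet B → W B = ∫ ξ, w ξ (Prod.mk ξ ⁻¹' B)) ∧
      ∀ A : Set I, MeasurableSet A → volume A = 0 → W.variation (univ ×ˢ A) = 0 := by
  obtain ⟨hw, w', hw', hΦ⟩ := hw
  obtain ⟨W, hW⟩ := hw.exists_signedMeasure
  obtain ⟨W', hW'⟩ := hw'.exists_signedMeasure
  obtain ⟨C, hC⟩ := hw.2
  obtain ⟨C', hC'⟩ := hw'.2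
  -- Test the compatibility of the two families with products `φ k ξ * ψ k ζ` of continuous
  -- approximations of the indicators of `A` and `B`.
  have hrect (A B : Set I) (hA : IsClosed A) (hB : IsClosed B) : W (A ×ˢ B) = W' (B ×ˢ A) := by
    classical
    rw [hW _ (hA.measurableSet.prod hB.measurableSet),
      hW' _ (hB.measurableSet.prod hA.measurableSet)]
    obtain ⟨φ, hφ1, hφ2⟩ := exists_continuousMap_tendsto_indicator hA
    obtain ⟨ψ, hψ1, hψ2⟩ := exists_continuousMap_tendsto_indicator hB
    have key (v : I → SignedMeasure I) (hv : MemLinftyM v) (c : ℝ≥0)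
        (hc : ∀ᵐ ξ : I, (v ξ).variation univ ≤ c) (A B : Set I) (hA : IsClosed A)
        (hB : IsClosed B) (φ ψ : ℕ → C(I, ℝ)) (hφ1 : ∀ k x, |φ k x| ≤ 1)
        (hφ2 : ∀ x, Tendsto (fun k => φ k x) atTop (𝓝 (A.indicator (fun _ => (1 : ℝ)) x)))
        (hψ1 : ∀ k x, |ψ k x| ≤ 1)
        (hψ2 : ∀ x, Tendsto (fun k => ψ k x) atTop (𝓝 (B.indicator (fun _ => (1 : ℝ)) x))) :
        Tendsto (fun k => ∫ ξ, ∫ᵛ ζ, φ k ξ * ψ k ζ ∂<•(v ξ)) atTop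
          (𝓝 (∫ ξ, v ξ (Prod.mk ξ ⁻¹' A ×ˢ B))) := by
      have hmul (k : ℕ) (ξ : I) :
          ∫ᵛ ζ, φ k ξ * ψ k ζ ∂<•(v ξ) = φ k ξ * ∫ᵛ ζ, ψ k ζ ∂<•(v ξ) :=
        VectorMeasure.integral_smul _ _ _ (φ k ξ)
      simp_rw [hmul]
      refine tendsto_integral_of_dominated_convergence (fun _ => (1 * (1 * c) : ℝ))
        (fun k => (((φ k).continuous.aemeasurable).mul (hv.1 (ψ k))).aestronglyMeasurable)
        (integrable_const _) (fun k => ?_) (Eventually.of_forall fun ξ => ?_)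
      · filter_upwards [hc] with ξ hξ
        rw [norm_mul]
        exact mul_le_mul (hφ1 k ξ) (SignedMeasure.abs_integral_le _ (hψ1 k) hξ) (norm_nonneg _)
          zero_le_one
      · have h := (hφ2 ξ).mul
          (SignedMeasure.tendsto_integral_of_tendsto_indicator (v ξ) hB.measurableSet hψ1 hψ2)
        convert h using 2
        by_cases h : ξ ∈ A <;> simp [h]
    have h1 := key w hw C hC A B hA hB φ ψ hφ1 hφ2 hψ1 hψ2
    have h2 := key w' hw' C' hC' B A hB hA ψ φ hψ1 hψ2 hφ1 hφ2
    refine tendsto_nhds_unique h1 (h2.congr fun k => ?_)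
    have := hΦ ⟨fun p => φ k p.1 * ψ k p.2, by fun_prop⟩
    simp only [ContinuousMap.coe_mk] at this
    rw [this]
    simp_rw [mul_comm]
  have hswap : W = W'.map Prod.swap := by
    have hgen : (borel I) = MeasurableSpace.generateFrom {s : Set I | IsClosed s} :=
      borel_eq_generateFrom_isClosed
    have hspan : IsCountablySpanning {s : Set I | IsClosed s} :=
      ⟨fun _ => univ, fun _ => isClosed_univ, iUnion_const _⟩
    refine VectorMeasure.ext_of_generateFrom
      (image2 (· ×ˢ ·) {s : Set I | IsClosed s} {s : Set I | IsClosed s}) ?_ ?_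
      (isPiSystem_isClosed.prod isPiSystem_isClosed) ?_
    · rintro _ ⟨A, hA, B, hB, rfl⟩
      rw [VectorMeasure.map_apply _ measurable_swap
        ((IsClosed.measurableSet hA).prod (IsClosed.measurableSet hB)), preimage_swap_prod]
      exact hrect A B hA hB
    · rw [← generateFrom_prod_eq hspan hspan, ← hgen, ← BorelSpace.measurable_eq (α := I)]
    · rw [VectorMeasure.map_apply _ measurable_swap .univ, ← univ_prod_univ, preimage_swap_prod]
      exact hrect _ _ isClosed_univ isClosed_univ
  refine ⟨W, hW, fun A hA hA0 => ?_⟩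
  rw [VectorMeasure.variation_apply_eq_zero (MeasurableSet.univ.prod hA)]
  intro t ht htm
  rw [hswap, VectorMeasure.map_apply _ measurable_swap htm, hW' _ (measurable_swap htm)]
  refine integral_eq_zero_of_ae ?_
  filter_upwards [measure_eq_zero_iff_ae_notMem.1 hA0] with ζ hζ
  have : Prod.mk ζ ⁻¹' (Prod.swap ⁻¹' t) = ∅ := by
    ext ξ
    simp only [mem_preimage, Prod.swap_prod_mk, mem_empty_iff_false, iff_false]
    exact fun h => hζ (ht h).2
  simp [this]

end Graphon

/-! ### Disintegration of an extended graphon along a Markov kernel -/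

/-- Take finite intersections from a countable generating family. Countability allows the
exceptional null sets, one for each member, to be merged into a single one. -/
lemma exists_countable_isPiSystem (X : Type*) [MeasurableSpace X]
    [MeasurableSpace.CountablyGenerated X] :
    ∃ S : Set (Set X), S.Countable ∧ IsPiSystem S ∧ univ ∈ S ∧
      ‹MeasurableSpace X› = MeasurableSpace.generateFrom S := by
  classical
  set G := MeasurableSpace.countableGeneratingSet X
  have hG : G.Countable := MeasurableSpace.countable_countableGeneratingSet
  have : Countable G := hG.to_subtype
  refine ⟨range fun F : Finset G => ⋂ a ∈ F, (a : Set X), countable_range _, ?_, ⟨∅, by simp⟩, ?_⟩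
  · rintro _ ⟨F, rfl⟩ _ ⟨F', rfl⟩ -
    refine ⟨F ∪ F', ?_⟩
    ext x
    simp only [mem_iInter, mem_inter_iff, Finset.mem_union]
    exact ⟨fun h => ⟨fun a ha => h a (.inl ha), fun a ha => h a (.inr ha)⟩,
      fun h a ha => ha.elim (h.1 a) (h.2 a)⟩
  · refine le_antisymm ?_ (MeasurableSpace.generateFrom_le ?_)
    · conv_lhs => rw [← MeasurableSpace.generateFrom_countableGeneratingSet (α := X)]
      refine MeasurableSpace.generateFrom_mono fun a ha => ⟨{⟨a, ha⟩}, by simp⟩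
    · rintro _ ⟨F, rfl⟩
      exact F.measurableSet_biInter fun a _ =>
        MeasurableSpace.measurableSet_countableGeneratingSet a.2

/-- Disintegration of an extended graphon with respect to a Markov kernel. -/
structure IsGraphonKernel (w : I → SignedMeasure I) (κ : Kernel I I) (s : I × I → ℝ) (C : ℝ) :
    Prop where
  measurable : Measurable s
  abs_le : ∀ p, |s p| ≤ C
  comp_absolutelyContinuous : κ ∘ₘ (volume : Measure I) ≪ volume
  ae_eq : ∀ᵐ ξ, w ξ = (κ ξ).withDensityᵥ fun ζ => s (ξ, ζ)

/-- Disintegrate the positive measure `μ = |W| + Lebesgue`. The density `ρ` of `W` with respect to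
`μ` is at most `1` in absolute value, and the first marginal of `μ` has a bounded density `r` on
`[0,1]`; then `s(ξ, ζ) = r(ξ) ρ(ξ, ζ)`. The Lebesgue summand makes the first marginal equivalent to
Lebesgue measure, so that almost-everywhere statements pass in both directions. -/
lemma IsExtendedGraphon.exists_kernel {w : I → SignedMeasure I} (hw : IsExtendedGraphon w) :
    ∃ (κ : Kernel I I) (_ : IsMarkovKernel κ) (s : I × I → ℝ) (C : ℝ), IsGraphonKernel w κ s C := by
  obtain ⟨W, hW, hW0⟩ := hw.exists_signedMeasure
  obtain ⟨C, hC⟩ := hw.1.2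
  have hfst (A : Set I) (hA : MeasurableSet A) :
      W.variation (A ×ˢ univ) ≤ 2 * (C * volume A) := by
    refine SignedMeasure.variation_le_two_mul W (hA.prod .univ) fun E hE hEA => ?_
    rw [hW E hE]
    calc ‖∫ ξ, w ξ (Prod.mk ξ ⁻¹' E)‖ₑ ≤ ∫⁻ ξ, ‖w ξ (Prod.mk ξ ⁻¹' E)‖ₑ :=
          enorm_integral_le_lintegral_enorm _
      _ ≤ ∫⁻ ξ, A.indicator (fun _ => (C : ℝ≥0∞)) ξ := by
          refine lintegral_mono_ae ?_
          filter_upwards [hC] with ξ hξ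
          by_cases h : ξ ∈ A
          · rw [indicator_of_mem h]
            exact (VectorMeasure.enorm_measure_le_variation _ _).trans
              ((measure_mono (subset_univ _)).trans hξ)
          · have : Prod.mk ξ ⁻¹' E = ∅ := by
              ext ζ
              simp only [mem_preimage, mem_empty_iff_false, iff_false]
              exact fun h' => h (hEA h').1
            simp [this]
      _ = C * volume A := by rw [lintegral_indicator_const hA]
  set μ : Measure (I × I) := W.variation + volume with hμ
  have hWμ : W.variation ≤ μ := Measure.le_add_right le_rfl
  have hvμ : (volume : Measure (I × I)) ≤ μ := Measure.le_add_left le_rfl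
  have hac : W ≪ᵥ μ.toENNRealVectorMeasure := by
    refine VectorMeasure.AbsolutelyContinuous.mk fun A hA hA0 => ?_
    rw [Measure.toENNRealVectorMeasure_apply_measurable hA] at hA0
    exact (VectorMeasure.variation_apply_eq_zero hA).1 (le_antisymm ((hWμ A).trans hA0.le) bot_le)
      A Subset.rfl hA
  have hρ : μ.withDensityᵥ (W.rnDeriv μ) = W := SignedMeasure.withDensityᵥ_rnDeriv_eq W μ hac
  have hρi : Integrable (W.rnDeriv μ) μ := SignedMeasure.integrable_rnDeriv W μ
  -- The truncation makes the bound hold at every point; it changes the density only on a `μ`-null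
  -- set, because `|W A| ≤ μ A` for every `A`. The truncation in `r` below plays the same role.
  set ρ : I × I → ℝ := fun p => max (-1) (min 1 (W.rnDeriv μ p)) with hρdef
  have hρm : Measurable ρ := by
    have := SignedMeasure.measurable_rnDeriv W μ
    fun_prop
  have hρ1 (p : I × I) : |ρ p| ≤ 1 := abs_le.2 ⟨le_max_left _ _, by simp [ρ]⟩
  have hset (A : Set (I × I)) (hA : MeasurableSet A) : ∫ p in A, W.rnDeriv μ p ∂μ = W A := by
    rw [← withDensityᵥ_apply hρi hA, hρ]
  have hWA (A : Set (I × I)) : |W A| ≤ μ.real A := by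
    refine (VectorMeasure.norm_measure_le_variation (μ := W) (measure_ne_top _ _)).trans ?_
    exact ENNReal.toReal_mono (measure_ne_top _ _) (hWμ A)
  have hle : W.rnDeriv μ ≤ᵐ[μ] fun _ => 1 :=
    ae_le_of_forall_setIntegral_le hρi (integrable_const _) fun A hA _ => by
      rw [hset A hA]
      simpa using (le_abs_self _).trans (hWA A)
  have hge : (fun _ => -1) ≤ᵐ[μ] W.rnDeriv μ :=
    ae_le_of_forall_setIntegral_le (integrable_const _) hρi fun A hA _ => by
      rw [hset A hA]
      simpa using (abs_le.1 (hWA A)).1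
  have hρae : ρ =ᵐ[μ] W.rnDeriv μ := by
    filter_upwards [hle, hge] with p h1 h2
    simp [ρ, h1, h2]
  have hρint : Integrable ρ μ := hρi.congr hρae.symm
  -- The term `2 * C` bounds the marginal of `|W|`, and `1` is the Lebesgue summand.
  have hfst_le : μ.fst ≤ (2 * C + 1 : ℝ≥0) • (volume : Measure I) := by
    refine Measure.le_intro fun A hA _ => ?_
    rw [Measure.fst_apply hA, ← prod_univ, hμ, Measure.add_apply, Measure.volume_eq_prod,
      Measure.prod_prod]
    refine (add_le_add (hfst A hA) le_rfl).trans (le_of_eq ?_)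
    simp [ENNReal.smul_def, add_mul, mul_assoc]
  have : IsFiniteMeasure μ.fst := inferInstance
  have : μ.fst.HaveLebesgueDecomposition volume :=
    Measure.haveLebesgueDecomposition_of_sigmaFinite _ _
  have hfst_ac : μ.fst ≪ volume := Measure.absolutelyContinuous_of_le_smul hfst_le
  have hvol_ac : (volume : Measure I) ≪ μ.fst := by
    refine Measure.absolutelyContinuous_of_le (Measure.le_intro fun A hA _ => ?_)
    rw [Measure.fst_apply hA, ← prod_univ]
    calc volume A = (volume : Measure (I × I)) (A ×ˢ univ) := by
          rw [Measure.volume_eq_prod, Measure.prod_prod]; simp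
      _ ≤ μ (A ×ˢ univ) := hvμ _
  set D : ℝ≥0 := 2 * C + 1
  have hr : μ.fst.rnDeriv volume ≤ᵐ[volume] fun _ => (D : ℝ≥0∞) := by
    refine ae_le_of_forall_setLIntegral_le_of_sigmaFinite (Measure.measurable_rnDeriv _ _)
      fun A hA _ => ?_
    rw [Measure.setLIntegral_rnDeriv hfst_ac, setLIntegral_const]
    exact hfst_le A
  set r : I → ℝ := fun ξ => (min (μ.fst.rnDeriv volume ξ) D).toReal
  have hrm : Measurable r :=
    ((Measure.measurable_rnDeriv _ _).min measurable_const).ennreal_toReal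
  have hrD (ξ : I) : |r ξ| ≤ D := by
    rw [abs_of_nonneg ENNReal.toReal_nonneg]
    exact ENNReal.toReal_le_coe_of_le_coe (min_le_right _ _)
  have hs (p : I × I) : |r p.1 * ρ p| ≤ D := by
    rw [abs_mul]
    calc |r p.1| * |ρ p| ≤ D * 1 := mul_le_mul (hrD _) (hρ1 _) (abs_nonneg _) D.2
      _ = D := mul_one _
  have hdis : μ.fst ⊗ₘ μ.condKernel = μ := Measure.disintegrate μ μ.condKernel
  refine ⟨μ.condKernel, inferInstance, fun p => r p.1 * ρ p, D,
    ⟨(hrm.comp measurable_fst).mul hρm, hs, ?_, ?_⟩⟩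
  -- If `A` is null, the strip `univ ×ˢ A` is `μ`-null, so `κ ξ A = 0` for almost every `ξ` under
  -- the first marginal, hence under Lebesgue measure.
  · refine Measure.AbsolutelyContinuous.mk fun A hA hA0 => ?_
    rw [Measure.bind_apply hA (Kernel.aemeasurable _),
      lintegral_eq_zero_iff (Kernel.measurable_coe _ hA)]
    refine hvol_ac.ae_le ?_
    have h0 : μ (univ ×ˢ A) = 0 := by
      rw [hμ, Measure.add_apply, hW0 A hA hA0, Measure.volume_eq_prod, Measure.prod_prod, hA0]
      simp
    rw [← hdis, Measure.compProd_apply (MeasurableSet.univ.prod hA),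
      lintegral_eq_zero_iff (Kernel.measurable_kernel_prodMk_left (MeasurableSet.univ.prod hA))]
      at h0
    filter_upwards [h0] with ξ hξ
    simpa using hξ
  · have hsec (A : Set I) (hA : MeasurableSet A) :
        ∀ᵐ ξ, w ξ A = ((μ.condKernel ξ).withDensityᵥ fun ζ => r ξ * ρ (ξ, ζ)) A := by
      have hκi (ξ : I) : Integrable (fun ζ => ρ (ξ, ζ)) (μ.condKernel ξ) :=
        Integrable.of_bound (hρm.comp measurable_prodMk_left).aestronglyMeasurable 1
          (Eventually.of_forall fun ζ => hρ1 _)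
      have hwi : Integrable (fun ξ => w ξ A) volume := by
        refine Integrable.of_bound (hw.1.aemeasurable_apply hA).aestronglyMeasurable C ?_
        filter_upwards [hC] with ξ hξ
        exact SignedMeasure.abs_apply_le _ hξ A
      have hm : StronglyMeasurable fun ξ => ∫ ζ in A, ρ (ξ, ζ) ∂(μ.condKernel ξ) := by
        simp_rw [← integral_indicator hA]
        exact StronglyMeasurable.integral_kernel_prod_right
          (f := fun ξ ζ => A.indicator (fun ζ => ρ (ξ, ζ)) ζ)
          ((hρm.indicator (measurable_snd hA)).stronglyMeasurable)
      have hb (ξ : I) : |∫ ζ in A, ρ (ξ, ζ) ∂(μ.condKernel ξ)| ≤ 1 := by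
        refine (norm_setIntegral_le_of_norm_le_const (C := 1) (f := fun ζ => ρ (ξ, ζ))
          (measure_lt_top _ _)
          fun ζ _ => hρ1 (ξ, ζ)).trans ?_
        simp
      have hgi : Integrable (fun ξ => r ξ * ∫ ζ in A, ρ (ξ, ζ) ∂(μ.condKernel ξ)) volume := by
        refine Integrable.of_bound (hrm.aestronglyMeasurable.mul hm.aestronglyMeasurable) (D * 1)
          (Eventually.of_forall fun ξ => ?_)
        rw [norm_mul]
        exact mul_le_mul (hrD _) (hb _) (norm_nonneg _) D.2
      -- Both integrals over `B` equal `W (B ×ˢ A)`: one by the construction of `W`, the other by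
      -- disintegrating `∫ ρ dμ` over the rectangle and rewriting the first marginal through `r`.
      have hae := Integrable.ae_eq_of_forall_setIntegral_eq _ _ hwi hgi fun B hB _ => by
        have e1 : ∫ ξ in B, w ξ A = W (B ×ˢ A) := by
          classical
          rw [hW _ (hB.prod hA), ← integral_indicator hB]
          congr 1 with ξ
          by_cases h : ξ ∈ B <;> simp [h]
        have e2 : W (B ×ˢ A) = ∫ p in B ×ˢ A, ρ p ∂μ := by
          rw [← hset _ (hB.prod hA)]
          exact setIntegral_congr_ae (hB.prod hA) (hρae.mono fun p hp _ => hp.symm)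
        rw [e1, e2]
        conv_lhs => rw [← hdis]
        rw [Measure.setIntegral_compProd hB hA (by rw [hdis]; exact hρint.integrableOn),
          ← setIntegral_rnDeriv_smul hfst_ac hB]
        refine setIntegral_congr_ae hB (hr.mono fun ξ hξ _ => ?_)
        simp [r, min_eq_left hξ]
      filter_upwards [hae] with ξ hξ
      rw [hξ, withDensityᵥ_apply ((hκi ξ).const_mul _) hA, integral_const_mul]
    obtain ⟨S, hSc, hSpi, hSu, hS⟩ := exists_countable_isPiSystem I
    have hSm (A : Set I) (hA : A ∈ S) : MeasurableSet A := by
      rw [hS]; exact MeasurableSpace.measurableSet_generateFrom hA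
    have : ∀ᵐ ξ, ∀ A ∈ S, w ξ A = ((μ.condKernel ξ).withDensityᵥ fun ζ => r ξ * ρ (ξ, ζ)) A :=
      (ae_ball_iff hSc).2 fun A hA => hsec A (hSm A hA)
    filter_upwards [this] with ξ hξ
    exact VectorMeasure.ext_of_generateFrom S hξ hS hSpi (hξ univ hSu)

/-- Since the identity is one between measures, the exceptional null set of `ξ` does not depend on
`g`. This matters because the integrands to come vary with `t`, `x` and the other labels. -/
lemma IsGraphonKernel.ae_integral_eq {w : I → SignedMeasure I} {κ : Kernel I I} [IsMarkovKernel κ]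
    {s : I × I → ℝ} {C : ℝ} (h : IsGraphonKernel w κ s C) :
    ∀ᵐ ξ, ∀ {E : Type} [NormedAddCommGroup E] [NormedSpace ℝ E] [CompleteSpace E] {g : I → E},
      Integrable g (κ ξ) → ∫ᵛ ζ, g ζ ∂<•(w ξ) = ∫ ζ, s (ξ, ζ) • g ζ ∂(κ ξ) := by
  filter_upwards [h.ae_eq] with ξ hξ E _ _ _ g hg
  rw [hξ]
  exact SignedMeasure.integral_withDensityᵥ _ (h.measurable.comp measurable_prodMk_left)
    (fun ζ => h.abs_le _) hg

/-! ### The probability measure and the bounded weight carried by a tree -/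

lemma measurable_finSnoc {n : ℕ} {α : Type*} [MeasurableSpace α] :
    Measurable fun p : (Fin n → α) × α => (Fin.snoc (α := fun _ => α) p.1 p.2 : Fin (n + 1) → α) := by
  refine measurable_pi_iff.2 fun j => ?_
  induction j using Fin.lastCases with
  | last => simpa using measurable_snd
  | cast j => simp only [Fin.snoc_castSucc]; fun_prop

/-- The measure `∏_{(k,l) ∈ T} κ(ξ_k, dξ_l) dξ₁` on `[0,1]^n`. -/
def treeMeasure (κ : Kernel I I) : {n : ℕ} → LabeledTree n → Measure (Fin n → I)
  | _, .single => (volume : Measure I).map fun ξ _ => ξ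
  | _, .addLeaf T i =>
      (treeMeasure κ T ⊗ₘ κ.comap (fun ξ => ξ i) (measurable_pi_apply i)).map
        fun p => Fin.snoc (α := fun _ => I) p.1 p.2

/-- The weight `∏_{(k,l) ∈ T} s(ξ_k, ξ_l)`. -/
def treeWeight (s : I × I → ℝ) : {n : ℕ} → LabeledTree n → (Fin n → I) → ℝ
  | _, .single, _ => 1
  | _, .addLeaf (n := n) T i, ξ =>
      treeWeight s T (fun j => ξ j.castSucc) * s (ξ i.castSucc, ξ (Fin.last n))

lemma Integrable.integral_measure_compProd {α β E : Type*} [MeasurableSpace α] [MeasurableSpace β]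
    [NormedAddCommGroup E] [NormedSpace ℝ E] {μ : Measure α} [SFinite μ] {κ : Kernel α β}
    [IsSFiniteKernel κ] {f : α × β → E} (hf : Integrable f (μ ⊗ₘ κ)) :
    Integrable (fun a => ∫ b, f (a, b) ∂(κ a)) μ := by
  simpa using MeasureTheory.Integrable.integral_compProd hf

section Tree

variable {κ : Kernel I I} [IsMarkovKernel κ]

instance isProbabilityMeasure_treeMeasure {n : ℕ} (T : LabeledTree n) :
    IsProbabilityMeasure (treeMeasure κ T) := by
  induction T with
  | single => exact Measure.isProbabilityMeasure_map (by fun_prop)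
  | addLeaf T i ih => exact Measure.isProbabilityMeasure_map measurable_finSnoc.aemeasurable

/-- Induction on the tree: the label of a new leaf has as law the average of `κ` over the law of its
parent's label, which is absolutely continuous by induction, and `κ` preserves this property.
Consequently a property of almost every label holds at each vertex for almost every labelling. -/
lemma quasiMeasurePreserving_eval_treeMeasure (hκ : κ ∘ₘ (volume : Measure I) ≪ volume) {n : ℕ}
    (T : LabeledTree n) (m : Fin n) :
    Measure.QuasiMeasurePreserving (fun ξ => ξ m) (treeMeasure κ T) volume := by
  induction T with
  | single =>
    refine ⟨measurable_pi_apply m, ?_⟩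
    rw [treeMeasure, Measure.map_map (measurable_pi_apply m) (by fun_prop)]
    exact (Measure.map_id (μ := (volume : Measure I))).absolutelyContinuous
  | @addLeaf k T i ih =>
    refine ⟨measurable_pi_apply m, ?_⟩
    rw [treeMeasure, Measure.map_map (measurable_pi_apply m) measurable_finSnoc]
    induction m using Fin.lastCases with
    | last =>
      have : (fun ξ : Fin (k + 1) → I => ξ (Fin.last k)) ∘
          (fun p : (Fin k → I) × I => Fin.snoc (α := fun _ => I) p.1 p.2) = Prod.snd := by
        funext p; simp
      rw [this]
      refine Measure.AbsolutelyContinuous.mk fun A hA hA0 => ?_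
      have h1 := hκ hA0
      rw [Measure.bind_apply hA κ.aemeasurable,
        lintegral_eq_zero_iff (Kernel.measurable_coe _ hA)] at h1
      rw [Measure.map_apply measurable_snd hA, Measure.compProd_apply (measurable_snd hA),
        lintegral_eq_zero_iff (Kernel.measurable_kernel_prodMk_left (measurable_snd hA))]
      exact (ih i).ae h1
    | cast m =>
      have : (fun ξ : Fin (k + 1) → I => ξ m.castSucc) ∘
          (fun p : (Fin k → I) × I => Fin.snoc (α := fun _ => I) p.1 p.2) =
            (fun ξ => ξ m) ∘ Prod.fst := by
        funext p; simp
      rw [this, ← Measure.map_map (measurable_pi_apply m) measurable_fst]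
      have h : (treeMeasure κ T ⊗ₘ κ.comap (fun ξ => ξ i) (measurable_pi_apply i)).map Prod.fst =
          treeMeasure κ T := Measure.fst_compProd _ _
      rw [h]
      exact (ih m).2

lemma measurable_treeWeight {s : I × I → ℝ} (hs : Measurable s) {n : ℕ} (T : LabeledTree n) :
    Measurable (treeWeight s T) := by
  induction T with
  | single => exact measurable_const
  | addLeaf T i ih =>
    simp only [treeWeight]
    exact (ih.comp (by fun_prop)).mul (hs.comp (by fun_prop))

lemma abs_treeWeight_le {s : I × I → ℝ} {C : ℝ} (hs : ∀ p, |s p| ≤ C) {n : ℕ}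
    (T : LabeledTree n) : ∃ D : ℝ, 0 ≤ D ∧ ∀ ξ, |treeWeight s T ξ| ≤ D := by
  have hC : 0 ≤ C := (abs_nonneg _).trans (hs (0, 0))
  induction T with
  | single => exact ⟨1, zero_le_one, fun ξ => by simp [treeWeight]⟩
  | addLeaf T i ih =>
    obtain ⟨D, hD, h⟩ := ih
    refine ⟨D * C, by positivity, fun ξ => ?_⟩
    rw [treeWeight, abs_mul]
    exact mul_le_mul (h _) (hs _) (abs_nonneg _) hD

lemma treeWeight_snoc (s : I × I → ℝ) {n : ℕ} (T : LabeledTree n) (i : Fin n) (ξ : Fin n → I)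
    (ζ : I) :
    treeWeight s (T.addLeaf i) (Fin.snoc (α := fun _ => I) ξ ζ) = treeWeight s T ξ * s (ξ i, ζ) := by
  simp [treeWeight]

lemma integral_treeMeasure_addLeaf {E : Type*} [NormedAddCommGroup E] [NormedSpace ℝ E] {n : ℕ}
    (T : LabeledTree n) (i : Fin n) {g : (Fin (n + 1) → I) → E}
    (hg : Integrable g (treeMeasure κ (T.addLeaf i))) :
    ∫ ξ, g ξ ∂(treeMeasure κ (T.addLeaf i)) =
      ∫ ξ, ∫ ζ, g (Fin.snoc (α := fun _ => I) ξ ζ) ∂(κ (ξ i)) ∂(treeMeasure κ T) := by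
  rw [treeMeasure, integral_map measurable_finSnoc.aemeasurable hg.1, Measure.integral_compProd]
  · rfl
  · exact (integrable_map_measure hg.1 measurable_finSnoc.aemeasurable).1 hg

lemma Integrable.of_treeMeasure_addLeaf {E : Type*} [NormedAddCommGroup E] {n : ℕ}
    {T : LabeledTree n} {i : Fin n} {g : (Fin (n + 1) → I) → E}
    (hg : Integrable g (treeMeasure κ (T.addLeaf i))) :
    Integrable (fun p : (Fin n → I) × I => g (Fin.snoc (α := fun _ => I) p.1 p.2))
      (treeMeasure κ T ⊗ₘ κ.comap (fun ξ => ξ i) (measurable_pi_apply i)) :=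
  (integrable_map_measure hg.1 measurable_finSnoc.aemeasurable).1 hg

/-- Peel off the last leaf. The identity `w = s κ` holds for almost every label, hence at the parent
vertex for almost every labelling, and Fubini reduces the claim to the smaller tree. -/
lemma treeIntegral_eq_integral {w : I → SignedMeasure I} {n : ℕ} (T : LabeledTree n)
    {s : I × I → ℝ} {C : ℝ} (h : IsGraphonKernel w κ s C) {g : (Fin n → I) → ℝ}
    (hg : Integrable g (treeMeasure κ T)) :
    treeIntegral w T g = ∫ ξ, treeWeight s T ξ * g ξ ∂(treeMeasure κ T) := by
  induction T with
  | single =>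
    simp only [treeIntegral, treeWeight, one_mul]
    rw [treeMeasure, integral_map (by fun_prop) hg.1]
  | addLeaf T i ih =>
    obtain ⟨D, hD, hDb⟩ := abs_treeWeight_le h.abs_le (T.addLeaf i)
    have hsw : Integrable (fun ξ => treeWeight s (T.addLeaf i) ξ * g ξ)
        (treeMeasure κ (T.addLeaf i)) :=
      hg.bdd_mul (measurable_treeWeight h.measurable _).aestronglyMeasurable
        (Eventually.of_forall hDb)
    have hg' := Integrable.of_treeMeasure_addLeaf hg
    have hsg : Integrable (fun p : (Fin _ → I) × I => s (p.1 i, p.2) *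
        g (Fin.snoc (α := fun _ => I) p.1 p.2))
        (treeMeasure κ T ⊗ₘ κ.comap (fun ξ => ξ i) (measurable_pi_apply i)) :=
      hg'.bdd_mul (f := fun p : (Fin _ → I) × I => s (p.1 i, p.2))
        (h.measurable.comp (by fun_prop)).aestronglyMeasurable
        (Eventually.of_forall fun _ => h.abs_le _)
    have hae : ∀ᵐ ξ ∂(treeMeasure κ T),
        ∫ᵛ ζ, g (Fin.snoc (α := fun _ => I) ξ ζ) ∂<•(w (ξ i)) =
          ∫ ζ, s (ξ i, ζ) * g (Fin.snoc (α := fun _ => I) ξ ζ) ∂(κ (ξ i)) := by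
      filter_upwards [(quasiMeasurePreserving_eval_treeMeasure h.comp_absolutelyContinuous T i).ae
        h.ae_integral_eq, ((Measure.integrable_compProd_iff hg'.1).1 hg').1] with ξ h1 h2
      exact h1 h2
    have hint : Integrable (fun ξ => ∫ ζ, s (ξ i, ζ) * g (Fin.snoc (α := fun _ => I) ξ ζ) ∂(κ (ξ i)))
        (treeMeasure κ T) := Integrable.integral_measure_compProd hsg
    rw [treeIntegral, ih (hint.congr (hae.mono fun _ h => h.symm)),
      integral_treeMeasure_addLeaf T i hsw]
    refine integral_congr_ae (hae.mono fun ξ hξ => ?_)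
    simp only [hξ, treeWeight_snoc, mul_assoc]
    rw [integral_const_mul]

end Tree

/-! ### Weak derivatives on an interval and the product rule -/

section WeakDerivative

/-- Smooth functions on `ℝ` with compact support in `(a, b)`. -/
structure IsTestFunction (a b : ℝ) (θ : ℝ → ℝ) : Prop where
  contDiff : ContDiff ℝ ∞ θ
  hasCompactSupport : HasCompactSupport θ
  tsupport_subset : tsupport θ ⊆ Ioo a b

lemma IsTestFunction.exists_Icc {a b : ℝ} (hab : a < b) {θ : ℝ → ℝ} (h : IsTestFunction a b θ) :
    ∃ p q, a < p ∧ p < q ∧ q < b ∧ ∀ t, t ∉ Icc p q → θ t = 0 := by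
  have hm : (a + b) / 2 ∈ Ioo a b := ⟨by linarith, by linarith⟩
  -- The midpoint keeps the set nonempty when `θ` vanishes identically.
  set K := insert ((a + b) / 2) (tsupport θ)
  have hK : IsCompact K := h.hasCompactSupport.isCompact.insert _
  have hne : K.Nonempty := ⟨_, mem_insert _ _⟩
  have hKs : K ⊆ Ioo a b := insert_subset hm h.tsupport_subset
  have h1 := hKs (hK.sInf_mem hne)
  have h2 := hKs (hK.sSup_mem hne)
  have h3 : sInf K ≤ sSup K := csInf_le_csSup hne hK.bddBelow hK.bddAbove 
  refine ⟨(a + sInf K) / 2, (sSup K + b) / 2, by linarith [h1.1], by linarith [h1.1, h2.2],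
    by linarith [h2.2], fun t ht => ?_⟩
  by_contra hne0
  have htK : t ∈ K := mem_insert_of_mem _ (subset_tsupport _ hne0)
  have := csInf_le hK.bddBelow htK
  have := le_csSup hK.bddAbove htK
  exact ht ⟨by linarith [h1.1], by linarith [h2.2]⟩

/-- The primitive based at `a` vanishes to the left of the support trivially, and to its right
because the total integral is zero. -/
lemma IsTestFunction.exists_primitive {a b : ℝ} (hab : a < b) {g : ℝ → ℝ}
    (hg : IsTestFunction a b g) (h0 : ∫ t, g t = 0) :
    ∃ θ, IsTestFunction a b θ ∧ deriv θ = g := by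
  obtain ⟨p, q, hap, hpq, hqb, hz⟩ := hg.exists_Icc hab
  have hgc : Continuous g := hg.contDiff.continuous
  have hd (t : ℝ) : HasDerivAt (fun t => ∫ s in a..t, g s) (g t) t :=
    intervalIntegral.integral_hasDerivAt_right (hgc.intervalIntegrable _ _)
      (hgc.stronglyMeasurableAtFilter _ _) hgc.continuousAt
  have hderiv : deriv (fun t => ∫ s in a..t, g s) = g := funext fun t => (hd t).deriv
  have hzero : ∀ t, t ∉ Icc p q → ∫ s in a..t, g s = 0 := by
    intro t ht
    rcases lt_or_ge t p with h | h
    · rw [intervalIntegral.integral_zero_ae]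
      refine Eventually.of_forall fun s hs => hz s fun hs' => ?_
      have : s ≤ max a t := by
        rcases mem_uIoc.1 hs with h | h
        · exact h.2.trans (le_max_right _ _)
        · exact h.2.trans (le_max_left _ _)
      exact absurd (hs'.1.trans this) (not_le.2 (max_lt hap h))
    · have hqt : q < t := not_le.1 fun h' => ht ⟨h, h'⟩
      rw [intervalIntegral.integral_of_le (by linarith), ← h0]
      refine setIntegral_eq_integral_of_forall_compl_eq_zero fun s hs => hz s fun hs' => hs ?_
      exact ⟨hap.trans_le hs'.1, hs'.2.trans hqt.le⟩
  have hsub : tsupport (fun t => ∫ s in a..t, g s) ⊆ Icc p q :=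
    closure_minimal (fun t ht => by_contra fun h => ht (hzero t h)) isClosed_Icc
  refine ⟨fun t => ∫ s in a..t, g s, ⟨?_, ?_, ?_⟩, hderiv⟩
  · rw [contDiff_infty_iff_deriv, hderiv]
    exact ⟨fun t => (hd t).differentiableAt, hg.contDiff⟩
  · exact HasCompactSupport.intro isCompact_Icc hzero
  · exact hsub.trans (Icc_subset_Ioo hap hqb)

lemma exists_isTestFunction_integral_eq_one {a b : ℝ} (hab : a < b) :
    ∃ θ, IsTestFunction a b θ ∧ ∫ t, θ t = 1 := by
  let φ : ContDiffBump ((a + b) / 2) :=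
    ⟨(b - a) / 8, (b - a) / 4, by linarith, by linarith⟩
  refine ⟨φ.normed volume, ⟨φ.contDiff_normed, φ.hasCompactSupport_normed, ?_⟩,
    φ.integral_normed⟩
  rw [φ.tsupport_normed_eq, Real.closedBall_eq_Icc]
  exact Icc_subset_Ioo (by simp only [φ]; linarith) (by simp only [φ]; linarith)

/-- The du Bois-Reymond lemma on an interval. -/
lemma exists_ae_eq_const_of_integral_deriv_mul {a b : ℝ} (hab : a < b) {G : ℝ → ℝ}
    (hG : IntegrableOn G (Ioo a b))
    (h : ∀ θ, IsTestFunction a b θ → ∫ t in Ioo a b, deriv θ t * G t = 0) :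
    ∃ c, ∀ᵐ t ∂(volume.restrict (Ioo a b)), G t = c := by
  obtain ⟨θ₀, h₀, h₀i⟩ := exists_isTestFunction_integral_eq_one hab
  have hbd (g : ℝ → ℝ) (hg : IsTestFunction a b g) : ∃ C, ∀ t, ‖g t‖ ≤ C :=
    hg.hasCompactSupport.exists_bound_of_continuous hg.contDiff.continuous
  have hgG (g : ℝ → ℝ) (hg : IsTestFunction a b g) (c : ℝ) :
      IntegrableOn (fun t => g t * (G t - c)) (Ioo a b) := by
    obtain ⟨C, hC⟩ := hbd g hg
    exact (hG.sub (integrable_const c)).bdd_mul hg.contDiff.continuous.aestronglyMeasurable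
      (Eventually.of_forall hC)
  have hint (g : ℝ → ℝ) (hg : IsTestFunction a b g) : ∫ t in Ioo a b, g t = ∫ t, g t :=
    setIntegral_eq_integral_of_forall_compl_eq_zero fun t ht =>
      image_eq_zero_of_notMem_tsupport fun h' => ht (hg.tsupport_subset h')
  set c := ∫ t in Ioo a b, θ₀ t * G t
  refine ⟨c, ?_⟩
  have key := isOpen_Ioo.ae_eq_zero_of_integral_contDiff_smul_eq_zero (μ := volume)
    (f := fun t => G t - c) (U := Ioo a b)
    ((hG.sub (integrable_const c)).locallyIntegrableOn) fun g hg1 hg2 hg3 => by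
      have hg : IsTestFunction a b g := ⟨hg1, hg2, hg3⟩
      set m := ∫ t, g t
      -- Removing the multiple `m` of `θ₀` leaves mean zero, hence the derivative of a test
      -- function. So `G` pairs with `g` as the constant `c`, its mean against `θ₀`, does.
      have hsub : IsTestFunction a b (fun t => g t - m * θ₀ t) := by
        refine ⟨hg1.sub (contDiff_const.mul h₀.contDiff),
          hg2.sub (h₀.hasCompactSupport.mul_left), ?_⟩
        refine (tsupport_sub g (fun t => m * θ₀ t)).trans
          (union_subset hg3 ((closure_mono ?_).trans h₀.tsupport_subset))
        exact Function.support_mul_subset_right _ _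
      have hgi : Integrable g := hg1.continuous.integrable_of_hasCompactSupport hg2
      have h₀int : Integrable θ₀ :=
        h₀.contDiff.continuous.integrable_of_hasCompactSupport h₀.hasCompactSupport
      obtain ⟨θ, hθ, hθd⟩ := hsub.exists_primitive hab (by
        rw [integral_sub hgi (h₀int.const_mul _), integral_const_mul, h₀i]; simp [m])
      have h1 := h θ hθ
      rw [hθd] at h1
      have hG0 (g : ℝ → ℝ) (hg : IsTestFunction a b g) :
          IntegrableOn (fun t => g t * G t) (Ioo a b) := by simpa using hgG g hg 0
      have e : (fun t => (g t - m * θ₀ t) * G t) = fun t => g t * G t - m * (θ₀ t * G t) := by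
        funext t; ring
      rw [e, integral_sub (hG0 g hg) ((hG0 θ₀ h₀).const_mul m), integral_const_mul] at h1
      rw [← setIntegral_eq_integral_of_forall_compl_eq_zero (s := Ioo a b) fun t ht => by
        rw [image_eq_zero_of_notMem_tsupport fun h' => ht (hg3 h')]; simp]
      simp only [smul_eq_mul, mul_sub]
      rw [integral_sub (hG0 g hg) (hgi.integrableOn.mul_const c), integral_mul_const, hint g hg]
      linarith
  rw [ae_restrict_iff' measurableSet_Ioo]
  filter_upwards [key] with t ht h'
  linarith [ht h']

lemma IsTestFunction.absolutelyContinuousOnInterval {a b : ℝ} {θ : ℝ → ℝ}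
    (h : IsTestFunction a b θ) : AbsolutelyContinuousOnInterval θ a b :=
  ((h.contDiff.of_le (m := 1) (by simp)).contDiffOn).absolutelyContinuousOnInterval

/-- A function whose weak derivative is `v` is a primitive of `v`. -/
lemma exists_ae_eq_const_add_integral {T : ℝ} (hT : 0 < T) {u v : ℝ → ℝ}
    (hu : IntegrableOn u (Ioo 0 T)) (hv : IntegrableOn v (Ioo 0 T))
    (h : ∀ θ, IsTestFunction 0 T θ → ∫ t in Ioo 0 T, (deriv θ t * u t + θ t * v t) = 0) :
    ∃ c, ∀ᵐ t ∂(volume.restrict (Ioo 0 T)), u t = c + ∫ s in 0..t, v s := by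
  have hvi : IntervalIntegrable v volume 0 T := by
    rw [intervalIntegrable_iff_integrableOn_Ioo_of_le hT.le]; exact hv
  have hP : AbsolutelyContinuousOnInterval (fun t => ∫ s in 0..t, v s) 0 T :=
    hvi.absolutelyContinuousOnInterval_intervalIntegral (by simp)
  have hPc : ContinuousOn (fun t => ∫ s in 0..t, v s) (Icc 0 T) := by
    have := hP.continuousOn; rwa [uIcc_of_le hT.le] at this
  have hPi : IntegrableOn (fun t => ∫ s in 0..t, v s) (Ioo 0 T) :=
    (hPc.integrableOn_compact isCompact_Icc).mono_set Ioo_subset_Icc_self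
  have hder : ∀ᵐ t ∂(volume.restrict (Ioo 0 T)), deriv (fun t => ∫ s in 0..t, v s) t = v t := by
    rw [ae_restrict_iff' measurableSet_Ioo]
    filter_upwards [hvi.ae_hasDerivAt_integral] with t ht ht'
    exact (ht (by rw [uIcc_of_le hT.le]; exact Ioo_subset_Icc_self ht') 0 (by simp)).deriv
  -- Integration by parts for absolutely continuous functions shows that the primitive of `v` also
  -- has weak derivative `v`, so the difference has weak derivative zero.
  obtain ⟨c, hc⟩ := exists_ae_eq_const_of_integral_deriv_mul hT (hu.sub hPi) fun θ hθ => by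
    have hz (t : ℝ) (ht : t ∉ Ioo 0 T) : θ t = 0 :=
      image_eq_zero_of_notMem_tsupport fun h' => ht (hθ.tsupport_subset h')
    have hp := hθ.absolutelyContinuousOnInterval.integral_deriv_mul_eq_sub hP
    rw [hz 0 (by simp), hz T (by simp), intervalIntegral.integral_of_le hT.le,
      integral_Ioc_eq_integral_Ioo] at hp
    obtain ⟨C, hC⟩ := hθ.hasCompactSupport.exists_bound_of_continuous hθ.contDiff.continuous
    have hθ'c : Continuous (deriv θ) := hθ.contDiff.continuous_deriv (by simp)
    obtain ⟨C', hC'⟩ := hθ.hasCompactSupport.deriv.exists_bound_of_continuous hθ'c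
    have i1 : IntegrableOn (fun t => deriv θ t * u t) (Ioo 0 T) :=
      hu.bdd_mul hθ'c.aestronglyMeasurable (Eventually.of_forall hC')
    have i2 : IntegrableOn (fun t => deriv θ t * ∫ s in 0..t, v s) (Ioo 0 T) :=
      hPi.bdd_mul hθ'c.aestronglyMeasurable (Eventually.of_forall hC')
    have i3 : IntegrableOn (fun t => θ t * v t) (Ioo 0 T) :=
      hv.bdd_mul hθ.contDiff.continuous.aestronglyMeasurable (Eventually.of_forall hC)
    have e1 : ∫ t in Ioo 0 T, (deriv θ t * (∫ s in 0..t, v s) + θ t * v t) = 0 := by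
      rw [zero_mul, zero_mul, sub_zero] at hp
      refine Eq.trans (integral_congr_ae ?_) hp
      filter_upwards [hder] with t ht
      rw [ht]
    have e2 := h θ hθ
    rw [integral_add i1 i3] at e2
    rw [integral_add i2 i3] at e1
    simp only [Pi.sub_apply, mul_sub]
    rw [integral_sub i1 i2]
    linarith
  refine ⟨c, hc.mono fun t ht => ?_⟩
  simp only [Pi.sub_apply] at ht
  linarith

/-- The product rule for primitives, tested against `θ`. -/
lemma integral_deriv_mul_prod_add {T : ℝ} (hT : 0 < T) {ι : Type*} [Fintype ι] [DecidableEq ι]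
    {u v : ι → ℝ → ℝ} (hv : ∀ i, IntegrableOn (v i) (Ioo 0 T))
    (h : ∀ i, ∃ c, ∀ᵐ t ∂(volume.restrict (Ioo 0 T)), u i t = c + ∫ s in 0..t, v i s)
    {θ : ℝ → ℝ} (hθ : IsTestFunction 0 T θ) :
    ∫ t in Ioo 0 T, (deriv θ t * ∏ i, u i t
      + θ t * ∑ i, (∏ j ∈ Finset.univ.erase i, u j t) * v i t) = 0 := by
  choose c hc using h
  have hvi (i : ι) : IntervalIntegrable (v i) volume 0 T := by
    rw [intervalIntegrable_iff_integrableOn_Ioo_of_le hT.le]; exact hv i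
  set P : ι → ℝ → ℝ := fun i t => c i + ∫ s in 0..t, v i s
  have hconst (k : ℝ) : AbsolutelyContinuousOnInterval (fun _ : ℝ => k) 0 T :=
    (contDiff_const (n := 1) (𝕜 := ℝ) (c := k) (E := ℝ)).contDiffOn.absolutelyContinuousOnInterval
  have hP (i : ι) : AbsolutelyContinuousOnInterval (P i) 0 T :=
    (hconst _).add ((hvi i).absolutelyContinuousOnInterval_intervalIntegral (by simp))
  have hprod (s : Finset ι) : AbsolutelyContinuousOnInterval (fun t => ∏ i ∈ s, P i t) 0 T := by
    induction s using Finset.induction_on with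
    | empty => simpa using hconst 1
    | insert i s hi ih =>
      simp_rw [Finset.prod_insert hi]
      exact (hP i).mul ih
  have hder (i : ι) : ∀ᵐ t ∂(volume.restrict (Ioo 0 T)), HasDerivAt (P i) (v i t) t := by
    rw [ae_restrict_iff' measurableSet_Ioo]
    filter_upwards [(hvi i).ae_hasDerivAt_integral] with t ht ht'
    exact (ht (by rw [uIcc_of_le hT.le]; exact Ioo_subset_Icc_self ht') 0 (by simp)).const_add _
  have hz (t : ℝ) (ht : t ∉ Ioo 0 T) : θ t = 0 :=
    image_eq_zero_of_notMem_tsupport fun h' => ht (hθ.tsupport_subset h')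
  -- The product of the primitives is absolutely continuous and `θ` vanishes at both endpoints, so
  -- integration by parts leaves no boundary term.
  have hp := hθ.absolutelyContinuousOnInterval.integral_deriv_mul_eq_sub (hprod Finset.univ)
  rw [hz 0 (by simp), hz T (by simp), intervalIntegral.integral_of_le hT.le,
    integral_Ioc_eq_integral_Ioo, zero_mul, zero_mul, sub_zero] at hp
  refine Eq.trans (integral_congr_ae ?_) hp
  filter_upwards [ae_all_iff.2 hder, ae_all_iff.2 hc] with t h1 h2
  have hd : HasDerivAt (fun t => ∏ i, P i t)
      (∑ i, (∏ j ∈ Finset.univ.erase i, P j t) • v i t) t :=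
    HasDerivAt.fun_finsetProd fun i _ => h1 i
  simp only [hd.deriv, smul_eq_mul, h2, P]

end WeakDerivative

/-! ### From averages over labels to almost every label -/

/-- The label test functions are restrictions of smooth functions on `ℝ`; pushing Lebesgue measure
on `[0,1]` forward to `ℝ` reduces the claim to the fundamental lemma there. -/
lemma ae_eq_zero_of_forall_integral_smooth_mul_eq_zero {h : I → ℝ} (hh : Integrable h)
    (h0 : ∀ c : ℝ → ℝ, ContDiff ℝ ∞ c → HasCompactSupport c → ∫ ξ : I, c ξ * h ξ = 0) :
    ∀ᵐ ξ, h ξ = 0 := by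
  have hemb : MeasurableEmbedding (Subtype.val : I → ℝ) :=
    MeasurableEmbedding.subtype_coe measurableSet_Icc
  set H : ℝ → ℝ := fun x => h (projIcc 0 1 zero_le_one x)
  have hH (ξ : I) : H ξ = h ξ := by simp [H]
  have hint : Integrable H ((volume : Measure I).map Subtype.val) :=
    hemb.integrable_map_iff.2 (by simpa [Function.comp_def, hH] using hh)
  have key := ae_eq_zero_of_integral_contDiff_smul_eq_zero hint.locallyIntegrable
    fun c hc1 hc2 => by
      rw [hemb.integral_map]
      simpa [hH] using h0 c hc1 hc2
  filter_upwards [ae_of_ae_map hemb.measurable.aemeasurable key] with ξ hξ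
  rwa [hH] at hξ

lemma ae_eq_zero_of_forall_countable_setIntegral_eq_zero {X : Type*} [MeasurableSpace X]
    {μ : Measure X} [IsFiniteMeasure μ] {S : Set (Set X)} (hpi : IsPiSystem S) (hu : univ ∈ S)
    (hS : ‹MeasurableSpace X› = MeasurableSpace.generateFrom S) {h : X → ℝ} (hh : Integrable h μ)
    (h0 : ∀ B ∈ S, ∫ x in B, h x ∂μ = 0) : h =ᵐ[μ] 0 := by
  refine hh.ae_eq_of_withDensityᵥ_eq (integrable_zero _ _ _) ?_
  have hm (B : Set X) (hB : B ∈ S) : MeasurableSet B := by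
    rw [hS]; exact MeasurableSpace.measurableSet_generateFrom hB
  have key (B : Set X) (hB : B ∈ S) : μ.withDensityᵥ h B = μ.withDensityᵥ (0 : X → ℝ) B := by
    rw [withDensityᵥ_apply hh (hm B hB), h0 B hB]
    simp
  exact VectorMeasure.ext_of_generateFrom S key hS hpi (key univ hu)

/-- A function on `(0,T) × [0,1]` with weak time derivative `v` is, for almost every label, a
primitive of `v`. -/
lemma ae_exists_ae_eq_const_add_integral {T : ℝ} (hT : 0 < T) {u v : ℝ × I → ℝ}
    (hu : Measurable u) (hv : Measurable v) {A : ℝ} (huA : ∀ p, |u p| ≤ A) (hvA : ∀ p, |v p| ≤ A)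
    (h : ∀ θ, IsTestFunction 0 T θ → ∀ c : ℝ → ℝ, ContDiff ℝ ∞ c → HasCompactSupport c →
      ∫ ξ : I, c ξ * ∫ t in Ioo 0 T, (deriv θ t * u (t, ξ) + θ t * v (t, ξ)) = 0) :
    ∀ᵐ ξ : I, ∃ c, ∀ᵐ t ∂(volume.restrict (Ioo 0 T)),
      u (t, ξ) = c + ∫ s in 0..t, v (s, ξ) := by
  set lam : Measure ℝ := volume.restrict (Ioo 0 T)
  have hprodint {g : ℝ × I → ℝ} (hg : Measurable g) {C : ℝ} (hgC : ∀ p, |g p| ≤ C) :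
      Integrable g (lam.prod volume) :=
    Integrable.of_bound hg.aestronglyMeasurable C (Eventually.of_forall hgC)
  obtain ⟨S, hSc, hSpi, hSu, hS⟩ := exists_countable_isPiSystem I
  have hSm (B : Set I) (hB : B ∈ S) : MeasurableSet B := by
    rw [hS]; exact MeasurableSpace.measurableSet_generateFrom hB
  have hθ_bounds (θ : ℝ → ℝ) (hθ : IsTestFunction 0 T θ) :
      ∃ C C', (∀ t, |θ t| ≤ C) ∧ (∀ t, |deriv θ t| ≤ C') ∧ Continuous θ ∧ Continuous (deriv θ) := by
    have hθ'c : Continuous (deriv θ) := hθ.contDiff.continuous_deriv (by simp)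
    obtain ⟨C, hC⟩ := hθ.hasCompactSupport.exists_bound_of_continuous hθ.contDiff.continuous
    obtain ⟨C', hC'⟩ := hθ.hasCompactSupport.deriv.exists_bound_of_continuous hθ'c
    exact ⟨C, C', hC, hC', hθ.contDiff.continuous, hθ'c⟩
  have hi1 (θ : ℝ → ℝ) (hθ : IsTestFunction 0 T θ) :
      Integrable (fun p : ℝ × I => deriv θ p.1 * u p) (lam.prod volume) := by
    obtain ⟨C, C', hC, hC', hc, hc'⟩ := hθ_bounds θ hθ
    exact (hprodint hu huA).bdd_mul (c := C') (by fun_prop) (Eventually.of_forall fun p => hC' p.1)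
  have hi2 (θ : ℝ → ℝ) (hθ : IsTestFunction 0 T θ) :
      Integrable (fun p : ℝ × I => θ p.1 * v p) (lam.prod volume) := by
    obtain ⟨C, C', hC, hC', hc, hc'⟩ := hθ_bounds θ hθ
    exact (hprodint hv hvA).bdd_mul (c := C) (by fun_prop) (Eventually.of_forall fun p => hC p.1)
  -- primitive in time
  set P : ℝ × I → ℝ := fun p => ∫ s, (if 0 < s ∧ s ≤ p.1 then v (s, p.2) else 0) ∂lam
  have hPm : Measurable P := by
    refine (StronglyMeasurable.integral_prod_right (f := fun p : ℝ × I => fun s : ℝ =>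
      if 0 < s ∧ s ≤ p.1 then v (s, p.2) else 0) ?_).measurable
    refine (Measurable.ite ?_ (hv.comp (by fun_prop)) measurable_const).stronglyMeasurable
    exact (measurableSet_lt measurable_const measurable_snd).inter
      (measurableSet_le measurable_snd (by fun_prop))
  have hP (t : ℝ) (ht : t ∈ Ioo 0 T) (ξ : I) : P (t, ξ) = ∫ s in 0..t, v (s, ξ) := by
    rw [intervalIntegral.integral_of_le ht.1.le]
    have e : ∀ s, (if 0 < s ∧ s ≤ t then v (s, ξ) else 0)
        = (Ioc 0 t).indicator (fun s => v (s, ξ)) s := fun s => by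
      simp [indicator, mem_Ioc]
    simp only [P, e]
    rw [integral_indicator measurableSet_Ioc, Measure.restrict_restrict measurableSet_Ioc,
      show Ioc 0 t ∩ Ioo 0 T = Ioc 0 t from
        inter_eq_left.2 fun s hs => ⟨hs.1, hs.2.trans_lt ht.2⟩]
  have hPA (p : ℝ × I) : |P p| ≤ A * T := by
    refine (norm_integral_le_of_norm_le_const (μ := lam) (C := A)
      (f := fun s => if 0 < s ∧ s ≤ p.1 then v (s, p.2) else 0) (Eventually.of_forall fun s => ?_)).trans ?_
    · split_ifs
      · exact hvA _
      · simpa using (abs_nonneg _).trans (hvA (0, 0))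
    · simp [lam, measureReal_def, hT.le]
  have hHm : Measurable fun p => u p - P p := hu.sub hPm
  have hHb (p : ℝ × I) : |u p - P p| ≤ A + A * T :=
    (abs_sub _ _).trans (add_le_add (huA p) (hPA p))
  -- Averaging over a fixed set of labels gives a scalar function of time, to which the one-variable
  -- statement applies. The exceptional null set of times depends on `B`.
  have hB (B : Set I) (hB : MeasurableSet B) : ∃ c, ∀ᵐ t ∂lam, ∫ ξ in B, (u (t, ξ) - P (t, ξ)) = c := by
    have hres : lam.prod (volume.restrict B) ≤ lam.prod volume :=
      Measure.prod_mono le_rfl Measure.restrict_le_self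
    have hres' {g : ℝ × I → ℝ} (hg : Integrable g (lam.prod volume)) :
        Integrable g (lam.prod (volume.restrict B)) := hg.mono_measure hres
    obtain ⟨c, hc⟩ := exists_ae_eq_const_add_integral hT
      (u := fun t => ∫ ξ in B, u (t, ξ)) (v := fun t => ∫ ξ in B, v (t, ξ))
      (hres' (hprodint hu huA)).integral_prod_left (hres' (hprodint hv hvA)).integral_prod_left
      fun θ hθ => by
        have hsum : Integrable (fun p : ℝ × I => deriv θ p.1 * u p + θ p.1 * v p)
          (lam.prod volume) := (hi1 θ hθ).add (hi2 θ hθ)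
        have hzero := ae_eq_zero_of_forall_integral_smooth_mul_eq_zero hsum.integral_prod_right
          (fun c hc1 hc2 => h θ hθ c hc1 hc2)
        calc ∫ t in Ioo 0 T, (deriv θ t * (∫ ξ in B, u (t, ξ)) + θ t * ∫ ξ in B, v (t, ξ))
            = ∫ t, (∫ ξ in B, (deriv θ t * u (t, ξ) + θ t * v (t, ξ))) ∂lam := by
              refine integral_congr_ae ?_
              filter_upwards [(hres' (hi1 θ hθ)).prod_right_ae, (hres' (hi2 θ hθ)).prod_right_ae]
                with t h1 h2
              rw [integral_add h1 h2, integral_const_mul, integral_const_mul]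
          _ = ∫ ξ in B, ∫ t, (deriv θ t * u (t, ξ) + θ t * v (t, ξ)) ∂lam :=
              integral_integral_swap
                (f := fun t ξ => deriv θ t * u (t, ξ) + θ t * v (t, ξ)) (hres' hsum)
          _ = 0 := integral_eq_zero_of_ae (ae_restrict_of_ae hzero)
    refine ⟨c, ?_⟩
    filter_upwards [hc, ae_restrict_mem measurableSet_Ioo] with t ht htm
    have hu1 : Integrable (fun ξ => u (t, ξ)) (volume.restrict B) :=
      Integrable.of_bound (hu.comp measurable_prodMk_left).aestronglyMeasurable A
        (Eventually.of_forall fun ξ => huA _)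
    have hP1 : Integrable (fun ξ => P (t, ξ)) (volume.restrict B) :=
      Integrable.of_bound (hPm.comp measurable_prodMk_left).aestronglyMeasurable (A * T)
        (Eventually.of_forall fun ξ => hPA _)
    rw [integral_sub hu1 hP1, ht]
    have : ∫ ξ in B, P (t, ξ) = ∫ s in 0..t, ∫ ξ in B, v (s, ξ) := by
      simp_rw [hP t htm]
      rw [intervalIntegral.integral_of_le htm.1.le]
      simp_rw [intervalIntegral.integral_of_le htm.1.le]
      refine integral_integral_swap (f := fun ξ s => v (s, ξ)) ?_
      exact Integrable.of_bound (hv.comp measurable_swap).aestronglyMeasurable A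
        (Eventually.of_forall fun p => hvA _)
    rw [this]; ring
  -- the mean over time
  set m : I → ℝ := fun ξ => T⁻¹ * ∫ t, (u (t, ξ) - P (t, ξ)) ∂lam
  have hmm : Measurable m := by
    refine measurable_const.mul (StronglyMeasurable.integral_prod_right
      (f := fun ξ t => u (t, ξ) - P (t, ξ)) ?_).measurable
    exact (hHm.comp measurable_swap).stronglyMeasurable
  have hmi : Integrable m := (hprodint hHm hHb).integral_prod_right.const_mul _
  have hmB (B : Set I) (hBm : MeasurableSet B) :
      ∀ᵐ t ∂lam, ∫ ξ in B, (u (t, ξ) - P (t, ξ) - m ξ) = 0 := by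
    obtain ⟨c, hc⟩ := hB B hBm
    have hres' : Integrable (fun p => u p - P p) (lam.prod (volume.restrict B)) :=
      (hprodint hHm hHb).mono_measure (Measure.prod_mono le_rfl Measure.restrict_le_self)
    have hmc : ∫ ξ in B, m ξ = c := by
      simp only [m]
      rw [integral_const_mul, ← integral_integral_swap (f := fun t ξ => u (t, ξ) - P (t, ξ)) hres', integral_congr_ae hc,
        integral_const]
      simp [lam, measureReal_def, hT.le, hT.ne']
    filter_upwards [hc] with t ht
    have h1 : Integrable (fun ξ => u (t, ξ) - P (t, ξ)) (volume.restrict B) :=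
      Integrable.of_bound (hHm.comp measurable_prodMk_left).aestronglyMeasurable _
        (Eventually.of_forall fun ξ => hHb _)
    rw [integral_sub h1 hmi.integrableOn, ht, hmc, sub_self]
  -- With `B` restricted to a countable generating π-system, one null set of times serves all `B`,
  -- and the integrals over these `B` determine the integrand. Fubini then exchanges the two
  -- quantifiers, both sides being jointly measurable.
  have hae : ∀ᵐ t ∂lam, ∀ᵐ ξ, u (t, ξ) - P (t, ξ) = m ξ := by
    filter_upwards [(ae_ball_iff hSc).2 fun B hBS => hmB B (hSm B hBS)] with t ht
    have h1 : Integrable (fun ξ => u (t, ξ) - P (t, ξ)) (volume : Measure I) :=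
      Integrable.of_bound (hHm.comp measurable_prodMk_left).aestronglyMeasurable _
        (Eventually.of_forall fun ξ => hHb _)
    filter_upwards [ae_eq_zero_of_forall_countable_setIntegral_eq_zero hSpi hSu hS
      (h1.sub hmi) ht] with ξ hξ
    simpa [sub_eq_zero] using hξ
  have hset : MeasurableSet {p : ℝ × I | u p - P p = m p.2} :=
    measurableSet_eq_fun hHm (hmm.comp measurable_snd)
  have hae' : ∀ᵐ ξ, ∀ᵐ t ∂lam, u (t, ξ) - P (t, ξ) = m ξ :=
    (Measure.ae_ae_comm (p := fun t ξ => u (t, ξ) - P (t, ξ) = m ξ) hset).1 hae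
  filter_upwards [hae'] with ξ hξ
  refine ⟨m ξ, ?_⟩
  filter_upwards [hξ, ae_restrict_mem measurableSet_Ioo] with t ht htm
  rw [← hP t htm, ← ht]; ring

/-! ### Bounded measurable representatives of the solution, the kernel and the velocity -/

section Density

variable {d : ℕ}

/-- Measurable densities `g(t, x, ξ)`, bounded in `L^1_x` uniformly in `(t, ξ)`. -/
structure IsDensity (g : ℝ × Space d × I → ℝ) (C : ℝ≥0) : Prop where
  measurable : Measurable g
  lintegral_le : ∀ t ξ, ∫⁻ x, ‖g (t, x, ξ)‖ₑ ≤ C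

namespace IsDensity

variable {g : ℝ × Space d × I → ℝ} {C : ℝ≥0}

lemma integrable (hg : IsDensity g C) (t : ℝ) (ξ : I) : Integrable fun x => g (t, x, ξ) :=
  ⟨(hg.measurable.comp (by fun_prop)).aestronglyMeasurable,
    (hg.lintegral_le t ξ).trans_lt ENNReal.coe_lt_top⟩

lemma integral_norm_le (hg : IsDensity g C) (t : ℝ) (ξ : I) : ∫ x, ‖g (t, x, ξ)‖ ≤ C := by
  rw [integral_norm_eq_lintegral_enorm (hg.integrable t ξ).1]
  exact ENNReal.toReal_le_coe_of_le_coe (hg.lintegral_le t ξ)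

lemma norm_integral_smul_le (hg : IsDensity g C) {E : Type*} [NormedAddCommGroup E]
    [NormedSpace ℝ E] {β : Space d → E} {B : ℝ} (hβ : ∀ x, ‖β x‖ ≤ B) (t : ℝ) (ξ : I) :
    ‖∫ x, g (t, x, ξ) • β x‖ ≤ C * B := by
  have hB : 0 ≤ B := (norm_nonneg _).trans (hβ 0)
  refine (norm_integral_le_of_norm_le ((hg.integrable t ξ).norm.mul_const B)
    (Eventually.of_forall fun x => ?_)).trans ?_
  · rw [norm_smul]
    exact mul_le_mul_of_nonneg_left (hβ x) (norm_nonneg _)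
  · rw [integral_mul_const]
    exact mul_le_mul_of_nonneg_right (hg.integral_norm_le t ξ) hB

lemma lintegral_prod_le (hg : IsDensity g C) {n : ℕ} (t : ℝ) (ξ : Fin n → I) :
    ∫⁻ x : Fin n → Space d, ‖∏ m, g (t, x m, ξ m)‖ₑ ≤ C ^ n := by
  have hi : Integrable fun x : Fin n → Space d => ∏ m, g (t, x m, ξ m) :=
    Integrable.fintype_prod (f := fun m x => g (t, x, ξ m)) fun m => hg.integrable t (ξ m)
  rw [← ofReal_integral_norm_eq_lintegral_enorm hi]
  simp_rw [norm_prod]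
  rw [integral_fintype_prod_volume_eq_prod (fun m (x : Space d) => ‖g (t, x, ξ m)‖)]
  refine (ENNReal.ofReal_le_ofReal (Finset.prod_le_prod (fun m _ =>
    integral_nonneg fun x => norm_nonneg _) fun m _ => hg.integral_norm_le t (ξ m))).trans ?_
  simp [ENNReal.ofReal_pow]

end IsDensity

/-- The convolution `∫ K(x - y) g(t, y, ζ) dy`. -/
def spaceConv (K : Space d → Space d) (g : ℝ × Space d × I → ℝ) (p : ℝ × Space d × I) : Space d :=
  ∫ y, g (p.1, y, p.2.2) • K (p.2.1 - y)

/-- The velocity field of a disintegrated graphon. -/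
def field (K : Space d → Space d) (κ : Kernel I I) (s : I × I → ℝ) (g : ℝ × Space d × I → ℝ)
    (p : ℝ × Space d × I) : Space d :=
  ∫ ζ, s (p.2.2, ζ) • spaceConv K g (p.1, p.2.1, ζ) ∂(κ p.2.2)

variable {K : Space d → Space d} {κ : Kernel I I} {s : I × I → ℝ} {g : ℝ × Space d × I → ℝ}
  {C : ℝ≥0} {B D : ℝ}

lemma measurable_spaceConv (hK : Measurable K) (hg : IsDensity g C) :
    Measurable (spaceConv K g) := by
  have hgm := hg.measurable
  refine (StronglyMeasurable.integral_prod_right (f := fun (p : ℝ × Space d × I) y =>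
    g (p.1, y, p.2.2) • K (p.2.1 - y)) ?_).measurable
  have h1 : Measurable fun q : (ℝ × Space d × I) × Space d => g (q.1.1, q.2, q.1.2.2) := by fun_prop
  have h2 : Measurable fun q : (ℝ × Space d × I) × Space d => K (q.1.2.1 - q.2) := by fun_prop
  exact (h1.smul h2).stronglyMeasurable

lemma norm_spaceConv_le (hKB : ∀ x, ‖K x‖ ≤ B) (hg : IsDensity g C) (p : ℝ × Space d × I) :
    ‖spaceConv K g p‖ ≤ C * B :=
  hg.norm_integral_smul_le (fun y => hKB (p.2.1 - y)) p.1 p.2.2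

variable [IsMarkovKernel κ]

lemma measurable_field (hK : Measurable K) (hg : IsDensity g C) (hs : Measurable s) :
    Measurable (field K κ s g) := by
  have hc := measurable_spaceConv hK hg
  refine (StronglyMeasurable.integral_kernel_prod_right
    (κ := κ.comap (fun p : ℝ × Space d × I => p.2.2) (by fun_prop))
    (f := fun (p : ℝ × Space d × I) ζ => s (p.2.2, ζ) • spaceConv K g (p.1, p.2.1, ζ)) ?_).measurable
  have h1 : Measurable fun q : (ℝ × Space d × I) × I => s (q.1.2.2, q.2) := by fun_prop
  have h2 : Measurable fun q : (ℝ × Space d × I) × I => spaceConv K g (q.1.1, q.1.2.1, q.2) := by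
    fun_prop
  exact (h1.smul h2).stronglyMeasurable

lemma norm_field_le (hKB : ∀ x, ‖K x‖ ≤ B) (hg : IsDensity g C) (hsD : ∀ p, |s p| ≤ D)
    (p : ℝ × Space d × I) : ‖field K κ s g p‖ ≤ D * (C * B) := by
  refine (norm_integral_le_of_norm_le_const (C := D * (C * B))
    (Eventually.of_forall fun ζ => ?_)).trans (by simp)
  rw [norm_smul]
  exact mul_le_mul (hsD _) (norm_spaceConv_le hKB hg _) (norm_nonneg _)
    ((abs_nonneg _).trans (hsD (0, 0)))

lemma integrable_spaceConv (hK : Measurable K) (hKB : ∀ x, ‖K x‖ ≤ B) (hg : IsDensity g C)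
    (t : ℝ) (x : Space d) (μ : Measure I) [IsFiniteMeasure μ] :
    Integrable (fun ζ => spaceConv K g (t, x, ζ)) μ :=
  Integrable.of_bound ((measurable_spaceConv hK hg).comp (by fun_prop)).aestronglyMeasurable
    (C * B) (Eventually.of_forall fun ζ => norm_spaceConv_le hKB hg _)

/-- `L^∞_{t,ξ} L^1_x` functions have representatives that are densities. -/
lemma MemLinftyLinftyL1.exists_isDensity {T : ℝ} {f : ℝ → Space d → I → ℝ}
    (hf : MemLinftyLinftyL1 T f) : ∃ (g : ℝ × Space d × I → ℝ) (C : ℝ≥0), IsDensity g C ∧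
      ∀ᵐ p ∂((volume.restrict (Ioo 0 T)).prod (volume.prod volume)), f p.1 p.2.1 p.2.2 = g p := by
  obtain ⟨hf1, C, hC⟩ := hf
  set g₀ := hf1.mk _
  have hg₀ : Measurable g₀ := hf1.stronglyMeasurable_mk.measurable
  have hfg : ∀ᵐ p ∂((volume.restrict (Ioo 0 T)).prod ((volume : Measure (Space d)).prod
    (volume : Measure I))), f p.1 p.2.1 p.2.2 = g₀ p := hf1.ae_eq_mk
  set N : ℝ × I → ℝ≥0∞ := fun q => ∫⁻ x, ‖g₀ (q.1, x, q.2)‖ₑ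
  have hN : Measurable N := by
    refine Measurable.lintegral_prod_right' (f := fun r : (ℝ × I) × Space d =>
      ‖g₀ (r.1.1, r.2, r.1.2)‖ₑ) ?_
    fun_prop
  have hsec : ∀ᵐ t ∂(volume.restrict (Ioo 0 T)), ∀ᵐ ξ : I, ∀ᵐ x, f t x ξ = g₀ (t, x, ξ) := by
    filter_upwards [Measure.ae_ae_of_ae_prod hfg] with t ht
    exact Measure.ae_ae_of_ae_prod
      (Measure.measurePreserving_swap.quasiMeasurePreserving.ae ht)
  have hNC : ∀ᵐ t ∂(volume.restrict (Ioo 0 T)), ∀ᵐ ξ : I, N (t, ξ) ≤ C := by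
    filter_upwards [hsec, Measure.ae_ae_of_ae_prod hC] with t ht htC
    filter_upwards [ht, htC] with ξ hξ hξC
    refine le_trans (le_of_eq (lintegral_congr_ae ?_)) hξC
    filter_upwards [hξ] with x hx
    rw [hx]
  have hset : MeasurableSet {q : ℝ × I | N q ≤ C} := measurableSet_le hN measurable_const
  -- Discarding the null set of `(t, ξ)` on which the `L^1_x` norm exceeds `C` makes the bound hold
  -- for every time and label.
  refine ⟨fun p => if N (p.1, p.2.2) ≤ C then g₀ p else 0, C, ⟨?_, fun t ξ => ?_⟩, ?_⟩
  · exact Measurable.ite (hset.preimage (by fun_prop)) hg₀ measurable_const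
  · by_cases h : N (t, ξ) ≤ C
    · simp only [if_pos h]
      exact h
    · simp [if_neg h]
  · have hq : ∀ᵐ q ∂((volume.restrict (Ioo 0 T)).prod (volume : Measure I)), N q ≤ C :=
      (Measure.ae_prod_iff_ae_ae hset).2 hNC
    have hqmp : Measure.QuasiMeasurePreserving (fun p : ℝ × Space d × I => (p.1, p.2.2))
        ((volume.restrict (Ioo 0 T)).prod ((volume : Measure (Space d)).prod
          (volume : Measure I))) ((volume.restrict (Ioo 0 T)).prod (volume : Measure I)) :=
      QuasiMeasurePreserving.prodMap (.id _) Measure.quasiMeasurePreserving_snd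
    filter_upwards [hfg, hqmp.ae hq] with p hp hpN
    rw [hp, if_pos hpN]

/-- Essentially bounded kernels have bounded measurable representatives. -/
lemma exists_measurable_bounded_ae_eq (hK : MemLp K ∞ volume) :
    ∃ (K' : Space d → Space d) (B : ℝ), Measurable K' ∧ (∀ x, ‖K' x‖ ≤ B) ∧ K =ᵐ[volume] K' := by
  set K₀ := hK.1.mk K
  have hm : Measurable K₀ := hK.1.stronglyMeasurable_mk.measurable
  set B : ℝ := (eLpNorm K ∞ volume).toReal
  have hb : ∀ᵐ x, ‖K x‖ ≤ B := by
    have h1 := ae_le_eLpNormEssSup (f := K) (μ := volume)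
    filter_upwards [h1] with x hx
    rw [← eLpNorm_exponent_top] at hx
    rw [← toReal_enorm]
    exact ENNReal.toReal_mono hK.2.ne hx
  refine ⟨fun x => if ‖K₀ x‖ ≤ B then K₀ x else 0, B, ?_, fun x => ?_, ?_⟩
  · exact Measurable.ite (measurableSet_le hm.norm measurable_const) hm measurable_const
  · dsimp only
    split_ifs with h
    · exact h
    · simp [B]
  · filter_upwards [hK.1.ae_eq_mk, hb] with x hx hxB
    have : K₀ x = K x := hx.symm
    simp only [this, if_pos hxB]

lemma integral_smul_congr_ae {K' : Space d → Space d} (hK : K =ᵐ[volume] K') {h h' : Space d → ℝ}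
    (hh : h =ᵐ[volume] h') (x : Space d) : ∫ y, h y • K (x - y) = ∫ y, h' y • K' (x - y) := by
  have h2 : ∀ᵐ y, K (x - y) = K' (x - y) :=
    (Measure.measurePreserving_sub_left volume x).quasiMeasurePreserving.ae hK
  refine integral_congr_ae ?_
  filter_upwards [hh, h2] with y h1 h2
  rw [h1, h2]

/-- The functions `f` and `g` agree for Lebesgue-almost every `ζ`, hence for `κ ξ`-almost every `ζ`
at almost every `ξ`. The velocities agree at every `x`, since the convolution sees its two factors
only up to null sets of `y`. -/
lemma ae_velocity_eq_field {T : ℝ} {w : I → SignedMeasure I} {f : ℝ → Space d → I → ℝ}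
    {K' : Space d → Space d} (hKK : K =ᵐ[volume] K') (hK : Measurable K')
    (hKB : ∀ x, ‖K' x‖ ≤ B) (hw : IsGraphonKernel w κ s D) (hg : IsDensity g C)
    (hfg : ∀ᵐ p ∂((volume.restrict (Ioo 0 T)).prod (volume.prod volume)),
      f p.1 p.2.1 p.2.2 = g p) :
    ∀ᵐ t ∂(volume.restrict (Ioo 0 T)), ∀ᵐ ξ : I, (∀ᵐ x, f t x ξ = g (t, x, ξ)) ∧
      ∀ x, velocity K w f t x ξ = field K' κ s g (t, x, ξ) := by
  filter_upwards [Measure.ae_ae_of_ae_prod hfg] with t ht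
  have h1 : ∀ᵐ ξ : I, ∀ᵐ x, f t x ξ = g (t, x, ξ) := Measure.ae_ae_of_ae_prod
    (Measure.measurePreserving_swap.quasiMeasurePreserving.ae ht)
  have h2 : ∀ᵐ ξ : I, ∀ᵐ ζ ∂(κ ξ), ∀ᵐ x, f t x ζ = g (t, x, ζ) :=
    Measure.ae_ae_of_ae_comp (hw.comp_absolutelyContinuous.ae_le h1)
  filter_upwards [h1, h2, hw.ae_integral_eq] with ξ hξ1 hξ2 hξ3
  refine ⟨hξ1, fun x => ?_⟩
  have e : (fun ζ => ∫ y, f t y ζ • K (x - y)) =ᵐ[κ ξ] fun ζ => spaceConv K' g (t, x, ζ) := by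
    filter_upwards [hξ2] with ζ hζ
    exact integral_smul_congr_ae hKK hζ x
  rw [velocity, hξ3 ((integrable_spaceConv hK hKB hg t x _).congr e.symm), field]
  refine integral_congr_ae ?_
  filter_upwards [e] with ζ hζ
  rw [hζ]

end Density

/-! ### Observables and their fluxes as integrals over labels -/

section Observables

variable {d n : ℕ} {g : ℝ × Space d × I → ℝ} {C : ℝ≥0} {A : ℝ}
  {M : Measure (Fin n → I)} [IsProbabilityMeasure M] {S : (Fin n → I) → ℝ}

instance sFinite_volume_prod {X : Type*} [MeasurableSpace X] (M : Measure X) [SFinite M] :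
    SFinite ((volume : Measure (Fin n → Space d)).prod M) :=
  Measure.prod.instSFinite

lemma IsDensity.measurable_prod (hg : IsDensity g C) :
    Measurable fun p : ℝ × (Fin n → Space d) × (Fin n → I) => ∏ m, g (p.1, p.2.1 m, p.2.2 m) := by
  have := hg.measurable
  fun_prop

lemma IsDensity.lintegral_weight_le (hg : IsDensity g C) (hS : Measurable S)
    (hSA : ∀ ξ, |S ξ| ≤ A) (t : ℝ) :
    ∫⁻ p : (Fin n → Space d) × (Fin n → I), ‖S p.2 * ∏ m, g (t, p.1 m, p.2 m)‖ₑ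
      ∂(volume.prod M) ≤ ENNReal.ofReal A * C ^ n := by
  have hm : Measurable fun p : (Fin n → Space d) × (Fin n → I) =>
      ∏ m, g (t, p.1 m, p.2 m) := hg.measurable_prod.comp measurable_prodMk_left
  rw [lintegral_prod_symm' _ (by fun_prop)]
  calc ∫⁻ ξ, (∫⁻ x : Fin n → Space d, ‖S ξ * ∏ m, g (t, x m, ξ m)‖ₑ) ∂M
      ≤ ∫⁻ _, ENNReal.ofReal A * C ^ n ∂M := by
        refine lintegral_mono fun ξ => ?_
        simp_rw [enorm_mul]
        rw [lintegral_const_mul' _ _ enorm_ne_top]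
        refine mul_le_mul' ?_ (hg.lintegral_prod_le t ξ)
        rw [Real.enorm_eq_ofReal_abs]
        exact ENNReal.ofReal_le_ofReal (hSA ξ)
    _ = ENNReal.ofReal A * C ^ n := by simp

lemma IsDensity.integrable_weight (hg : IsDensity g C) (hS : Measurable S)
    (hSA : ∀ ξ, |S ξ| ≤ A) (t : ℝ) :
    Integrable (fun p : (Fin n → Space d) × (Fin n → I) => S p.2 * ∏ m, g (t, p.1 m, p.2 m))
      (volume.prod M) := by
  have hm : Measurable fun p : (Fin n → Space d) × (Fin n → I) =>
      ∏ m, g (t, p.1 m, p.2 m) := hg.measurable_prod.comp measurable_prodMk_left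
  exact ⟨by fun_prop, (hg.lintegral_weight_le hS hSA t).trans_lt (by finiteness)⟩

lemma IsDensity.integrable_time_weight (hg : IsDensity g C) (hS : Measurable S)
    (hSA : ∀ ξ, |S ξ| ≤ A) (lam : Measure ℝ) [IsFiniteMeasure lam] :
    Integrable (fun p : ℝ × (Fin n → Space d) × (Fin n → I) =>
      S p.2.2 * ∏ m, g (p.1, p.2.1 m, p.2.2 m)) (lam.prod (volume.prod M)) := by
  have hm := hg.measurable_prod (n := n)
  have hm' : Measurable fun p : ℝ × (Fin n → Space d) × (Fin n → I) =>
      S p.2.2 * ∏ m, g (p.1, p.2.1 m, p.2.2 m) := by fun_prop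
  refine ⟨hm'.aestronglyMeasurable, ?_⟩
  rw [hasFiniteIntegral_iff_enorm, lintegral_prod _ hm'.enorm.aemeasurable]
  refine (lintegral_mono fun t => hg.lintegral_weight_le hS hSA t).trans_lt ?_
  rw [lintegral_const]
  finiteness

variable {κ : Kernel I I} [IsMarkovKernel κ] {s : I × I → ℝ} {D T : ℝ} {w : I → SignedMeasure I}
  {f : ℝ → Space d → I → ℝ}

/-- The density of the observable of `G`, for a disintegrated graphon. -/
def observable (κ : Kernel I I) (s : I × I → ℝ) (g : ℝ × Space d × I → ℝ) (G : LabeledTree n)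
    (t : ℝ) (x : Fin n → Space d) : ℝ :=
  ∫ ξ, treeWeight s G ξ * ∏ m, g (t, x m, ξ m) ∂(treeMeasure κ G)

/-- Each map `(t, x, ξ) ↦ (t, x_m, ξ_m)` pulls null sets back to null sets, so the representative
can be substituted in all factors of the product at once. -/
lemma ae_tau_eq (hw : IsGraphonKernel w κ s D) (hg : IsDensity g C)
    (hfg : ∀ᵐ p ∂((volume.restrict (Ioo 0 T)).prod (volume.prod volume)),
      f p.1 p.2.1 p.2.2 = g p) (G : LabeledTree n) :
    ∀ᵐ p ∂((volume.restrict (Ioo 0 T)).prod (volume : Measure (Fin n → Space d))),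
      tau G w (f p.1) p.2 = observable κ s g G p.1 p.2 := by
  set lam := (volume : Measure ℝ).restrict (Ioo 0 T)
  have h1 : ∀ᵐ p ∂(lam.prod ((volume : Measure (Fin n → Space d)).prod (treeMeasure κ G))),
      ∏ m, f p.1 (p.2.1 m) (p.2.2 m) = ∏ m, g (p.1, p.2.1 m, p.2.2 m) := by
    have h (m : Fin n) : Measure.QuasiMeasurePreserving
        (Prod.map id (Prod.map (fun x : Fin n → Space d => x m) fun ξ : Fin n → I => ξ m))
        (lam.prod ((volume : Measure (Fin n → Space d)).prod (treeMeasure κ G)))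
        (lam.prod (volume.prod volume)) :=
      QuasiMeasurePreserving.prodMap (.id _) (QuasiMeasurePreserving.prodMap
        (Measure.quasiMeasurePreserving_eval _ m)
        (quasiMeasurePreserving_eval_treeMeasure hw.comp_absolutelyContinuous G m))
    filter_upwards [ae_all_iff.2 fun m => (h m).ae hfg] with p hp
    exact Finset.prod_congr rfl fun m _ => hp m
  have hae := measurePreserving_prodAssoc lam (volume : Measure (Fin n → Space d))
    (treeMeasure κ G)
  have hint := hae.integrable_comp_of_integrable (hg.integrable_time_weight
    (M := treeMeasure κ G) (S := fun _ => 1) (A := 1) measurable_const (fun ξ => by simp) lam)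
  filter_upwards [Measure.ae_ae_of_ae_prod (hae.quasiMeasurePreserving.ae h1),
    hint.prod_right_ae] with p hp1 hp2
  simp only [MeasurableEquiv.prodAssoc, MeasurableEquiv.coe_mk, Equiv.prodAssoc_apply,
    Function.comp_apply, one_mul] at hp1 hp2
  rw [tau, treeIntegral_eq_integral G hw (hp2.congr (hp1.mono fun _ h => h.symm)), observable]
  refine integral_congr_ae (hp1.mono fun ξ hξ => ?_)
  simp only [hξ]

lemma memLinftyL1_tau (hw : IsGraphonKernel w κ s D) (hg : IsDensity g C)
    (hfg : ∀ᵐ p ∂((volume.restrict (Ioo 0 T)).prod (volume.prod volume)),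
      f p.1 p.2.1 p.2.2 = g p) (G : LabeledTree n) :
    MemLinftyL1 T fun t => tau G w (f t) := by
  obtain ⟨A, hA, hSA⟩ := abs_treeWeight_le hw.abs_le G
  have hS := measurable_treeWeight hw.measurable G
  have hae := ae_tau_eq hw hg hfg G
  refine ⟨?_, A.toNNReal * C ^ n, ?_⟩
  · refine AEStronglyMeasurable.congr ?_ (hae.mono fun _ h => h.symm)
    have hm := hg.measurable_prod (n := n)
    have : Measurable fun q : (ℝ × (Fin n → Space d)) × (Fin n → I) =>
        treeWeight s G q.2 * ∏ m, g (q.1.1, q.1.2 m, q.2 m) :=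
      (hS.comp measurable_snd).mul (hm.comp (f := fun q : (ℝ × (Fin n → Space d)) × (Fin n → I) =>
        (q.1.1, q.1.2, q.2)) (by fun_prop))
    exact (this.stronglyMeasurable.integral_prod_right').aestronglyMeasurable
  · filter_upwards [Measure.ae_ae_of_ae_prod hae] with t ht
    rw [lintegral_congr_ae (ht.mono fun x hx => congrArg _ hx)]
    have hm : Measurable fun p : (Fin n → Space d) × (Fin n → I) =>
        ∏ m, g (t, p.1 m, p.2 m) := hg.measurable_prod.comp measurable_prodMk_left
    calc ∫⁻ x, ‖observable κ s g G t x‖ₑ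
        ≤ ∫⁻ x : Fin n → Space d, ∫⁻ ξ, ‖treeWeight s G ξ * ∏ m, g (t, x m, ξ m)‖ₑ
            ∂(treeMeasure κ G) := lintegral_mono fun x => enorm_integral_le_lintegral_enorm _
      _ ≤ ENNReal.ofReal A * C ^ n := by
        have := hg.lintegral_weight_le (M := treeMeasure κ G) hS hSA t
        rwa [lintegral_prod _ (by fun_prop)] at this
      _ = _ := by push_cast; rfl

lemma ae_integrable_prod (hg : IsDensity g C) (t : ℝ) :
    ∀ᵐ x : Fin n → Space d, Integrable (fun ξ : Fin n → I => ∏ m, g (t, x m, ξ m)) M := by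
  have := (hg.integrable_weight (M := M) (S := fun _ => 1) (A := 1) measurable_const
    (fun ξ => by simp) t).prod_right_ae
  simpa using this

lemma measurePreserving_finSnoc (E : Type*) [MeasureSpace E] [SigmaFinite (volume : Measure E)] :
    MeasurePreserving (fun p : (Fin n → E) × E => (Fin.snoc (α := fun _ => E) p.1 p.2))
      (volume.prod volume) volume := by
  have h := ((volume_preserving_piFinSuccAbove (fun _ : Fin (n + 1) => E) (Fin.last n)).symm _).comp
    (Measure.measurePreserving_swap (μ := (volume : Measure (Fin n → E))) (ν := (volume : Measure E)))
  have e : (fun p : (Fin n → E) × E => (Fin.snoc (α := fun _ => E) p.1 p.2 : Fin (n + 1) → E)) =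
      (MeasurableEquiv.piFinSuccAbove (fun _ : Fin (n + 1) => E) (Fin.last n)).symm ∘ Prod.swap := by
    funext p
    simp [MeasurableEquiv.piFinSuccAbove, Fin.insertNthEquiv]
  rw [e]
  exact h

/-- The hierarchy closes here. The extra vertex contributes only the factor `s(ξ_i, ζ) g(t, z, ζ)`;
integrating first in `z` against `K(x_i - z)` and then in `ζ` against `κ(ξ_i, ·)` produces the
velocity at `(x_i, ξ_i)`. -/
lemma integral_observable_addLeaf_smul {K : Space d → Space d} {B : ℝ} (hK : Measurable K)
    (hKB : ∀ x, ‖K x‖ ≤ B) (hw : IsGraphonKernel w κ s D) (hg : IsDensity g C)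
    (G : LabeledTree n) (i : Fin n) (t : ℝ) :
    ∀ᵐ x : Fin n → Space d,
      ∫ z, observable κ s g (G.addLeaf i) t (Fin.snoc (α := fun _ => Space d) x z) • K (x i - z) =
        ∫ ξ, (treeWeight s G ξ * ∏ m, g (t, x m, ξ m)) • field K κ s g (t, x i, ξ i)
          ∂(treeMeasure κ G) := by
  set N := treeMeasure κ G ⊗ₘ κ.comap (fun ξ => ξ i) (measurable_pi_apply i)
  have hgm := hg.measurable
  obtain ⟨A, hA, hSA⟩ := abs_treeWeight_le hw.abs_le G
  obtain ⟨A', hA', hSA'⟩ := abs_treeWeight_le hw.abs_le (G.addLeaf i)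
  have hS := measurable_treeWeight hw.measurable G
  have hS' := measurable_treeWeight hw.measurable (G.addLeaf i)
  have hadd := (measurePreserving_finSnoc (n := n) (Space d)).quasiMeasurePreserving.ae
    (ae_integrable_prod (M := treeMeasure κ (G.addLeaf i)) hg t)
  filter_upwards [ae_integrable_prod (M := treeMeasure κ G) hg t, Measure.ae_ae_of_ae_prod hadd]
    with x hx1 hx2
  set Φ : (Fin n → I) × I → ℝ := fun p =>
    treeWeight s G p.1 * s (p.1 i, p.2) * ∏ m, g (t, x m, p.1 m)
  have hsm : Measurable fun p : (Fin n → I) × I => treeWeight s G p.1 * s (p.1 i, p.2) := by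
    have := hw.measurable
    fun_prop
  have hΦ : Integrable Φ N := by
    have hfst : MeasurePreserving Prod.fst N (treeMeasure κ G) :=
      ⟨measurable_fst, Measure.fst_compProd _ _⟩
    refine (hfst.integrable_comp_of_integrable hx1).bdd_mul (c := A * D) hsm.aestronglyMeasurable
      (Eventually.of_forall fun p => ?_)
    rw [Real.norm_eq_abs, abs_mul]
    exact mul_le_mul (hSA _) (hw.abs_le _) (abs_nonneg _) hA
  have h1 : ∀ᵐ z, observable κ s g (G.addLeaf i) t (Fin.snoc (α := fun _ => Space d) x z) =
      ∫ p, Φ p * g (t, z, p.2) ∂N := by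
    filter_upwards [hx2] with z hz
    have hi : Integrable (fun ξ => treeWeight s (G.addLeaf i) ξ *
        ∏ m, g (t, (Fin.snoc (α := fun _ => Space d) x z : Fin (n + 1) → Space d) m, ξ m))
        (treeMeasure κ (G.addLeaf i)) :=
      hz.bdd_mul hS'.aestronglyMeasurable (Eventually.of_forall hSA')
    rw [observable, treeMeasure, integral_map measurable_finSnoc.aemeasurable hi.1]
    refine integral_congr_ae (Eventually.of_forall fun p => ?_)
    simp only [treeWeight_snoc, Fin.prod_univ_castSucc, Fin.snoc_castSucc, Fin.snoc_last, Φ]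
    ring
  have hmeas : AEStronglyMeasurable (fun q : Space d × ((Fin n → I) × I) =>
      (Φ q.2 * g (t, q.1, q.2.2)) • K (x i - q.1)) (volume.prod N) := by
    have e1 : AEStronglyMeasurable (fun q : Space d × ((Fin n → I) × I) => Φ q.2)
      (volume.prod N) := hΦ.1.comp_snd
    have e2 : Measurable fun q : Space d × ((Fin n → I) × I) => g (t, q.1, q.2.2) := by fun_prop
    have e3 : Measurable fun q : Space d × ((Fin n → I) × I) => K (x i - q.1) := by fun_prop
    exact (e1.mul e2.aestronglyMeasurable).smul e3.aestronglyMeasurable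
  have hB : 0 ≤ B := (norm_nonneg _).trans (hKB 0)
  have hgK (ζ : I) : Integrable fun z => g (t, z, ζ) • K (x i - z) := by
    refine (hg.integrable t ζ).smul_bdd B ?_ (Eventually.of_forall fun z => hKB _)
    exact (hK.comp (by fun_prop)).aestronglyMeasurable
  -- The `z`-integral of the norm is at most `‖Φ p‖ * (C * B)`, because `K` is bounded and the
  -- slices of `g` are bounded in `L^1`.
  have hint : Integrable (fun q : Space d × ((Fin n → I) × I) =>
      (Φ q.2 * g (t, q.1, q.2.2)) • K (x i - q.1)) (volume.prod N) := by
    refine (integrable_prod_iff' hmeas).2 ⟨Eventually.of_forall fun p => ?_, ?_⟩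
    · simp_rw [mul_smul]
      exact (hgK p.2).smul (Φ p)
    · refine (hΦ.norm.mul_const (C * B)).mono' hmeas.norm.prod_swap.integral_prod_right'
        (Eventually.of_forall fun p => ?_)
      rw [Real.norm_of_nonneg (integral_nonneg fun z => norm_nonneg _)]
      calc ∫ z, ‖(Φ p * g (t, z, p.2)) • K (x i - z)‖
          ≤ ∫ z, ‖Φ p‖ * (‖g (t, z, p.2)‖ * B) := by
            refine integral_mono_of_nonneg (Eventually.of_forall fun z => norm_nonneg _)
              (((hg.integrable t p.2).norm.mul_const B).const_mul _)
              (Eventually.of_forall fun z => ?_)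
            simp only [norm_smul, norm_mul, mul_assoc]
            gcongr
            exact hKB _
        _ = ‖Φ p‖ * ((∫ z, ‖g (t, z, p.2)‖) * B) := by
            rw [integral_const_mul, integral_mul_const]
        _ ≤ ‖Φ p‖ * (C * B) := by
            gcongr
            exact hg.integral_norm_le t p.2
  calc ∫ z, observable κ s g (G.addLeaf i) t (Fin.snoc (α := fun _ => Space d) x z) • K (x i - z)
      = ∫ z, ∫ p, (Φ p * g (t, z, p.2)) • K (x i - z) ∂N := by
        refine integral_congr_ae (h1.mono fun z hz => ?_)
        simp only [hz, integral_smul_const]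
    _ = ∫ p, (∫ z, (Φ p * g (t, z, p.2)) • K (x i - z)) ∂N :=
        integral_integral_swap (f := fun z p => (Φ p * g (t, z, p.2)) • K (x i - z)) hint
    _ = ∫ p, Φ p • spaceConv K g (t, x i, p.2) ∂N := by
        simp_rw [mul_smul, integral_smul]
        rfl
    _ = _ := by
        have hc := measurable_spaceConv hK hg
        rw [Measure.integral_compProd]
        · refine integral_congr_ae (Eventually.of_forall fun ξ => ?_)
          simp only [Φ, field, Kernel.comap_apply]
          rw [← integral_smul]
          refine integral_congr_ae (Eventually.of_forall fun ζ => ?_)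
          simp only [smul_smul]
          ring_nf
        · exact hΦ.smul_bdd (C * B)
            (hc.comp (f := fun p : (Fin n → I) × I => (t, x i, p.2)) (by fun_prop)).aestronglyMeasurable
            (Eventually.of_forall fun p => norm_spaceConv_le hKB hg _)

lemma ae_integral_tau_addLeaf_smul {K K' : Space d → Space d} {B : ℝ} (hKK : K =ᵐ[volume] K')
    (hK : Measurable K') (hKB : ∀ x, ‖K' x‖ ≤ B) (hw : IsGraphonKernel w κ s D)
    (hg : IsDensity g C)
    (hfg : ∀ᵐ p ∂((volume.restrict (Ioo 0 T)).prod (volume.prod volume)),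
      f p.1 p.2.1 p.2.2 = g p) (G : LabeledTree n) (i : Fin n) :
    ∀ᵐ t ∂(volume.restrict (Ioo 0 T)), ∀ᵐ x : Fin n → Space d,
      ∫ z, tau (G.addLeaf i) w (f t) (Fin.snoc (α := fun _ => Space d) x z) • K (x i - z) =
        ∫ ξ, (treeWeight s G ξ * ∏ m, g (t, x m, ξ m)) • field K' κ s g (t, x i, ξ i)
          ∂(treeMeasure κ G) := by
  filter_upwards [Measure.ae_ae_of_ae_prod (ae_tau_eq hw hg hfg (G.addLeaf i))] with t ht
  have h := Measure.ae_ae_of_ae_prod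
    ((measurePreserving_finSnoc (n := n) (Space d)).quasiMeasurePreserving.ae ht)
  filter_upwards [h, integral_observable_addLeaf_smul hK hKB hw hg G i t] with x hx1 hx2
  rw [← hx2]
  exact integral_smul_congr_ae hKK hx1 (x i)

end Observables

/-! ### Directional derivatives on products -/

section Calculus

lemma prod_update {X ι : Type*} [Fintype ι] [DecidableEq ι] (b : ι → X → ℝ) (x : ι → X) (i : ι) (z : X) :
    ∏ j, b j (Function.update x i z j) = (∏ j ∈ Finset.univ.erase i, b j (x j)) * b i z := by
  rw [← Finset.prod_erase_mul _ _ (Finset.mem_univ i), Function.update_self]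
  congr 1
  refine Finset.prod_congr rfl fun j hj => ?_
  rw [Function.update_of_ne (Finset.ne_of_mem_erase hj)]

variable {E : Type*} [NormedAddCommGroup E] [NormedSpace ℝ E]

/-- The derivative of `ψ` in the direction `v`. -/
def dirDeriv (v : E) (ψ : E → ℝ) (x : E) : ℝ := fderiv ℝ ψ x v

/-- The sum of the second derivatives of `ψ` in the directions `e i`. -/
def sumSecondDeriv {ι : Type*} [Fintype ι] (e : ι → E) (ψ : E → ℝ) (x : E) : ℝ :=
  ∑ i, dirDeriv (e i) (dirDeriv (e i) ψ) x

lemma ContDiff.dirDeriv {ψ : E → ℝ} (h : ContDiff ℝ ∞ ψ) (v : E) :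
    ContDiff ℝ ∞ (dirDeriv v ψ) :=
  (h.fderiv_right (m := ∞) (by simp)).clm_apply contDiff_const

lemma HasCompactSupport.dirDeriv {ψ : E → ℝ} (h : HasCompactSupport ψ) (v : E) :
    HasCompactSupport (dirDeriv v ψ) :=
  h.fderiv_apply ℝ v

lemma ContDiff.continuous_sumSecondDeriv {ι : Type*} [Fintype ι] {ψ : E → ℝ} (h : ContDiff ℝ ∞ ψ)
    (e : ι → E) : Continuous (sumSecondDeriv e ψ) :=
  continuous_finsetSum _ fun i _ => ((h.dirDeriv (e i)).dirDeriv (e i)).continuous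

lemma HasCompactSupport.sumSecondDeriv {ι : Type*} [Fintype ι] {ψ : E → ℝ}
    (h : HasCompactSupport ψ) (e : ι → E) : HasCompactSupport (sumSecondDeriv e ψ) := by
  refine h.mono' fun x hx => ?_
  by_contra hx'
  refine hx (Finset.sum_eq_zero fun i _ => image_eq_zero_of_notMem_tsupport fun h2 => hx' ?_)
  exact tsupport_fderiv_apply_subset ℝ (e i) (tsupport_fderiv_apply_subset ℝ (e i) h2)

/-- The product `ι → Space d` carries the sup norm and is not an inner product space. Sums of second
directional derivatives make sense both there and on each factor. -/
lemma laplacian_eq_sumSecondDeriv {d : ℕ} {ψ : Space d → ℝ} (h : ContDiff ℝ ∞ ψ) (x : Space d) :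
    Δ ψ x = sumSecondDeriv (EuclideanSpace.basisFun (Fin d) ℝ) ψ x := by
  rw [InnerProductSpace.laplacian_eq_iteratedFDeriv_orthonormalBasis ψ
    (EuclideanSpace.basisFun (Fin d) ℝ)]
  refine Finset.sum_congr rfl fun j _ => ?_
  rw [iteratedFDeriv_two_apply]
  have hd : DifferentiableAt ℝ (fderiv ℝ ψ) x :=
    (h.fderiv_right (m := ∞) (by simp)).differentiable (by simp) x
  have : dirDeriv (EuclideanSpace.basisFun (Fin d) ℝ j) ψ = fun y =>
    fderiv ℝ ψ y (EuclideanSpace.basisFun (Fin d) ℝ j) := rfl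
  rw [dirDeriv, this, fderiv_clm_apply hd (by fun_prop)]
  simp

lemma ContDiff.continuous_laplacian {d : ℕ} {ψ : Space d → ℝ} (h : ContDiff ℝ ∞ ψ) :
    Continuous (Δ ψ) := by
  rw [funext (laplacian_eq_sumSecondDeriv h)]
  exact h.continuous_sumSecondDeriv _

lemma laplacian_const_mul {d : ℕ} {ψ : Space d → ℝ} (h : ContDiff ℝ ∞ ψ) (c : ℝ) (x : Space d) :
    Δ (fun y => c * ψ y) x = c * Δ ψ x :=
  InnerProductSpace.laplacian_smul c (contDiff_infty.1 h 2).contDiffAt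

lemma ContDiff.fintype_prod_apply {ι : Type*} [Fintype ι] {b : ι → E → ℝ} (hb : ∀ i, ContDiff ℝ ∞ (b i)) :
    ContDiff ℝ ∞ fun x : ι → E => ∏ i, b i (x i) :=
  contDiff_prod fun i _ => (hb i).comp (contDiff_apply ℝ E i)

variable {ι : Type*} [Fintype ι] [DecidableEq ι]

lemma fderiv_comp_update {ψ : (ι → E) → ℝ} (h : ContDiff ℝ ∞ ψ) (x : ι → E) (i : ι) (z v : E) :
    fderiv ℝ (fun y => ψ (Function.update x i y)) z v =
      dirDeriv (Pi.single i v) ψ (Function.update x i z) := by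
  have h1 := ((h.differentiable (by simp) (Function.update x i z)).hasFDerivAt).comp z
    (hasFDerivAt_update (𝕜 := ℝ) x z)
  have h2 : fderiv ℝ (fun y => ψ (Function.update x i y)) z = _ := h1.fderiv
  rw [h2, dirDeriv, ContinuousLinearMap.comp_apply]
  congr 1
  funext j
  rcases eq_or_ne j i with rfl | hij
  · simp
  · simp [Pi.single_eq_of_ne hij]

lemma laplacian_comp_update {d : ℕ} {ψ : (ι → Space d) → ℝ} (h : ContDiff ℝ ∞ ψ)
    (x : ι → Space d) (i : ι) :
    Δ (fun y => ψ (Function.update x i y)) (x i) =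
      sumSecondDeriv (fun j => Pi.single i (EuclideanSpace.basisFun (Fin d) ℝ j)) ψ x := by
  have hu : ContDiff ℝ ∞ fun y => ψ (Function.update x i y) := h.comp (contDiff_update _ x i)
  rw [laplacian_eq_sumSecondDeriv hu]
  refine Finset.sum_congr rfl fun j _ => ?_
  have e : dirDeriv (EuclideanSpace.basisFun (Fin d) ℝ j) (fun y => ψ (Function.update x i y)) =
      fun y => dirDeriv (Pi.single i (EuclideanSpace.basisFun (Fin d) ℝ j)) ψ
        (Function.update x i y) := funext fun y => fderiv_comp_update h x i y _
  rw [e]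
  refine (fderiv_comp_update (h.dirDeriv _) x i (x i) _).trans ?_
  rw [Function.update_eq_self]

/-- The coordinate directions of `(ℝ^d)^ι`. -/
def coordDir (ι : Type*) [DecidableEq ι] (d : ℕ) (p : ι × Fin d) : ι → Space d :=
  Pi.single p.1 (EuclideanSpace.basisFun (Fin d) ℝ p.2)

lemma sum_laplacian_comp_update {d : ℕ} {ψ : (ι → Space d) → ℝ} (h : ContDiff ℝ ∞ ψ)
    (x : ι → Space d) :
    ∑ i, Δ (fun y => ψ (Function.update x i y)) (x i) = sumSecondDeriv (coordDir ι d) ψ x := by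
  simp only [laplacian_comp_update h, sumSecondDeriv, Fintype.sum_prod_type]
  rfl

lemma sum_fderiv_comp_update {ψ : (ι → E) → ℝ} (h : ContDiff ℝ ∞ ψ) (x v : ι → E) :
    ∑ i, fderiv ℝ (fun y => ψ (Function.update x i y)) (x i) (v i) = dirDeriv v ψ x := by
  simp only [fderiv_comp_update h, Function.update_eq_self]
  simp only [dirDeriv, ← map_sum]
  congr 1
  exact Finset.univ_sum_single v

lemma sum_prod_erase_mul_fderiv {b : ι → E → ℝ} (hb : ∀ i, ContDiff ℝ ∞ (b i)) (x v : ι → E) :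
    ∑ i, (∏ j ∈ Finset.univ.erase i, b j (x j)) * fderiv ℝ (b i) (x i) (v i) =
      dirDeriv v (fun y => ∏ i, b i (y i)) x := by
  rw [← sum_fderiv_comp_update (ContDiff.fintype_prod_apply hb)]
  refine Finset.sum_congr rfl fun i _ => ?_
  simp only [prod_update]
  rw [fderiv_const_mul ((hb i).differentiable (by simp) _)]
  rfl

lemma sum_prod_erase_mul_laplacian {d : ℕ} {b : ι → Space d → ℝ} (hb : ∀ i, ContDiff ℝ ∞ (b i))
    (x : ι → Space d) :
    ∑ i, (∏ j ∈ Finset.univ.erase i, b j (x j)) * Δ (b i) (x i) =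
      sumSecondDeriv (coordDir ι d) (fun y => ∏ i, b i (y i)) x := by
  rw [← sum_laplacian_comp_update (ContDiff.fintype_prod_apply hb)]
  refine Finset.sum_congr rfl fun i _ => ?_
  simp only [prod_update]
  rw [laplacian_const_mul (hb i)]

end Calculus

/-! ### Pairing the solution with a test function of space -/

section Pairing

variable {d : ℕ} {g : ℝ × Space d × I → ℝ} {C : ℝ≥0} {β : ℝ × Space d × I → ℝ} {B : ℝ}

/-- The pairing `∫ g(t, x, ξ) β(t, x, ξ) dx`. -/
def pairing (g β : ℝ × Space d × I → ℝ) (p : ℝ × I) : ℝ :=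
  ∫ x, g (p.1, x, p.2) * β (p.1, x, p.2)

lemma measurable_pairing (hg : IsDensity g C) (hβ : Measurable β) : Measurable (pairing g β) := by
  have hgm := hg.measurable
  have : Measurable fun q : (ℝ × I) × Space d =>
    g (q.1.1, q.2, q.1.2) * β (q.1.1, q.2, q.1.2) := by fun_prop
  exact (this.stronglyMeasurable.integral_prod_right').measurable

lemma abs_pairing_le (hg : IsDensity g C) (hβ : ∀ p, |β p| ≤ B) (p : ℝ × I) :
    |pairing g β p| ≤ C * B :=
  hg.norm_integral_smul_le (β := fun x => β (p.1, x, p.2)) (fun _ => hβ _) p.1 p.2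

lemma IsDensity.integrable_mul (hg : IsDensity g C) (hβm : Measurable β) (hβ : ∀ p, |β p| ≤ B)
    (t : ℝ) (ξ : I) : Integrable fun x => g (t, x, ξ) * β (t, x, ξ) :=
  (hg.integrable t ξ).mul_bdd (c := B) (hβm.comp (by fun_prop)).aestronglyMeasurable
    (Eventually.of_forall fun x => hβ _)

lemma integral_prod_mul_prod {n : ℕ} (β : Fin n → ℝ × Space d × I → ℝ)
    (t : ℝ) (ξ : Fin n → I) :
    ∫ x : Fin n → Space d, (∏ m, g (t, x m, ξ m)) * ∏ m, β m (t, x m, ξ m) =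
      ∏ m, pairing g (β m) (t, ξ m) := by
  simp_rw [← Finset.prod_mul_distrib]
  exact integral_fintype_prod_volume_eq_prod
    (fun m (x : Space d) => g (t, x, ξ m) * β m (t, x, ξ m))

/-- The space factor `∇b · V + ν Δb` of the weak formulation. -/
def spaceFactor (ν : ℝ) (V : ℝ × Space d × I → Space d) (b : Space d → ℝ) (p : ℝ × Space d × I) : ℝ :=
  fderiv ℝ b p.2.1 (V p) + ν * Δ b p.2.1

variable {b : Space d → ℝ} {V : ℝ × Space d × I → Space d} {ν : ℝ}

lemma measurable_fderiv_apply (hb : ContDiff ℝ ∞ b) (hV : Measurable V) :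
    Measurable fun p : ℝ × Space d × I => fderiv ℝ b p.2.1 (V p) := by
  have : Continuous fun q : Space d × Space d => fderiv ℝ b q.1 q.2 :=
    ((hb.continuous_fderiv (by simp)).comp continuous_fst).clm_apply continuous_snd
  exact this.measurable.comp (f := fun p : ℝ × Space d × I => (p.2.1, V p)) (by fun_prop)

lemma exists_abs_fderiv_apply_le (hb : ContDiff ℝ ∞ b) (hbc : HasCompactSupport b)
    (hVB : ∀ p, ‖V p‖ ≤ B) : ∃ A, ∀ p : ℝ × Space d × I, |fderiv ℝ b p.2.1 (V p)| ≤ A := by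
  obtain ⟨A, hA⟩ := (hbc.fderiv ℝ).exists_bound_of_continuous (hb.continuous_fderiv (by simp))
  exact ⟨A * B, fun p => ((fderiv ℝ b p.2.1).le_opNorm (V p)).trans (mul_le_mul (hA _) (hVB p)
    (norm_nonneg _) ((norm_nonneg _).trans (hA 0)))⟩

lemma HasCompactSupport.laplacian (hb : ContDiff ℝ ∞ b) (hbc : HasCompactSupport b) :
    HasCompactSupport (Δ b) := by
  rw [funext (laplacian_eq_sumSecondDeriv hb)]
  exact hbc.sumSecondDeriv _

lemma exists_abs_laplacian_le (hb : ContDiff ℝ ∞ b) (hbc : HasCompactSupport b) :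
    ∃ A, ∀ p : ℝ × Space d × I, |Δ b p.2.1| ≤ A := by
  obtain ⟨A, hA⟩ := (hbc.laplacian hb).exists_bound_of_continuous hb.continuous_laplacian
  exact ⟨A, fun p => hA _⟩

lemma measurable_laplacian_apply (hb : ContDiff ℝ ∞ b) :
    Measurable fun p : ℝ × Space d × I => Δ b p.2.1 :=
  hb.continuous_laplacian.measurable.comp (by fun_prop)

lemma measurable_spaceFactor (hb : ContDiff ℝ ∞ b) (hV : Measurable V) :
    Measurable (spaceFactor ν V b) :=
  (measurable_fderiv_apply hb hV).add ((measurable_laplacian_apply hb).const_mul ν)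

lemma exists_abs_spaceFactor_le (hb : ContDiff ℝ ∞ b) (hbc : HasCompactSupport b)
    (hVB : ∀ p, ‖V p‖ ≤ B) : ∃ A, ∀ p, |spaceFactor ν V b p| ≤ A := by
  obtain ⟨A₁, h₁⟩ := exists_abs_fderiv_apply_le hb hbc hVB
  obtain ⟨A₂, h₂⟩ := exists_abs_laplacian_le hb hbc
  refine ⟨A₁ + |ν| * A₂, fun p => (abs_add_le _ _).trans (add_le_add (h₁ p) ?_)⟩
  rw [abs_mul]
  exact mul_le_mul_of_nonneg_left (h₂ p) (abs_nonneg _)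

lemma pairing_spaceFactor (hg : IsDensity g C) (hb : ContDiff ℝ ∞ b) (hbc : HasCompactSupport b)
    (hV : Measurable V) (hVB : ∀ p, ‖V p‖ ≤ B) (p : ℝ × I) :
    pairing g (spaceFactor ν V b) p =
      pairing g (fun p => fderiv ℝ b p.2.1 (V p)) p + ν * pairing g (fun p => Δ b p.2.1) p := by
  obtain ⟨A₁, h₁⟩ := exists_abs_fderiv_apply_le hb hbc hVB
  obtain ⟨A₂, h₂⟩ := exists_abs_laplacian_le hb hbc
  simp only [pairing, spaceFactor]
  rw [← integral_const_mul, ← integral_add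
    (hg.integrable_mul (measurable_fderiv_apply hb hV) h₁ p.1 p.2)
    ((hg.integrable_mul (measurable_laplacian_apply hb) h₂ p.1 p.2).const_mul ν)]
  refine integral_congr_ae (Eventually.of_forall fun x => ?_)
  simp only
  ring

/-- The weak formulation is tested with `θ(t) b(x) c(ξ)`; the factor `c` is what later localizes the
identity in the label. -/
lemma IsWeakSolution.integral_pairing {K : Space d → Space d} {T : ℝ} {w : I → SignedMeasure I}
    {f : ℝ → Space d → I → ℝ} (hsol : IsWeakSolution K ν T w f) (hg : IsDensity g C)
    (hV : Measurable V) (hVB : ∀ p, ‖V p‖ ≤ B)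
    (hfg : ∀ᵐ t ∂(volume.restrict (Ioo 0 T)), ∀ᵐ ξ : I, (∀ᵐ x, f t x ξ = g (t, x, ξ)) ∧
      ∀ x, velocity K w f t x ξ = V (t, x, ξ))
    (hb : ContDiff ℝ ∞ b) (hbc : HasCompactSupport b) {θ : ℝ → ℝ} (hθ : IsTestFunction 0 T θ)
    {c : ℝ → ℝ} (hc : ContDiff ℝ ∞ c) (hcc : HasCompactSupport c) :
    ∫ ξ : I, c ξ * ∫ t in Ioo 0 T, (deriv θ t * pairing g (fun p => b p.2.1) (t, ξ) +
      θ t * pairing g (spaceFactor ν V b) (t, ξ)) = 0 := by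
  set lam : Measure ℝ := volume.restrict (Ioo 0 T)
  set φ : ℝ × Space d × ℝ → ℝ := fun q => θ q.1 * (b q.2.1 * c q.2.2) with hφ
  have hsub : tsupport φ ⊆ tsupport θ ×ˢ (tsupport b ×ˢ tsupport c) := by
    refine closure_minimal (fun q hq => ?_) ((isClosed_tsupport θ).prod
      ((isClosed_tsupport b).prod (isClosed_tsupport c)))
    have h1 := left_ne_zero_of_mul (Function.mem_support.1 hq)
    have h2 := right_ne_zero_of_mul (Function.mem_support.1 hq)
    exact ⟨subset_tsupport _ h1, subset_tsupport _ (left_ne_zero_of_mul h2),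
      subset_tsupport _ (right_ne_zero_of_mul h2)⟩
  have hφc : HasCompactSupport φ :=
    (hθ.hasCompactSupport.isCompact.prod (hbc.isCompact.prod hcc.isCompact)).of_isClosed_subset
      (isClosed_tsupport φ) hsub
  have hφd : ContDiff ℝ ∞ φ := by
    have h1 := hθ.contDiff
    fun_prop
  have key := hsol φ (contDiff_infty.1 hφd 2) hφc fun q hq =>
    ⟨hθ.tsupport_subset (hsub hq).1, mem_univ _⟩
  have hθd : ContDiff ℝ ∞ (deriv θ) := (contDiff_infty_iff_deriv.1 hθ.contDiff).2
  obtain ⟨A₀, hA₀⟩ := hθ.hasCompactSupport.exists_bound_of_continuous hθ.contDiff.continuous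
  obtain ⟨A₁, hA₁⟩ := hθ.hasCompactSupport.deriv.exists_bound_of_continuous hθd.continuous
  obtain ⟨A₂, hA₂⟩ := hcc.exists_bound_of_continuous hc.continuous
  obtain ⟨A₃, hA₃⟩ := hbc.exists_bound_of_continuous hb.continuous
  obtain ⟨A₄, hA₄⟩ := exists_abs_fderiv_apply_le hb hbc hVB
  obtain ⟨A₅, hA₅⟩ := exists_abs_laplacian_le hb hbc
  have hint {η : ℝ → ℝ} (hη : Continuous η) {A A' : ℝ} (hηA : ∀ t, ‖η t‖ ≤ A)
      {β : ℝ × Space d × I → ℝ} (hβ : Measurable β) (hβA : ∀ p, |β p| ≤ A') :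
      Integrable (fun p : ℝ × I => η p.1 * (c p.2 * pairing g β p)) (lam.prod volume) := by
    have hm := measurable_pairing hg hβ
    have hcm := hc.continuous.measurable
    have hηm := hη.measurable
    refine Integrable.of_bound (by fun_prop) (A * (A₂ * (C * A')))
      (Eventually.of_forall fun p => ?_)
    rw [norm_mul, norm_mul]
    exact mul_le_mul (hηA _) (mul_le_mul (hA₂ _) (abs_pairing_le hg hβA p) (abs_nonneg _)
      ((norm_nonneg _).trans (hA₂ 0))) (by positivity) ((norm_nonneg _).trans (hηA 0))
  have hbm : Measurable fun p : ℝ × Space d × I => b p.2.1 := by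
    have := hb.continuous.measurable
    fun_prop
  have i₁ := hint hθd.continuous hA₁ hbm fun p => hA₃ p.2.1
  have i₂ := hint hθ.contDiff.continuous hA₀ (measurable_fderiv_apply hb hV) hA₄
  have i₃ := hint hθ.contDiff.continuous hA₀ (measurable_laplacian_apply hb) hA₅
  have e₁ : ∫ t in Ioo 0 T, ∫ ξ : I, ∫ x, deriv (fun s => φ (s, x, ξ)) t * f t x ξ =
      ∫ p : ℝ × I, deriv θ p.1 * (c p.2 * pairing g (fun p => b p.2.1) p) ∂(lam.prod volume) := by
    rw [integral_prod _ i₁]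
    refine integral_congr_ae (hfg.mono fun t ht => integral_congr_ae (ht.mono fun ξ hξ => ?_))
    simp only [pairing]
    rw [← integral_const_mul, ← integral_const_mul]
    refine integral_congr_ae (hξ.1.mono fun x hx => ?_)
    simp only [hφ, deriv_mul_const_field, hx]
    ring
  have e₂ : ∫ t in Ioo 0 T, ∫ ξ : I, ∫ x,
      fderiv ℝ (fun y => φ (t, y, ξ)) x (velocity K w f t x ξ) * f t x ξ =
      ∫ p : ℝ × I, θ p.1 * (c p.2 * pairing g (fun p => fderiv ℝ b p.2.1 (V p)) p) ∂(lam.prod volume) := by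
    rw [integral_prod _ i₂]
    refine integral_congr_ae (hfg.mono fun t ht => integral_congr_ae (ht.mono fun ξ hξ => ?_))
    simp only [pairing]
    rw [← integral_const_mul, ← integral_const_mul]
    refine integral_congr_ae (hξ.1.mono fun x hx => ?_)
    have hbd := hb.differentiable (by simp) x
    simp only [hφ, hξ.2, hx]
    rw [fderiv_const_mul (hbd.mul_const _), fderiv_mul_const hbd]
    simp only [smul_apply, smul_eq_mul]
    ring
  have e₃ : ∫ t in Ioo 0 T, ∫ ξ : I, ∫ x, Δ (fun y => φ (t, y, ξ)) x * f t x ξ =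
      ∫ p : ℝ × I, θ p.1 * (c p.2 * pairing g (fun p => Δ b p.2.1) p) ∂(lam.prod volume) := by
    rw [integral_prod _ i₃]
    refine integral_congr_ae (hfg.mono fun t ht => integral_congr_ae (ht.mono fun ξ hξ => ?_))
    simp only [pairing]
    rw [← integral_const_mul, ← integral_const_mul]
    refine integral_congr_ae (hξ.1.mono fun x hx => ?_)
    have : (fun y => φ (t, y, ξ)) = fun y => (θ t * c ξ) * b y := by
      funext y
      simp only [hφ]
      ring
    simp only [this, laplacian_const_mul hb, hx]
    ring
  rw [e₁, e₂, e₃, ← integral_const_mul, ← integral_add' i₁ i₂,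
    ← integral_add' (i₁.add i₂) (i₃.const_mul ν),
    integral_prod_symm _ ((i₁.add i₂).add (i₃.const_mul ν))] at key
  rw [← key]
  refine integral_congr_ae (Eventually.of_forall fun ξ => ?_)
  simp only
  rw [← integral_const_mul]
  refine integral_congr_ae (Eventually.of_forall fun t => ?_)
  simp only [pairing_spaceFactor hg hb hbc hV hVB, Pi.add_apply]
  ring

end Pairing

/-! ### The weak operator on test functions `θ(t) G(x)` -/

section TestFactor

variable {E : Type*} [NormedAddCommGroup E] [NormedSpace ℝ E] {ι : Type*} [Fintype ι]

/-- The factor `θ' G + θ (h · ∇G + ν ∑ D²G)` of a weak formulation. -/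
def testFactor (ν : ℝ) (e : ι → E) (θ : ℝ → ℝ) (G : E → ℝ) (q : ℝ × E × E) : ℝ :=
  deriv θ q.1 * G q.2.1 + θ q.1 * (dirDeriv q.2.2 G q.2.1 + ν * sumSecondDeriv e G q.2.1)

lemma IsTestFunction.contDiff_deriv {a b : ℝ} {θ : ℝ → ℝ} (hθ : IsTestFunction a b θ) :
    ContDiff ℝ ∞ (deriv θ) :=
  (contDiff_infty_iff_deriv.1 hθ.contDiff).2

lemma continuous_testFactor {a b : ℝ} {θ : ℝ → ℝ} (hθ : IsTestFunction a b θ) {G : E → ℝ}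
    (hG : ContDiff ℝ ∞ G) (ν : ℝ) (e : ι → E) : Continuous (testFactor ν e θ G) := by
  have h1 := hθ.contDiff.continuous
  have h2 := hθ.contDiff_deriv.continuous
  have h3 := hG.continuous
  have h4 := hG.continuous_sumSecondDeriv e
  have h5 : Continuous fun q : ℝ × E × E => dirDeriv q.2.2 G q.2.1 :=
    ((hG.continuous_fderiv (by simp)).comp (by fun_prop)).clm_apply (by fun_prop)
  unfold testFactor
  fun_prop

lemma exists_abs_testFactor_le {a b : ℝ} {θ : ℝ → ℝ} (hθ : IsTestFunction a b θ) {G : E → ℝ}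
    (hG : ContDiff ℝ ∞ G) (hGc : HasCompactSupport G) (ν : ℝ) (e : ι → E) (B : ℝ) :
    ∃ A, ∀ q : ℝ × E × E, ‖q.2.2‖ ≤ B → |testFactor ν e θ G q| ≤ A := by
  obtain ⟨A₀, hA₀⟩ := hθ.hasCompactSupport.exists_bound_of_continuous hθ.contDiff.continuous
  obtain ⟨A₁, hA₁⟩ := hθ.hasCompactSupport.deriv.exists_bound_of_continuous
    hθ.contDiff_deriv.continuous
  obtain ⟨A₂, hA₂⟩ := hGc.exists_bound_of_continuous hG.continuous
  obtain ⟨A₃, hA₃⟩ := (hGc.fderiv ℝ).exists_bound_of_continuous (hG.continuous_fderiv (by simp))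
  obtain ⟨A₄, hA₄⟩ := (hGc.sumSecondDeriv e).exists_bound_of_continuous
    (hG.continuous_sumSecondDeriv e)
  simp only [Real.norm_eq_abs] at hA₀ hA₁ hA₂ hA₄
  have p₀ := (abs_nonneg _).trans (hA₀ 0)
  have p₁ := (abs_nonneg _).trans (hA₁ 0)
  have p₃ := (norm_nonneg _).trans (hA₃ 0)
  refine ⟨A₁ * A₂ + A₀ * (A₃ * B + |ν| * A₄), fun q hq => (abs_add_le _ _).trans ?_⟩
  rw [abs_mul, abs_mul]
  refine add_le_add (mul_le_mul (hA₁ _) (hA₂ _) (abs_nonneg _) p₁)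
    (mul_le_mul (hA₀ _) ((abs_add_le _ _).trans (add_le_add ?_ ?_)) (abs_nonneg _) p₀)
  · exact ((fderiv ℝ G q.2.1).le_opNorm q.2.2).trans
      (mul_le_mul (hA₃ _) hq (norm_nonneg _) p₃)
  · rw [abs_mul]
    exact mul_le_mul_of_nonneg_left (hA₄ _) (abs_nonneg _)

lemma HasCompactSupport.fintype_prod_apply {X : Type*} [TopologicalSpace X] [T2Space X]
    {b : ι → X → ℝ} (hb : ∀ i, HasCompactSupport (b i)) :
    HasCompactSupport fun x : ι → X => ∏ i, b i (x i) := by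
  refine HasCompactSupport.intro (isCompact_univ_pi fun i => (hb i).isCompact) fun x hx => ?_
  simp only [mem_univ_pi, not_forall] at hx
  obtain ⟨i, hi⟩ := hx
  exact Finset.prod_eq_zero (Finset.mem_univ i) (image_eq_zero_of_notMem_tsupport hi)

end TestFactor

instance sFinite_prod_volume {d n : ℕ} {X : Type*} [MeasurableSpace X] (M : Measure X) [SFinite M] :
    SFinite (M.prod (volume : Measure (Fin n → Space d))) :=
  Measure.prod.instSFinite

/-! ### The tensorized equation on product test functions -/

section Tensor

variable {d n : ℕ} {g : ℝ × Space d × I → ℝ} {C : ℝ≥0} {B ν T A : ℝ}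
  {V : ℝ × Space d × I → Space d} {M : Measure (Fin n → I)} [IsProbabilityMeasure M]
  {S : (Fin n → I) → ℝ} {b : Fin n → Space d → ℝ}

lemma testFactor_prod (hb : ∀ i, ContDiff ℝ ∞ (b i)) (θ : ℝ → ℝ) (t : ℝ) (x : Fin n → Space d)
    (ξ : Fin n → I) :
    testFactor ν (coordDir (Fin n) d) θ (fun y => ∏ m, b m (y m))
        (t, x, fun i => V (t, x i, ξ i)) =
      deriv θ t * ∏ m, b m (x m) + θ t * ∑ i, (∏ j ∈ Finset.univ.erase i, b j (x j)) *
        spaceFactor ν V (b i) (t, x i, ξ i) := by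
  simp only [testFactor, spaceFactor, ← sum_prod_erase_mul_fderiv hb,
    ← sum_prod_erase_mul_laplacian hb, mul_add, Finset.sum_add_distrib, Finset.mul_sum]
  congr 2
  refine Finset.sum_congr rfl fun i _ => ?_
  ring

lemma measurable_field_pi (hV : Measurable V) :
    Measurable fun p : ℝ × (Fin n → Space d) × (Fin n → I) =>
      (fun i => V (p.1, p.2.1 i, p.2.2 i) : Fin n → Space d) :=
  measurable_pi_iff.2 fun i => hV.comp (by fun_prop)

lemma norm_field_pi_le (hB : 0 ≤ B) (hVB : ∀ p, ‖V p‖ ≤ B)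
    (p : ℝ × (Fin n → Space d) × (Fin n → I)) :
    ‖(fun i => V (p.1, p.2.1 i, p.2.2 i) : Fin n → Space d)‖ ≤ B :=
  (pi_norm_le_iff_of_nonneg hB).2 fun _ => hVB _

lemma integral_prod_mul_testFactor (hg : IsDensity g C) (hV : Measurable V)
    (hVB : ∀ p, ‖V p‖ ≤ B) (hb : ∀ i, ContDiff ℝ ∞ (b i)) (hbc : ∀ i, HasCompactSupport (b i))
    (θ : ℝ → ℝ) (t : ℝ) (ξ : Fin n → I) :
    ∫ x : Fin n → Space d, (∏ m, g (t, x m, ξ m)) *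
        testFactor ν (coordDir (Fin n) d) θ (fun y => ∏ m, b m (y m))
          (t, x, fun i => V (t, x i, ξ i)) =
      deriv θ t * ∏ m, pairing g (fun p => b m p.2.1) (t, ξ m) +
        θ t * ∑ i, (∏ j ∈ Finset.univ.erase i, pairing g (fun p => b j p.2.1) (t, ξ j)) *
          pairing g (spaceFactor ν V (b i)) (t, ξ i) := by
  set β : Fin n → ℝ × Space d × I → ℝ := fun m p => b m p.2.1
  set γ : Fin n → ℝ × Space d × I → ℝ := fun m => spaceFactor ν V (b m)
  have hβm (m : Fin n) : Measurable (β m) := (hb m).continuous.measurable.comp (by fun_prop)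
  have hβA (m : Fin n) : ∃ A, ∀ p, |β m p| ≤ A := by
    obtain ⟨A, hA⟩ := (hbc m).exists_bound_of_continuous (hb m).continuous
    exact ⟨A, fun p => hA _⟩
  have hγm (m : Fin n) : Measurable (γ m) := measurable_spaceFactor (hb m) hV
  have hγA (m : Fin n) : ∃ A, ∀ p, |γ m p| ≤ A := exists_abs_spaceFactor_le (hb m) (hbc m) hVB
  have hint (δ : Fin n → ℝ × Space d × I → ℝ) (hδ : ∀ m, Measurable (δ m))
      (hδA : ∀ m, ∃ A, ∀ p, |δ m p| ≤ A) : Integrable fun x : Fin n → Space d =>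
        (∏ m, g (t, x m, ξ m)) * ∏ m, δ m (t, x m, ξ m) := by
    simp_rw [← Finset.prod_mul_distrib]
    refine Integrable.fintype_prod (f := fun m x => g (t, x, ξ m) * δ m (t, x, ξ m)) fun m => ?_
    obtain ⟨A, hA⟩ := hδA m
    exact hg.integrable_mul (hδ m) hA t (ξ m)
  have hi₀ := hint β hβm hβA
  -- The `i`-th Leibniz term is again a product of one-particle functions, with the factor `β i`
  -- replaced by `γ i`. Fubini therefore factors its integral into pairings.
  have hi (i : Fin n) := hint (Function.update β i (γ i))
    (fun m => by
      rcases eq_or_ne m i with rfl | hm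
      · rw [Function.update_self]; exact hγm m
      · rw [Function.update_of_ne hm]; exact hβm m)
    (fun m => by
      rcases eq_or_ne m i with rfl | hm
      · rw [Function.update_self]; exact hγA m
      · rw [Function.update_of_ne hm]; exact hβA m)
  have e (i : Fin n) (x : Fin n → Space d) :
      ∏ m, Function.update β i (γ i) m (t, x m, ξ m) =
        (∏ j ∈ Finset.univ.erase i, b j (x j)) * γ i (t, x i, ξ i) :=
    prod_update (fun m (δ : ℝ × Space d × I → ℝ) => δ (t, x m, ξ m)) β i (γ i)
  have e' (i : Fin n) : ∏ m, pairing g (Function.update β i (γ i) m) (t, ξ m) =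
      (∏ j ∈ Finset.univ.erase i, pairing g (β j) (t, ξ j)) * pairing g (γ i) (t, ξ i) :=
    prod_update (fun m (δ : ℝ × Space d × I → ℝ) => pairing g δ (t, ξ m)) β i (γ i)
  change _ = deriv θ t * ∏ m, pairing g (β m) (t, ξ m) +
    θ t * ∑ i, (∏ j ∈ Finset.univ.erase i, pairing g (β j) (t, ξ j)) * pairing g (γ i) (t, ξ i)
  simp_rw [← e', ← integral_prod_mul_prod]
  rw [← integral_finsetSum _ fun i _ => hi i, ← integral_const_mul, ← integral_const_mul,
    ← integral_add (hi₀.const_mul _) ((integrable_finsetSum _ fun i _ => hi i).const_mul _)]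
  refine integral_congr_ae (Eventually.of_forall fun x => ?_)
  simp only [testFactor_prod hb, e, β, γ, mul_add, Finset.mul_sum]
  congr 1
  · ring
  · refine Finset.sum_congr rfl fun i _ => ?_
    ring

lemma integrable_weight_mul_testFactor (hg : IsDensity g C) (hV : Measurable V)
    (hVB : ∀ p, ‖V p‖ ≤ B) (hS : Measurable S) (hSA : ∀ ξ, |S ξ| ≤ A)
    {ι : Type*} [Fintype ι] (e : ι → Fin n → Space d) {G : (Fin n → Space d) → ℝ}
    (hG : ContDiff ℝ ∞ G) (hGc : HasCompactSupport G) {θ : ℝ → ℝ} (hθ : IsTestFunction 0 T θ)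
    (lam : Measure ℝ) [IsFiniteMeasure lam] :
    Integrable (fun p : ℝ × (Fin n → Space d) × (Fin n → I) =>
      (S p.2.2 * ∏ m, g (p.1, p.2.1 m, p.2.2 m)) *
        testFactor ν e θ G (p.1, p.2.1, fun i => V (p.1, p.2.1 i, p.2.2 i)))
      (lam.prod (volume.prod M)) := by
  have hB : 0 ≤ B := (norm_nonneg _).trans (hVB (0, 0, 0))
  obtain ⟨A', hA'⟩ := exists_abs_testFactor_le hθ hG hGc ν e B
  have hVm := measurable_field_pi (n := n) hV
  refine (hg.integrable_time_weight hS hSA lam).mul_bdd (c := A') ?_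
    (Eventually.of_forall fun p => hA' _ (norm_field_pi_le hB hVB p))
  exact ((continuous_testFactor hθ hG ν e).measurable.comp
    (f := fun p : ℝ × (Fin n → Space d) × (Fin n → I) =>
      (p.1, p.2.1, (fun i => V (p.1, p.2.1 i, p.2.2 i) : Fin n → Space d)))
    (by fun_prop)).aestronglyMeasurable

/-- For almost every labelling the space integral turns the expression into the product rule for the
scalar functions `u m`, whose integral over time vanishes. Integrating this against the weight `S`
gives the claim. -/
lemma IsWeakSolution.integral_weight_mul_testFactor {K : Space d → Space d}
    {w : I → SignedMeasure I} {f : ℝ → Space d → I → ℝ} (hsol : IsWeakSolution K ν T w f)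
    (hT : 0 < T) (hg : IsDensity g C) (hV : Measurable V) (hVB : ∀ p, ‖V p‖ ≤ B)
    (hfg : ∀ᵐ t ∂(volume.restrict (Ioo 0 T)), ∀ᵐ ξ : I, (∀ᵐ x, f t x ξ = g (t, x, ξ)) ∧
      ∀ x, velocity K w f t x ξ = V (t, x, ξ))
    (hM : ∀ m, Measure.QuasiMeasurePreserving (fun ξ : Fin n → I => ξ m) M volume)
    (hS : Measurable S) (hSA : ∀ ξ, |S ξ| ≤ A)
    (hb : ∀ i, ContDiff ℝ ∞ (b i)) (hbc : ∀ i, HasCompactSupport (b i)) {θ : ℝ → ℝ}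
    (hθ : IsTestFunction 0 T θ) :
    ∫ p : ℝ × (Fin n → Space d) × (Fin n → I),
      (S p.2.2 * ∏ m, g (p.1, p.2.1 m, p.2.2 m)) *
        testFactor ν (coordDir (Fin n) d) θ (fun y => ∏ m, b m (y m))
          (p.1, p.2.1, fun i => V (p.1, p.2.1 i, p.2.2 i))
      ∂((volume.restrict (Ioo 0 T)).prod (volume.prod M)) = 0 := by
  set lam : Measure ℝ := volume.restrict (Ioo 0 T)
  set u : Fin n → ℝ × I → ℝ := fun m => pairing g (fun p => b m p.2.1)
  set v : Fin n → ℝ × I → ℝ := fun m => pairing g (spaceFactor ν V (b m))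
  have hum (m : Fin n) : Measurable (u m) :=
    measurable_pairing hg ((hb m).continuous.measurable.comp (by fun_prop))
  have hvm (m : Fin n) : Measurable (v m) := measurable_pairing hg (measurable_spaceFactor (hb m) hV)
  have huv (m : Fin n) : ∃ A, (∀ p, |u m p| ≤ A) ∧ ∀ p, |v m p| ≤ A := by
    obtain ⟨A₁, h₁⟩ := (hbc m).exists_bound_of_continuous (hb m).continuous
    obtain ⟨A₂, h₂⟩ := exists_abs_spaceFactor_le (ν := ν) (hb m) (hbc m) hVB
    exact ⟨max (C * A₁) (C * A₂),
      fun p => (abs_pairing_le hg (fun q => h₁ _) p).trans (le_max_left _ _),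
      fun p => (abs_pairing_le hg h₂ p).trans (le_max_right _ _)⟩
  choose A' hu hv using huv
  -- The absolutely continuous marginals of `M` transfer the statement for almost every single label
  -- to all vertices simultaneously.
  have hprim : ∀ᵐ ξ ∂M, ∀ m, ∃ c, ∀ᵐ t ∂lam, u m (t, ξ m) = c + ∫ s in 0..t, v m (s, ξ m) :=
    ae_all_iff.2 fun m => (hM m).ae (ae_exists_ae_eq_const_add_integral hT (hum m) (hvm m) (hu m)
      (hv m) fun θ hθ c hc hcc => hsol.integral_pairing hg hV hVB hfg (hb m) (hbc m) hθ hc hcc)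
  set U : ℝ × (Fin n → I) → ℝ := fun q => deriv θ q.1 * ∏ m, u m (q.1, q.2 m) +
    θ q.1 * ∑ i, (∏ j ∈ Finset.univ.erase i, u j (q.1, q.2 j)) * v i (q.1, q.2 i) with hU
  have hUz : ∀ᵐ ξ ∂M, ∫ t, U (t, ξ) ∂lam = 0 := by
    filter_upwards [hprim] with ξ hξ
    refine integral_deriv_mul_prod_add hT (u := fun m t => u m (t, ξ m))
      (v := fun m t => v m (t, ξ m)) (fun m => ?_) hξ hθ
    exact Integrable.of_bound ((hvm m).comp (by fun_prop)).aestronglyMeasurable (A' m)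
      (Eventually.of_forall fun t => hv m _)
  have hF := integrable_weight_mul_testFactor (ν := ν) (M := M) hg hV hVB hS hSA
    (coordDir (Fin n) d) (ContDiff.fintype_prod_apply hb) (HasCompactSupport.fintype_prod_apply hbc)
    hθ lam
  have hi : Integrable (fun q : ℝ × (Fin n → I) => S q.2 * U q) (lam.prod M) := by
    have hae := MeasurePreserving.prod (MeasurePreserving.id lam)
      (Measure.measurePreserving_swap (μ := M) (ν := (volume : Measure (Fin n → Space d))))
    have h1 := ((measurePreserving_prodAssoc lam M
      (volume : Measure (Fin n → Space d)))).integrable_comp_of_integrable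
        (hae.integrable_comp_of_integrable hF)
    refine h1.integral_prod_left.congr (Eventually.of_forall fun q => ?_)
    simp only [Function.comp_apply, MeasurableEquiv.prodAssoc, MeasurableEquiv.coe_mk,
      Equiv.prodAssoc_apply, Prod.map_apply, id_eq, Prod.swap_prod_mk, mul_assoc]
    rw [integral_const_mul, integral_prod_mul_testFactor hg hV hVB hb hbc θ q.1 q.2]
  rw [integral_prod _ hF]
  calc _ = ∫ t, ∫ ξ, S ξ * U (t, ξ) ∂M ∂lam := by
        refine integral_congr_ae (hF.prod_right_ae.mono fun t ht => ?_)
        simp only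
        rw [integral_prod_symm _ ht]
        simp only [mul_assoc, integral_const_mul,
          integral_prod_mul_testFactor hg hV hVB hb hbc θ t]
        rfl
    _ = ∫ ξ, ∫ t, S ξ * U (t, ξ) ∂lam ∂M := integral_integral_swap hi
    _ = 0 := by
        refine integral_eq_zero_of_ae (hUz.mono fun ξ hξ => ?_)
        simp only [integral_const_mul, hξ, mul_zero, Pi.zero_apply]

end Tensor

/-! ### Translations, time slices and integration by parts -/

section DirDeriv

variable {E : Type*} [NormedAddCommGroup E] [NormedSpace ℝ E] {ι : Type*} [Fintype ι]

lemma dirDeriv_comp_sub_const (v : E) (P : E → ℝ) (y : E) :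
    dirDeriv v (fun x => P (x - y)) = fun x => dirDeriv v P (x - y) := by
  funext x
  simp only [dirDeriv, fderiv_comp_sub]

lemma sumSecondDeriv_comp_sub_const (e : ι → E) (P : E → ℝ) (y : E) :
    sumSecondDeriv e (fun x => P (x - y)) = fun x => sumSecondDeriv e P (x - y) := by
  funext x
  simp only [sumSecondDeriv, dirDeriv_comp_sub_const]

lemma dirDeriv_const_sub {P : E → ℝ} (hP : ContDiff ℝ ∞ P) (v x : E) :
    dirDeriv v (fun y => P (x - y)) = fun y => -dirDeriv v P (x - y) := by
  funext y
  have h : HasFDerivAt (fun y => P (x - y)) _ y :=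
    ((hP.differentiable (by simp) (x - y)).hasFDerivAt).comp y ((hasFDerivAt_id y).const_sub x)
  rw [dirDeriv, h.fderiv]
  simp [dirDeriv]

lemma dirDeriv_neg (v : E) (P : E → ℝ) : dirDeriv v (fun y => -P y) = fun y => -dirDeriv v P y := by
  funext y
  simp [dirDeriv, fderiv_fun_neg]

lemma sumSecondDeriv_const_sub {P : E → ℝ} (hP : ContDiff ℝ ∞ P) (e : ι → E) (x : E) :
    sumSecondDeriv e (fun y => P (x - y)) = fun y => sumSecondDeriv e P (x - y) := by
  funext y
  simp only [sumSecondDeriv, dirDeriv_const_sub hP, dirDeriv_neg,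
    dirDeriv_const_sub (hP.dirDeriv _), neg_neg]

lemma dirDeriv_slice {φ : ℝ × E → ℝ} (hφ : ContDiff ℝ ∞ φ) (v : E) (t : ℝ) :
    dirDeriv v (fun x => φ (t, x)) = fun x => dirDeriv (0, v) φ (t, x) := by
  funext x
  have h : HasFDerivAt (fun x => φ (t, x)) _ x :=
    ((hφ.differentiable (by simp) (t, x)).hasFDerivAt).comp x (hasFDerivAt_prodMk_right t x)
  rw [dirDeriv, h.fderiv]
  simp [dirDeriv]

lemma sumSecondDeriv_slice {φ : ℝ × E → ℝ} (hφ : ContDiff ℝ ∞ φ) (e : ι → E) (t : ℝ) :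
    sumSecondDeriv e (fun x => φ (t, x)) =
      fun x => sumSecondDeriv (fun i => ((0 : ℝ), e i)) φ (t, x) := by
  funext x
  simp only [sumSecondDeriv, dirDeriv_slice hφ, dirDeriv_slice (hφ.dirDeriv _)]

lemma deriv_slice {φ : ℝ × E → ℝ} (hφ : ContDiff ℝ ∞ φ) (x : E) (t : ℝ) :
    deriv (fun s => φ (s, x)) t = dirDeriv (1, 0) φ (t, x) := by
  have h : HasFDerivAt (fun s => φ (s, x)) _ t :=
    ((hφ.differentiable (by simp) (t, x)).hasFDerivAt).comp t (hasFDerivAt_prodMk_left t x)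
  rw [← fderiv_apply_one_eq_deriv, h.fderiv]
  simp [dirDeriv]

lemma dirDeriv_one_add {φ : ℝ × E → ℝ} (h : E) (q : ℝ × E) :
    dirDeriv (1, h) φ q = dirDeriv (1, 0) φ q + dirDeriv (0, h) φ q := by
  simp only [dirDeriv, ← map_add, Prod.mk_add_mk, add_zero, zero_add]

variable [FiniteDimensional ℝ E] [MeasureSpace E] [BorelSpace E]
  [(volume : Measure E).IsAddHaarMeasure] {ψ Q : E → ℝ}

lemma integral_mul_dirDeriv (hψ : ContDiff ℝ ∞ ψ) (hψc : HasCompactSupport ψ)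
    (hQ : ContDiff ℝ ∞ Q) (v : E) :
    ∫ x, ψ x * dirDeriv v Q x = -∫ x, dirDeriv v ψ x * Q x := by
  refine integral_mul_fderiv_eq_neg_fderiv_mul_of_integrable ?_ ?_ ?_
    (fun x _ => hψ.differentiable (by simp) x) (fun x _ => hQ.differentiable (by simp) x)
  · exact ((hψ.dirDeriv v).continuous.mul hQ.continuous).integrable_of_hasCompactSupport
      ((hψc.dirDeriv v).mul_right)
  · exact (hψ.continuous.mul (hQ.dirDeriv v).continuous).integrable_of_hasCompactSupport
      hψc.mul_right
  · exact (hψ.continuous.mul hQ.continuous).integrable_of_hasCompactSupport hψc.mul_right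

lemma integral_mul_sumSecondDeriv (hψ : ContDiff ℝ ∞ ψ) (hψc : HasCompactSupport ψ)
    (hQ : ContDiff ℝ ∞ Q) (e : ι → E) :
    ∫ x, ψ x * sumSecondDeriv e Q x = ∫ x, sumSecondDeriv e ψ x * Q x := by
  simp only [sumSecondDeriv, Finset.mul_sum, Finset.sum_mul]
  rw [integral_finsetSum _ fun i _ => ?_, integral_finsetSum _ fun i _ => ?_]
  · refine Finset.sum_congr rfl fun i _ => ?_
    rw [integral_mul_dirDeriv hψ hψc (hQ.dirDeriv _),
      integral_mul_dirDeriv (hψ.dirDeriv _) (hψc.dirDeriv _) hQ, neg_neg]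
  · exact (((hψ.dirDeriv _).dirDeriv _).continuous.mul
      hQ.continuous).integrable_of_hasCompactSupport ((hψc.dirDeriv _).dirDeriv _).mul_right
  · exact (hψ.continuous.mul
      ((hQ.dirDeriv _).dirDeriv _).continuous).integrable_of_hasCompactSupport hψc.mul_right

end DirDeriv

lemma hasCompactSupport_slice {E : Type*} [TopologicalSpace E] [R1Space E] {φ : ℝ × E → ℝ}
    (hφc : HasCompactSupport φ) (t : ℝ) :
    HasCompactSupport fun x => φ (t, x) := by
  have hc : IsCompact (Prod.snd '' tsupport φ) := hφc.isCompact.image continuous_snd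
  refine HasCompactSupport.intro hc fun x hx => image_eq_zero_of_notMem_tsupport fun h => hx ?_
  exact ⟨(t, x), h, rfl⟩

lemma integral_add_add_const_mul {X : Type*} [MeasurableSpace X] {μ : Measure X} {f₁ f₂ f₃ : X → ℝ}
    {ν : ℝ} (h₁ : Integrable f₁ μ) (h₂ : Integrable f₂ μ) (h₃ : Integrable f₃ μ) :
    ∫ x, (f₁ x + f₂ x + ν * f₃ x) ∂μ = ∫ x, f₁ x ∂μ + ∫ x, f₂ x ∂μ + ν * ∫ x, f₃ x ∂μ := by
  rw [← integral_const_mul, ← integral_add h₁ h₂]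
  exact integral_add (h₁.add h₂) (h₃.const_mul ν)

/-! ### From mollifiers to general test functions -/

section Mollify

variable {E : Type*} [NormedAddCommGroup E] [NormedSpace ℝ E] {ι : Type*} [Fintype ι]

/-- The operator `∂_t φ + h · ∇φ + ν ∑ D²φ` applied to a test function of time and space. -/
def testOperator (ν : ℝ) (e : ι → E) (φ : ℝ × E → ℝ) (q : ℝ × E × E) : ℝ :=
  dirDeriv (1, q.2.2) φ (q.1, q.2.1) + ν * sumSecondDeriv (fun i => ((0 : ℝ), e i)) φ (q.1, q.2.1)

variable {ν : ℝ} {e : ι → E} {φ : ℝ × E → ℝ} {T B : ℝ}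

lemma continuous_testOperator (hφ : ContDiff ℝ ∞ φ) : Continuous (testOperator ν e φ) := by
  have h4 := hφ.continuous_sumSecondDeriv fun i => ((0 : ℝ), e i)
  have h5 : Continuous fun q : ℝ × E × E => dirDeriv (1, q.2.2) φ (q.1, q.2.1) :=
    ((hφ.continuous_fderiv (by simp)).comp (by fun_prop)).clm_apply (by fun_prop)
  unfold testOperator
  fun_prop

lemma exists_abs_testOperator_le (hφ : ContDiff ℝ ∞ φ) (hφc : HasCompactSupport φ) (B : ℝ) :
    ∃ A, ∀ q : ℝ × E × E, ‖q.2.2‖ ≤ B → |testOperator ν e φ q| ≤ A := by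
  obtain ⟨A₃, hA₃⟩ := (hφc.fderiv ℝ).exists_bound_of_continuous (hφ.continuous_fderiv (by simp))
  obtain ⟨A₄, hA₄⟩ := (hφc.sumSecondDeriv fun i => ((0 : ℝ), e i)).exists_bound_of_continuous
    (hφ.continuous_sumSecondDeriv _)
  have p₃ := (norm_nonneg _).trans (hA₃ 0)
  refine ⟨A₃ * max 1 B + |ν| * A₄, fun q hq => (abs_add_le _ _).trans (add_le_add ?_ ?_)⟩
  · refine ((fderiv ℝ φ _).le_opNorm _).trans (mul_le_mul (hA₃ _) ?_ (norm_nonneg _) p₃)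
    rw [Prod.norm_mk, norm_one]
    exact max_le_max le_rfl hq
  · rw [abs_mul]
    exact mul_le_mul_of_nonneg_left (hA₄ _) (abs_nonneg _)

lemma isTestFunction_slice (hφ : ContDiff ℝ ∞ φ) (hφc : HasCompactSupport φ)
    (hφs : tsupport φ ⊆ Ioo 0 T ×ˢ univ) (x : E) : IsTestFunction 0 T fun t => φ (t, x) := by
  have hc : IsCompact (Prod.fst '' tsupport φ) := hφc.isCompact.image continuous_fst
  have hsub : tsupport (fun t => φ (t, x)) ⊆ Prod.fst '' tsupport φ := by
    refine closure_minimal (fun t ht => ?_) hc.isClosed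
    exact ⟨(t, x), subset_tsupport _ ht, rfl⟩
  refine ⟨by fun_prop, hc.of_isClosed_subset (isClosed_tsupport _) hsub, hsub.trans ?_⟩
  rintro _ ⟨q, hq, rfl⟩
  exact (hφs hq).1

variable [FiniteDimensional ℝ E] [MeasureSpace E] [BorelSpace E]
  [(volume : Measure E).IsAddHaarMeasure]

/-- Derivatives of `P (x - y)` in `y` are, up to sign, derivatives in `x`, and integration by parts
moves them onto `φ`: the two signs cancel at first order, and none arises at second order. The
vector `h` does not depend on `x`, so no derivative falls on the velocity. -/
lemma integral_testFactor_const_sub (hφ : ContDiff ℝ ∞ φ) (hφc : HasCompactSupport φ)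
    {P : E → ℝ} (hP : ContDiff ℝ ∞ P) (t : ℝ) (y h : E) :
    ∫ x, testFactor ν e (fun s => φ (s, x)) (fun z => P (x - z)) (t, y, h) =
      ∫ x, P (x - y) * testOperator ν e φ (t, x, h) := by
  have hQ : ContDiff ℝ ∞ fun x => P (x - y) := by fun_prop
  have hψ : ContDiff ℝ ∞ fun x => φ (t, x) := by fun_prop
  have hψc := hasCompactSupport_slice hφc t
  have hτ : ContDiff ℝ ∞ fun x => dirDeriv (1, 0) φ (t, x) :=
    (hφ.dirDeriv (1, 0)).comp (by fun_prop)
  have hτc := hasCompactSupport_slice (hφc.dirDeriv (1, 0)) t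
  have j₁ : Integrable fun x => dirDeriv (1, 0) φ (t, x) * P (x - y) :=
    (hτ.continuous.mul hQ.continuous).integrable_of_hasCompactSupport hτc.mul_right
  have j₂ : Integrable fun x => φ (t, x) * dirDeriv h (fun x => P (x - y)) x :=
    (hψ.continuous.mul (hQ.dirDeriv h).continuous).integrable_of_hasCompactSupport hψc.mul_right
  have j₃ : Integrable fun x => φ (t, x) * sumSecondDeriv e (fun x => P (x - y)) x :=
    (hψ.continuous.mul (hQ.continuous_sumSecondDeriv e)).integrable_of_hasCompactSupport
      hψc.mul_right
  have j₂n : Integrable fun x => -(φ (t, x) * dirDeriv h (fun x => P (x - y)) x) := j₂.neg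
  have j₂' : Integrable fun x => dirDeriv h (fun x => φ (t, x)) x * P (x - y) :=
    ((hψ.dirDeriv h).continuous.mul hQ.continuous).integrable_of_hasCompactSupport
      (hψc.dirDeriv h).mul_right
  have j₃' : Integrable fun x => sumSecondDeriv e (fun x => φ (t, x)) x * P (x - y) :=
    ((hψ.continuous_sumSecondDeriv e).mul hQ.continuous).integrable_of_hasCompactSupport
      (hψc.sumSecondDeriv e).mul_right
  calc _ = ∫ x, (dirDeriv (1, 0) φ (t, x) * P (x - y)
          + -(φ (t, x) * dirDeriv h (fun x => P (x - y)) x))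
          + ν * (φ (t, x) * sumSecondDeriv e (fun x => P (x - y)) x) := by
        refine integral_congr_ae (Eventually.of_forall fun x => ?_)
        simp only [testFactor, deriv_slice hφ, dirDeriv_const_sub hP, sumSecondDeriv_const_sub hP,
          dirDeriv_comp_sub_const, sumSecondDeriv_comp_sub_const]
        ring
    _ = ∫ x, (dirDeriv (1, 0) φ (t, x) * P (x - y)
          + dirDeriv h (fun x => φ (t, x)) x * P (x - y))
          + ν * (sumSecondDeriv e (fun x => φ (t, x)) x * P (x - y)) := by
        rw [integral_add_add_const_mul j₁ j₂n j₃, integral_neg,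
          integral_mul_dirDeriv hψ hψc hQ, integral_mul_sumSecondDeriv hψ hψc hQ,
          integral_add_add_const_mul j₁ j₂' j₃', neg_neg]
    _ = _ := by
        refine integral_congr_ae (Eventually.of_forall fun x => ?_)
        simp only [testOperator, dirDeriv_one_add h, dirDeriv_slice hφ, sumSecondDeriv_slice hφ]
        ring

variable {Y : Type*} [MeasurableSpace Y] {μ : Measure Y} [SFinite μ] {F : Y → ℝ} {τ : Y → ℝ}
  {y h : Y → E}

/-- Apply `H` with `θ = φ(·, x)` for each centre `x` and integrate over `x`. Only the compact
projection of the support of `φ` contributes, so the bounded integrand allows Fubini. -/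
lemma integral_mul_integral_testOperator (hF : Integrable F μ) (hτ : Measurable τ)
    (hy : Measurable y) (hh : Measurable h) (hhB : ∀ p, ‖h p‖ ≤ B) {P : E → ℝ}
    (hP : ContDiff ℝ ∞ P) (hPc : HasCompactSupport P)
    (H : ∀ θ, IsTestFunction 0 T θ → ∀ x,
      ∫ p, F p * testFactor ν e θ (fun z => P (x - z)) (τ p, y p, h p) ∂μ = 0)
    (hφ : ContDiff ℝ ∞ φ) (hφc : HasCompactSupport φ) (hφs : tsupport φ ⊆ Ioo 0 T ×ˢ univ) :
    ∫ p, F p * (∫ x, P (x - y p) * testOperator ν e φ (τ p, x, h p)) ∂μ = 0 := by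
  set S : Set E := Prod.snd '' tsupport φ
  have hS : IsCompact S := hφc.isCompact.image continuous_snd
  have hz {x : E} (hx : x ∉ S) (t : ℝ) : φ (t, x) = 0 :=
    image_eq_zero_of_notMem_tsupport fun h => hx ⟨(t, x), h, rfl⟩
  set W : Y × E → ℝ := fun r =>
    testFactor ν e (fun s => φ (s, r.2)) (fun z => P (r.2 - z)) (τ r.1, y r.1, h r.1) with hW
  have hWeq : W = (fun q : ℝ × E × E × E => dirDeriv (1, 0) φ (q.1, q.2.1) * P (q.2.1 - q.2.2.1) +
      φ (q.1, q.2.1) * (-dirDeriv q.2.2.2 P (q.2.1 - q.2.2.1) +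
        ν * sumSecondDeriv e P (q.2.1 - q.2.2.1))) ∘
      fun r : Y × E => (τ r.1, r.2, y r.1, h r.1) := by
    funext r
    simp only [hW, testFactor, deriv_slice hφ, dirDeriv_const_sub hP, sumSecondDeriv_const_sub hP,
      Function.comp_apply]
  have hWm : Measurable W := by
    rw [hWeq]
    refine Measurable.comp (Continuous.measurable ?_) (by fun_prop)
    have h1 := (hφ.dirDeriv (1, 0)).continuous
    have h2 := hφ.continuous
    have h3 := hP.continuous
    have h4 := hP.continuous_sumSecondDeriv e
    have h5 : Continuous fun q : ℝ × E × E × E => dirDeriv q.2.2.2 P (q.2.1 - q.2.2.1) :=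
      ((hP.continuous_fderiv (by simp)).comp (by fun_prop)).clm_apply (by fun_prop)
    fun_prop
  obtain ⟨A₀, hA₀⟩ := hφc.exists_bound_of_continuous hφ.continuous
  obtain ⟨A₁, hA₁⟩ := (hφc.dirDeriv (1, 0)).exists_bound_of_continuous
    (hφ.dirDeriv (1, 0)).continuous
  obtain ⟨A₂, hA₂⟩ := hPc.exists_bound_of_continuous hP.continuous
  obtain ⟨A₃, hA₃⟩ := (hPc.fderiv ℝ).exists_bound_of_continuous (hP.continuous_fderiv (by simp))
  obtain ⟨A₄, hA₄⟩ := (hPc.sumSecondDeriv e).exists_bound_of_continuous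
    (hP.continuous_sumSecondDeriv e)
  have p₀ := (norm_nonneg _).trans (hA₀ 0)
  have p₁ := (norm_nonneg _).trans (hA₁ 0)
  have p₃ := (norm_nonneg _).trans (hA₃ 0)
  have hWA (r : Y × E) : ‖W r‖ ≤ A₁ * A₂ + A₀ * (A₃ * B + ‖ν‖ * A₄) := by
    rw [hWeq]
    refine (norm_add_le _ _).trans ?_
    rw [norm_mul, norm_mul]
    refine add_le_add (mul_le_mul (hA₁ _) (hA₂ _) (norm_nonneg _) p₁)
      (mul_le_mul (hA₀ _) ((norm_add_le _ _).trans (add_le_add ?_ ?_)) (norm_nonneg _) p₀)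
    · rw [norm_neg]
      exact ((fderiv ℝ P _).le_opNorm _).trans (mul_le_mul (hA₃ _) (hhB _) (norm_nonneg _) p₃)
    · rw [norm_mul]
      exact mul_le_mul_of_nonneg_left (hA₄ _) (norm_nonneg _)
  have : IsFiniteMeasure ((volume : Measure E).restrict S) :=
    ⟨by simpa using hS.measure_lt_top⟩
  have hi : Integrable (fun r : Y × E => F r.1 * W r) (μ.prod (volume.restrict S)) :=
    (hF.comp_fst _).mul_bdd hWm.aestronglyMeasurable (Eventually.of_forall hWA)
  have e1 (p : Y) : ∫ x in S, F p * W (p, x) =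
      F p * ∫ x, P (x - y p) * testOperator ν e φ (τ p, x, h p) := by
    rw [integral_const_mul, ← integral_testFactor_const_sub hφ hφc hP,
      setIntegral_eq_integral_of_forall_compl_eq_zero]
    intro x hx
    simp [hW, testFactor, hz hx]
  simp_rw [← e1]
  rw [integral_integral_swap hi]
  refine integral_eq_zero_of_ae (Eventually.of_forall fun x => ?_)
  exact H _ (isTestFunction_slice hφ hφc hφs x) x

/-- For fixed `p` the vector `h p` is constant, so the mollified function is continuous in `x` and
converges at the point `y p`. Domination by `‖F p‖ * A` then requires nothing of `h` beyond
measurability and boundedness. -/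
lemma integral_mul_testOperator_eq_zero (hF : Integrable F μ) (hτ : Measurable τ)
    (hy : Measurable y) (hh : Measurable h) (hhB : ∀ p, ‖h p‖ ≤ B) {P : ℕ → E → ℝ}
    (hP : ∀ k, ContDiff ℝ ∞ (P k)) (hPc : ∀ k, HasCompactSupport (P k))
    (hP0 : ∀ k x, 0 ≤ P k x) (hP1 : ∀ k, ∫ x, P k x = 1)
    (hPs : Tendsto (fun k => Function.support (P k)) atTop (𝓝 0).smallSets)
    (H : ∀ k θ, IsTestFunction 0 T θ → ∀ x,
      ∫ p, F p * testFactor ν e θ (fun z => P k (x - z)) (τ p, y p, h p) ∂μ = 0)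
    (hφ : ContDiff ℝ ∞ φ) (hφc : HasCompactSupport φ) (hφs : tsupport φ ⊆ Ioo 0 T ×ˢ univ) :
    ∫ p, F p * testOperator ν e φ (τ p, y p, h p) ∂μ = 0 := by
  obtain ⟨A, hA⟩ := exists_abs_testOperator_le (ν := ν) (e := e) hφ hφc B
  have hc := continuous_testOperator (ν := ν) (e := e) hφ
  have hPi (k : ℕ) (z : E) : Integrable fun x => P k (x - z) :=
    ((hP k).continuous.integrable_of_hasCompactSupport (hPc k)).comp_sub_right z
  have hlim : Tendsto (fun k => ∫ p, F p * (∫ x, P k (x - y p) *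
      testOperator ν e φ (τ p, x, h p)) ∂μ) atTop
      (𝓝 (∫ p, F p * testOperator ν e φ (τ p, y p, h p) ∂μ)) := by
    refine tendsto_integral_of_dominated_convergence (fun p => ‖F p‖ * A) (fun k => ?_)
      (hF.norm.mul_const A) (fun k => Eventually.of_forall fun p => ?_)
      (Eventually.of_forall fun p => ?_)
    · refine hF.1.mul (Measurable.aestronglyMeasurable ?_)
      have h1 : Measurable fun r : Y × E => P k (r.2 - y r.1) *
          testOperator ν e φ (τ r.1, r.2, h r.1) := by
        have h2 := (hP k).continuous.measurable
        have h3 := hc.measurable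
        fun_prop
      exact h1.stronglyMeasurable.integral_prod_right'.measurable
    · rw [norm_mul]
      refine mul_le_mul_of_nonneg_left ?_ (norm_nonneg _)
      refine (norm_integral_le_of_norm_le ((hPi k (y p)).mul_const A)
        (Eventually.of_forall fun x => ?_)).trans (le_of_eq ?_)
      · rw [norm_mul, Real.norm_of_nonneg (hP0 k _)]
        exact mul_le_mul_of_nonneg_left (hA _ (hhB p)) (hP0 k _)
      · rw [integral_mul_const, integral_sub_right_eq_self (P k), hP1, one_mul]
    · refine Tendsto.const_mul _ ?_
      -- Reflecting `z` and evaluating at `-y p` makes the convolution equal `∫ P k x * testOperator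
      -- ν e φ (τ p, y p + x, h p)`, which becomes the required integral after a translation.
      have hg : Continuous fun z => testOperator ν e φ (τ p, -z, h p) := by fun_prop
      have := convolution_tendsto_right (μ := volume) (φ := P) (l := atTop) (x₀ := -y p)
        (g := fun _ z => testOperator ν e φ (τ p, -z, h p)) (k := fun _ => -y p)
        (z₀ := testOperator ν e φ (τ p, y p, h p))
        (Eventually.of_forall hP0) (Eventually.of_forall hP1) hPs
        (Eventually.of_forall fun _ => hg.aestronglyMeasurable)
        ((hg.tendsto' _ _ (by simp)).comp tendsto_snd) tendsto_const_nhds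
      refine this.congr fun k => ?_
      rw [convolution, ← integral_sub_right_eq_self _ (y p)]
      refine integral_congr_ae (Eventually.of_forall fun x => ?_)
      simp
  refine tendsto_nhds_unique hlim (tendsto_const_nhds.congr fun k => ?_)
  exact (integral_mul_integral_testOperator hF hτ hy hh hhB (hP k) (hPc k) (H k) hφ hφc hφs).symm

end Mollify

/-! ### The hierarchy in the sense of distributions -/

section Hierarchy

lemma exists_mollifiers (d : ℕ) : ∃ η : ℕ → Space d → ℝ, (∀ k, ContDiff ℝ ∞ (η k)) ∧
    (∀ k, HasCompactSupport (η k)) ∧ (∀ k x, 0 ≤ η k x) ∧ (∀ k, ∫ x, η k x = 1) ∧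
      ∀ k, Function.support (η k) = Metric.ball 0 (1 / ((k : ℝ) + 1)) := by
  let ψ (k : ℕ) : ContDiffBump (0 : Space d) :=
    ⟨1 / ((k : ℝ) + 1) / 2, 1 / ((k : ℝ) + 1), by positivity, half_lt_self (by positivity)⟩
  exact ⟨fun k => (ψ k).normed volume, fun k => (ψ k).contDiff_normed,
    fun k => (ψ k).hasCompactSupport_normed, fun k => (ψ k).nonneg_normed,
    fun k => (ψ k).integral_normed, fun k => (ψ k).support_normed_eq⟩

lemma tendsto_support_prod_smallSets {ι X : Type*} [Fintype ι] [SeminormedAddCommGroup X]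
    {η : ℕ → X → ℝ}
    (hη : ∀ k, Function.support (η k) = Metric.ball 0 (1 / ((k : ℝ) + 1))) :
    Tendsto (fun k => Function.support fun x : ι → X => ∏ i, η k (x i)) atTop (𝓝 0).smallSets := by
  rw [Metric.nhds_basis_ball.smallSets.tendsto_right_iff]
  intro ε hε
  filter_upwards [tendsto_one_div_add_atTop_nhds_zero_nat.eventually (gt_mem_nhds hε)] with k hk x hx
  rw [mem_ball_zero_iff, pi_norm_lt_iff hε]
  intro i
  have h1 : x i ∈ Function.support (η k) := Finset.prod_ne_zero_iff.1 hx i (Finset.mem_univ i)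
  rw [hη, mem_ball_zero_iff] at h1
  exact h1.trans hk

variable {d n : ℕ} {g : ℝ × Space d × I → ℝ} {C : ℝ≥0} {B ν T A : ℝ}
  {V : ℝ × Space d × I → Space d} {M : Measure (Fin n → I)} [IsProbabilityMeasure M]
  {S : (Fin n → I) → ℝ} {φ : ℝ × (Fin n → Space d) → ℝ}

lemma IsWeakSolution.integral_weight_mul_testOperator {K : Space d → Space d}
    {w : I → SignedMeasure I} {f : ℝ → Space d → I → ℝ} (hsol : IsWeakSolution K ν T w f)
    (hT : 0 < T) (hg : IsDensity g C) (hV : Measurable V) (hVB : ∀ p, ‖V p‖ ≤ B)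
    (hfg : ∀ᵐ t ∂(volume.restrict (Ioo 0 T)), ∀ᵐ ξ : I, (∀ᵐ x, f t x ξ = g (t, x, ξ)) ∧
      ∀ x, velocity K w f t x ξ = V (t, x, ξ))
    (hM : ∀ m, Measure.QuasiMeasurePreserving (fun ξ : Fin n → I => ξ m) M volume)
    (hS : Measurable S) (hSA : ∀ ξ, |S ξ| ≤ A)
    (hφ : ContDiff ℝ ∞ φ) (hφc : HasCompactSupport φ) (hφs : tsupport φ ⊆ Ioo 0 T ×ˢ univ) :
    ∫ p : ℝ × (Fin n → Space d) × (Fin n → I),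
      (S p.2.2 * ∏ m, g (p.1, p.2.1 m, p.2.2 m)) *
        testOperator ν (coordDir (Fin n) d) φ (p.1, p.2.1, fun i => V (p.1, p.2.1 i, p.2.2 i))
      ∂((volume.restrict (Ioo 0 T)).prod (volume.prod M)) = 0 := by
  obtain ⟨η, h1, h2, h3, h4, h5⟩ := exists_mollifiers d
  have hB : 0 ≤ B := (norm_nonneg _).trans (hVB (0, 0, 0))
  -- With a product mollifier, `z ↦ P k (x - z)` is for each centre `x` the tensor product of the
  -- functions `z_m ↦ η k (x_m - z_m)`, so the result for product test functions supplies the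
  -- hypothesis.
  refine integral_mul_testOperator_eq_zero (P := fun k x => ∏ m, η k (x m))
    (τ := fun p : ℝ × (Fin n → Space d) × (Fin n → I) => p.1) (y := fun p => p.2.1)
    (h := fun p i => V (p.1, p.2.1 i, p.2.2 i)) (hg.integrable_time_weight hS hSA _) measurable_fst
    (by fun_prop) (measurable_field_pi hV) (norm_field_pi_le hB hVB)
    (fun k => ContDiff.fintype_prod_apply fun _ => h1 k)
    (fun k => HasCompactSupport.fintype_prod_apply fun _ => h2 k)
    (fun k x => Finset.prod_nonneg fun m _ => h3 k _) (fun k => ?_)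
    (tendsto_support_prod_smallSets h5) (fun k θ hθ x => ?_) hφ hφc hφs
  · rw [integral_fintype_prod_volume_eq_prod (fun _ : Fin n => η k)]
    simp [h4]
  · refine hsol.integral_weight_mul_testFactor hT hg hV hVB hfg hM hS hSA
      (b := fun m z => η k (x m - z)) (fun m => (h1 k).comp (contDiff_const.sub contDiff_id))
      (fun m => ?_) hθ
    exact (h2 k).comp_homeomorph (Homeomorph.subLeft (x m))

lemma IsDensity.integral_weight_mul (hg : IsDensity g C) (hS : Measurable S)
    (hSA : ∀ ξ, |S ξ| ≤ A) {W : ℝ × (Fin n → Space d) × (Fin n → I) → ℝ} (hW : Measurable W)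
    (hWB : ∀ p, |W p| ≤ B) (lam : Measure ℝ) [IsFiniteMeasure lam] :
    Integrable (fun p : ℝ × (Fin n → Space d) × (Fin n → I) =>
          (S p.2.2 * ∏ m, g (p.1, p.2.1 m, p.2.2 m)) * W p)
        (lam.prod (volume.prod M)) ∧
      ∫ p : ℝ × (Fin n → Space d) × (Fin n → I),
          (S p.2.2 * ∏ m, g (p.1, p.2.1 m, p.2.2 m)) * W p ∂(lam.prod (volume.prod M)) =
        ∫ t, (∫ x, ∫ ξ, (S ξ * ∏ m, g (t, x m, ξ m)) * W (t, x, ξ) ∂M) ∂lam := by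
  have hi : Integrable (fun p : ℝ × (Fin n → Space d) × (Fin n → I) =>
        (S p.2.2 * ∏ m, g (p.1, p.2.1 m, p.2.2 m)) * W p)
      (lam.prod (volume.prod M)) :=
    (hg.integrable_time_weight hS hSA lam).mul_bdd hW.aestronglyMeasurable
      (Eventually.of_forall hWB)
  refine ⟨hi, ?_⟩
  rw [integral_prod _ hi]
  exact integral_congr_ae (hi.prod_right_ae.mono fun t ht => integral_prod _ ht)

variable {κ : Kernel I I} [IsMarkovKernel κ] {s : I × I → ℝ} {D : ℝ} {w : I → SignedMeasure I}
  {f : ℝ → Space d → I → ℝ} {K K' : Space d → Space d}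

lemma integral_mul_tau (hw : IsGraphonKernel w κ s D) (hg : IsDensity g C)
    (hfg : ∀ᵐ p ∂((volume.restrict (Ioo 0 T)).prod (volume.prod volume)),
      f p.1 p.2.1 p.2.2 = g p) (G : LabeledTree n) {a : ℝ × (Fin n → Space d) → ℝ}
    (ha : Continuous a) (hac : HasCompactSupport a) :
    Integrable (fun p : ℝ × (Fin n → Space d) × (Fin n → I) =>
        (treeWeight s G p.2.2 * ∏ m, g (p.1, p.2.1 m, p.2.2 m)) * a (p.1, p.2.1))
        ((volume.restrict (Ioo 0 T)).prod (volume.prod (treeMeasure κ G))) ∧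
      ∫ t in Ioo 0 T, ∫ x, a (t, x) * tau G w (f t) x =
        ∫ p : ℝ × (Fin n → Space d) × (Fin n → I),
          (treeWeight s G p.2.2 * ∏ m, g (p.1, p.2.1 m, p.2.2 m)) * a (p.1, p.2.1)
          ∂((volume.restrict (Ioo 0 T)).prod (volume.prod (treeMeasure κ G))) := by
  obtain ⟨A, hA, hSA⟩ := abs_treeWeight_le hw.abs_le G
  obtain ⟨A', hA'⟩ := hac.exists_bound_of_continuous ha
  obtain ⟨h1, h2⟩ := hg.integral_weight_mul (M := treeMeasure κ G)
    (measurable_treeWeight hw.measurable G) hSA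
    (W := fun p => a (p.1, p.2.1)) (ha.measurable.comp (by fun_prop)) (fun p => hA' _)
    (volume.restrict (Ioo 0 T))
  refine ⟨h1, h2.trans ?_ |>.symm⟩
  refine integral_congr_ae ((Measure.ae_ae_of_ae_prod (ae_tau_eq hw hg hfg G)).mono fun t ht =>
    integral_congr_ae (ht.mono fun x hx => ?_))
  simp only [hx, observable]
  rw [integral_mul_const, mul_comm]

lemma fderiv_comp_update_slice (hφ : ContDiff ℝ ∞ φ) (t : ℝ) (x : Fin n → Space d) (i : Fin n)
    (v : Space d) : fderiv ℝ (fun y => φ (t, Function.update x i y)) (x i) v =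
      dirDeriv (0, Pi.single i v) φ (t, x) := by
  have h : ContDiff ℝ ∞ fun x => φ (t, x) := by fun_prop
  rw [fderiv_comp_update h, Function.update_eq_self, dirDeriv_slice hφ]

lemma integral_fderiv_comp_update (hKK : K =ᵐ[volume] K')
    (hK : Measurable K') (hKB : ∀ x, ‖K' x‖ ≤ B) (hw : IsGraphonKernel w κ s D) (hg : IsDensity g C)
    (hfg : ∀ᵐ p ∂((volume.restrict (Ioo 0 T)).prod (volume.prod volume)),
      f p.1 p.2.1 p.2.2 = g p) (G : LabeledTree n) (i : Fin n)
    (hφ : ContDiff ℝ ∞ φ) (hφc : HasCompactSupport φ) :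
    Integrable (fun p : ℝ × (Fin n → Space d) × (Fin n → I) =>
        (treeWeight s G p.2.2 * ∏ m, g (p.1, p.2.1 m, p.2.2 m)) *
          fderiv ℝ (fun y => φ (p.1, Function.update p.2.1 i y)) (p.2.1 i)
            (field K' κ s g (p.1, p.2.1 i, p.2.2 i)))
        ((volume.restrict (Ioo 0 T)).prod (volume.prod (treeMeasure κ G))) ∧
      ∫ t in Ioo 0 T, ∫ x, fderiv ℝ (fun y => φ (t, Function.update x i y)) (x i)
          (∫ z, tau (G.addLeaf i) w (f t) (Fin.snoc (α := fun _ => Space d) x z) • K (x i - z)) =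
        ∫ p : ℝ × (Fin n → Space d) × (Fin n → I),
          (treeWeight s G p.2.2 * ∏ m, g (p.1, p.2.1 m, p.2.2 m)) *
          fderiv ℝ (fun y => φ (p.1, Function.update p.2.1 i y)) (p.2.1 i)
            (field K' κ s g (p.1, p.2.1 i, p.2.2 i))
          ∂((volume.restrict (Ioo 0 T)).prod (volume.prod (treeMeasure κ G))) := by
  obtain ⟨A, hA, hSA⟩ := abs_treeWeight_le hw.abs_le G
  have hS := measurable_treeWeight hw.measurable G
  have hV := measurable_field (κ := κ) hK hg hw.measurable
  have hVB := norm_field_le (κ := κ) hKB hg hw.abs_le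
  set W : ℝ × (Fin n → Space d) × (Fin n → I) → ℝ := fun p =>
    fderiv ℝ (fun y => φ (p.1, Function.update p.2.1 i y)) (p.2.1 i)
      (field K' κ s g (p.1, p.2.1 i, p.2.2 i)) with hWdef
  have hWeq : W = fun p => dirDeriv (0, Pi.single i (field K' κ s g (p.1, p.2.1 i, p.2.2 i))) φ
      (p.1, p.2.1) := funext fun p => fderiv_comp_update_slice hφ _ _ _ _
  have hWm : Measurable W := by
    have h1 : Continuous fun q : (ℝ × (Fin n → Space d)) × Space d =>
        dirDeriv (0, Pi.single i q.2) φ q.1 := by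
      refine ((hφ.continuous_fderiv (by simp)).comp continuous_fst).clm_apply ?_
      exact continuous_const.prodMk ((continuous_single i).comp continuous_snd)
    rw [hWeq]
    exact h1.measurable.comp (f := fun p : ℝ × (Fin n → Space d) × (Fin n → I) =>
      ((p.1, p.2.1), field K' κ s g (p.1, p.2.1 i, p.2.2 i))) (by fun_prop)
  obtain ⟨A₃, hA₃⟩ := (hφc.fderiv ℝ).exists_bound_of_continuous (hφ.continuous_fderiv (by simp))
  have hWB (p) : |W p| ≤ A₃ * (D * (C * B)) := by
    rw [hWeq]
    refine ((fderiv ℝ φ _).le_opNorm _).trans (mul_le_mul (hA₃ _) ?_ (norm_nonneg _)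
      ((norm_nonneg _).trans (hA₃ 0)))
    rw [Prod.norm_mk, norm_zero, Pi.norm_single]
    exact max_le ((norm_nonneg _).trans (hVB (0, 0, 0))) (hVB _)
  obtain ⟨h1, h2⟩ := hg.integral_weight_mul (M := treeMeasure κ G) hS hSA hWm hWB
    (volume.restrict (Ioo 0 T))
  refine ⟨h1, h2.trans ?_ |>.symm⟩
  have hJ := ae_integral_tau_addLeaf_smul hKK hK hKB hw hg hfg G i
  refine integral_congr_ae (hJ.mono fun t ht => integral_congr_ae ?_)
  filter_upwards [ht, (hg.integrable_weight (M := treeMeasure κ G) hS hSA t).prod_right_ae]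
    with x hx1 hx2
  simp only [hx1, hWdef]
  -- The derivative of `φ` is a fixed linear map once `t` and `x` are fixed, so it passes inside the
  -- integral over labels that represents the flux.
  rw [← ContinuousLinearMap.integral_comp_comm]
  · simp only [map_smul, smul_eq_mul]
  · exact hx2.smul_bdd (D * (C * B)) (hV.comp (f := fun ξ : Fin n → I => (t, x i, ξ i))
      (by fun_prop)).aestronglyMeasurable (Eventually.of_forall fun ξ => hVB _)

lemma continuous_laplacian_comp_update (hφ : ContDiff ℝ ∞ φ) (i : Fin n) :
    Continuous fun q : ℝ × (Fin n → Space d) =>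
      Δ (fun y => φ (q.1, Function.update q.2 i y)) (q.2 i) := by
  have h (t : ℝ) : ContDiff ℝ ∞ fun x => φ (t, x) := by fun_prop
  have e (q : ℝ × (Fin n → Space d)) := laplacian_comp_update (h q.1) q.2 i
  simp only [e, sumSecondDeriv_slice hφ]
  exact hφ.continuous_sumSecondDeriv _

lemma hasCompactSupport_laplacian_comp_update (hφ : ContDiff ℝ ∞ φ) (hφc : HasCompactSupport φ)
    (i : Fin n) :
    HasCompactSupport fun q : ℝ × (Fin n → Space d) =>
      Δ (fun y => φ (q.1, Function.update q.2 i y)) (q.2 i) := by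
  have h (t : ℝ) : ContDiff ℝ ∞ fun x => φ (t, x) := by fun_prop
  have e (q : ℝ × (Fin n → Space d)) := laplacian_comp_update (h q.1) q.2 i
  simp only [e, sumSecondDeriv_slice hφ]
  exact hφc.sumSecondDeriv _

lemma testOperator_coordDir (hφ : ContDiff ℝ ∞ φ) (t : ℝ) (x v : Fin n → Space d) :
    testOperator ν (coordDir (Fin n) d) φ (t, x, v) = deriv (fun s => φ (s, x)) t +
      ∑ i, fderiv ℝ (fun y => φ (t, Function.update x i y)) (x i) (v i) +
        ν * ∑ i, Δ (fun y => φ (t, Function.update x i y)) (x i) := by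
  have h : ContDiff ℝ ∞ fun x => φ (t, x) := by fun_prop
  rw [sum_fderiv_comp_update h, sum_laplacian_comp_update h, sumSecondDeriv_slice hφ,
    dirDeriv_slice hφ, deriv_slice hφ, testOperator, dirDeriv_one_add]

lemma solvesInDistributions_tau (hsol : IsWeakSolution K ν T w f) (hT : 0 < T)
    (hKK : K =ᵐ[volume] K') (hK : Measurable K') (hKB : ∀ x, ‖K' x‖ ≤ B)
    (hw : IsGraphonKernel w κ s D) (hg : IsDensity g C)
    (hfg : ∀ᵐ p ∂((volume.restrict (Ioo 0 T)).prod (volume.prod volume)),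
      f p.1 p.2.1 p.2.2 = g p) (G : LabeledTree n) :
    SolvesInDistributions ν T (fun t => tau G w (f t)) fun i t x =>
      ∫ z, tau (G.addLeaf i) w (f t) (Fin.snoc (α := fun _ => Space d) x z) • K (x i - z) := by
  intro φ hφ hφc hφs
  obtain ⟨A, hA, hSA⟩ := abs_treeWeight_le hw.abs_le G
  have key := hsol.integral_weight_mul_testOperator hT hg
    (measurable_field (κ := κ) hK hg hw.measurable) (norm_field_le (κ := κ) hKB hg hw.abs_le)
    (ae_velocity_eq_field hKK hK hKB hw hg hfg)
    (quasiMeasurePreserving_eval_treeMeasure hw.comp_absolutelyContinuous G)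
    (measurable_treeWeight hw.measurable G) hSA hφ hφc hφs
  have hdt := fun (t : ℝ) (x : Fin n → Space d) => deriv_slice hφ x t
  obtain ⟨i₁, e₁⟩ := integral_mul_tau hw hg hfg G (a := fun q => dirDeriv (1, 0) φ q)
    (hφ.dirDeriv _).continuous (hφc.dirDeriv _)
  choose i₂ e₂ using fun i => integral_fderiv_comp_update hKK hK hKB hw hg hfg G i hφ hφc
  choose i₃ e₃ using fun i => integral_mul_tau hw hg hfg G
    (continuous_laplacian_comp_update hφ i) (hasCompactSupport_laplacian_comp_update hφ hφc i)
  simp only [hdt, e₂]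
  simp only [e₁, e₃]
  have s₂ := integral_finsetSum (G := ℝ) Finset.univ fun i _ => i₂ i
  have s₃ := integral_finsetSum (G := ℝ) Finset.univ fun i _ => i₃ i
  -- All terms are now integrals over the same space of times, positions and labels; together they
  -- form the integral of the weak operator applied to `φ`, which `key` shows to be zero.
  rw [← s₂, ← s₃, ← integral_add_add_const_mul i₁ (integrable_finsetSum Finset.univ fun i _ => i₂ i)
      (integrable_finsetSum Finset.univ fun i _ => i₃ i)]
  refine (integral_congr_ae (Eventually.of_forall fun p => ?_)).trans key
  simp only [testOperator_coordDir hφ, hdt, ← Finset.mul_sum]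
  ring

end Hierarchy

end

theorem mainTheorem8 {d : ℕ} (K : Space d → Space d) (hK : MemLp K ∞ volume)
    (ν : ℝ) (hν : 0 ≤ ν) (tstar : ℝ) (htstar : 0 < tstar)
    (w : I → SignedMeasure I) (hw : IsExtendedGraphon w)
    (f : ℝ → Space d → I → ℝ) (hf : MemLinftyLinftyL1 tstar f)
    (hsol : IsWeakSolution K ν tstar w f)
    {n : ℕ} (T : LabeledTree n) :
    MemLinftyL1 tstar (fun t => tau T w (f t)) ∧
      SolvesInDistributions ν tstar (fun t => tau T w (f t))
        (fun i t x => ∫ z, tau (T.addLeaf i) w (f t)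
          (Fin.snoc (α := fun _ => Space d) x z) • K (x i - z)) := by
  obtain ⟨κ, hκ, s, D, hs⟩ := hw.exists_kernel
  obtain ⟨g, C, hg, hfg⟩ := hf.exists_isDensity
  obtain ⟨K', B, hK', hKB, hKK⟩ := exists_measurable_bounded_ae_eq hK
  exact ⟨memLinftyL1_tau hs hg hfg T, solvesInDistributions_tau hsol htstar hKK hK' hKB hs hg hfg T⟩
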